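/- Let $\lambda,\gamma,T>0$. There exists a constant $c_4>0$, depending only on $\lambda,\gamma,T$, such that the following holds. Let $d\ge 0$ and $N,P\ge 1$ be integers with $P/N=\gamma$, let $K:\mathbb R^d\times\mathbb R^d\to\mathbb R$ be a symmetric positive semidefinite kernel, let $X=(x_1,\dots,x_N)\in(\mathbb R^d)^N$ be such that the kernel matrix $K(X,X)=(K(x_i,x_j))_{i,j}$ is positive definite (for instance: $K$ strictly positive definite and the $x_i$ distinct), with $\frac1N\operatorname{Tr}K(X,X)=T$, and let $y\in\mathbb R^N$. Let $f^{(1)},\dots,f^{(P)}$ be i.i.d. samples of the centered Gaussian process on $\mathbb R^d$ with covariance $K$, and let $\hat f^{(RF)}_{\lambda}(x)=\frac1{\sqrt P}\sum_{j=1}^P\hat\theta_j f^{(j)}(x)$ be the random feature predictor, where $\hat\theta$ is the unique minimizer over $\theta\in\mathbb R^P$ of $$\frac1N\sum_{i=1}^N\Big(\frac1{\sqrt P}\sum_{j=1}^P\theta_jf^{(j)}(x_i)-y_i\Big)^2+\frac{\lambda}{N}\|\theta\|^2,$$ that is, $\hat\theta=F^T(FF^T+\lambda I_N)^{-1}y$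 with $F_{ij}=\frac1{\sqrt P}f^{(j)}(x_i)$. Let $d_1,\dots,d_N$ be the eigenvalues of $K(X,X)$. For $\ell>0$ let $\tilde\lambda(\ell)$, the effective ridge, be the unique positive number satisfying $$\tilde\lambda=\ell+\frac{\tilde\lambda}{\gamma}\,\frac1N\sum_{i=1}^N\frac{d_i}{\tilde\lambda+d_i}.$$ Write $\tilde\lambda=\tilde\lambda(\lambda)$ and let $\partial_\lambda\tilde\lambda$ be the derivative of $\ell\mapsto\tilde\lambda(\ell)$ at $\ell=\lambda$ (which exists). Set $M_{\tilde\lambda}=K(X,X)\,(K(X,X)+\tilde\lambda I_N)^{-2}$, $\|y\|_{K^{-1}}^2=y^TK(X,X)^{-1}y$, and $\tilde K(x,x)=K(x,x)-K(x,X)K(X,X)^{-1}K(X,x)$ (the posterior covariance), where $K(x,X)=(K(x,x_i))_i$ and $K(X,x)=K(x,X)^T$. Then for every $x\in\mathbb R^d$ the random variable $\hat f^{(RF)}_{\lambda}(x)$ is square-integrable and $$\operatorname{Var}\big(\hat f^{(RF)}_{\lambda}(x)\big)\;\ge\;\partial_\lambda\tilde\lambda\,\frac{y^TM_{\tilde\lambda}\,y}{P}\,\tilde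 K(x,x)-\frac{c_4\,K(x,x)\,\|y\|_{K^{-1}}^2}{P^2}.$$ -/

import Mathlib

open MeasureTheory ProbabilityTheory Matrix

namespace RandomFeatures

/-! ### The linear model and its regularized least squares parameters -/

/-- The linear model `f_θ = P^{-1/2} (θ₁ φ⁽¹⁾ + ⋯ + θ_P φ⁽ᴾ⁾)` for the features `φ`. -/
noncomputable def linearModel {S : Type*} {P : ℕ} (φ : Fin P → S → ℝ) (θ : Fin P → ℝ) (x : S) : ℝ :=
  (1 / √(P : ℝ)) * ∑ j, θ j * φ j x

/-- The regularized mean square error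
`(1/N) ∑ᵢ (f_θ(xᵢ) - yᵢ)² + (λ/N) ‖θ‖²`. -/
noncomputable def ridgeLoss {S : Type*} {N P : ℕ} (lam : ℝ) (φ : Fin P → S → ℝ) (X : Fin N → S)
    (y : Fin N → ℝ) (θ : Fin P → ℝ) : ℝ :=
  (1 / (N : ℝ)) * ∑ i, (linearModel φ θ (X i) - y i) ^ 2 + (lam / (N : ℝ)) * ∑ j, θ j ^ 2

/-- The data matrix `F`, with entries `F i j = P^{-1/2} φ⁽ʲ⁾(xᵢ)`. -/
noncomputable def dataMatrix {S : Type*} {N P : ℕ} (φ : Fin P → S → ℝ) (X : Fin N → S) :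
    Matrix (Fin N) (Fin P) ℝ :=
  Matrix.of fun i j => (1 / √(P : ℝ)) * φ j (X i)

/-- The optimal parameters `θ̂ = Fᵀ (F Fᵀ + λ I)⁻¹ y`. By `ridgeLoss_optimalParam_lt` below they
are the unique minimizer of `ridgeLoss`. -/
noncomputable def optimalParam {S : Type*} {N P : ℕ} (lam : ℝ) (φ : Fin P → S → ℝ) (X : Fin N → S)
    (y : Fin N → ℝ) : Fin P → ℝ :=
  (dataMatrix φ X)ᵀ *ᵥ
    ((dataMatrix φ X * (dataMatrix φ X)ᵀ + lam • (1 : Matrix (Fin N) (Fin N) ℝ))⁻¹ *ᵥ y)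

theorem linearModel_eq {S : Type*} {N P : ℕ} (φ : Fin P → S → ℝ) (X : Fin N → S) (θ : Fin P → ℝ)
    (i : Fin N) : linearModel φ θ (X i) = (dataMatrix φ X *ᵥ θ) i := by
  simp only [linearModel, dataMatrix, Matrix.mulVec, dotProduct, Matrix.of_apply, Finset.mul_sum]
  exact Finset.sum_congr rfl fun j _ => by ring

/-- `optimalParam` is the unique minimizer of the regularized mean square error. -/
theorem ridgeLoss_optimalParam_lt {S : Type*} {N P : ℕ} {lam : ℝ} (hlam : 0 < lam) (hN : 0 < N)
    (φ : Fin P → S → ℝ) (X : Fin N → S) (y : Fin N → ℝ) (θ : Fin P → ℝ)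
    (hθ : θ ≠ optimalParam lam φ X y) :
    ridgeLoss lam φ X y (optimalParam lam φ X y) < ridgeLoss lam φ X y θ := by
  set F := dataMatrix φ X with hF
  set A := F * Fᵀ + lam • (1 : Matrix (Fin N) (Fin N) ℝ) with hA
  set v := A⁻¹ *ᵥ y with hv
  have hθ0 : optimalParam lam φ X y = Fᵀ *ᵥ v := rfl
  have hpd : A.PosDef := by
    refine Matrix.PosDef.posSemidef_add ?_ (Matrix.PosDef.one.smul hlam)
    simpa [Matrix.conjTranspose_eq_transpose_of_trivial] using
      Matrix.posSemidef_self_mul_conjTranspose F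
  have hAv : A *ᵥ v = y := by
    rw [hv, Matrix.mulVec_mulVec,
      Matrix.mul_nonsing_inv _ ((Matrix.isUnit_iff_isUnit_det _).1 hpd.isUnit), Matrix.one_mulVec]
  have hres : F *ᵥ (Fᵀ *ᵥ v) - y = -(lam • v) := by
    rw [← hAv, hA, Matrix.add_mulVec, Matrix.mulVec_mulVec, Matrix.smul_mulVec, Matrix.one_mulVec]
    abel
  have hloss : ∀ η : Fin P → ℝ, ridgeLoss lam φ X y η =
      (1 / (N : ℝ)) * ((F *ᵥ η - y) ⬝ᵥ (F *ᵥ η - y) + lam * (η ⬝ᵥ η)) := by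
    intro η
    simp only [ridgeLoss, linearModel_eq, ← hF, dotProduct, Pi.sub_apply, ← sq]
    ring
  obtain ⟨h, rfl⟩ : ∃ h, θ = Fᵀ *ᵥ v + h := ⟨θ - Fᵀ *ᵥ v, by abel⟩
  have hh : h ≠ 0 := by
    rintro rfl
    exact hθ (by rw [hθ0, add_zero])
  have hpos : 0 < h ⬝ᵥ h := by
    have := (Matrix.dotProduct_star_self_pos_iff (v := h)).2 hh
    simpa using this
  have hnn : 0 ≤ (F *ᵥ h) ⬝ᵥ (F *ᵥ h) := Finset.sum_nonneg fun i _ => mul_self_nonneg _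
  have hcross : (F *ᵥ h) ⬝ᵥ v = h ⬝ᵥ (Fᵀ *ᵥ v) := by
    rw [Matrix.mulVec_transpose, dotProduct_comm, Matrix.dotProduct_mulVec, dotProduct_comm]
  have hNr : 0 < 1 / (N : ℝ) := by positivity
  rw [hθ0, hloss, hloss]
  refine mul_lt_mul_of_pos_left ?_ hNr
  have e : F *ᵥ (Fᵀ *ᵥ v + h) - y = -(lam • v) + F *ᵥ h := by
    rw [Matrix.mulVec_add, ← hres]; abel
  rw [e, hres]
  simp only [add_dotProduct, dotProduct_add, neg_dotProduct, dotProduct_neg, smul_dotProduct,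
    dotProduct_smul, smul_eq_mul]
  rw [dotProduct_comm v (F *ᵥ h), hcross, dotProduct_comm (Fᵀ *ᵥ v) h]
  nlinarith [mul_pos hlam hpos]

/-- The random feature predictor `f̂(x) = P^{-1/2} ∑ⱼ θ̂ⱼ φ⁽ʲ⁾(x)`, for one realization `φ` of the
features. -/
noncomputable def rfPredictor {S : Type*} {N P : ℕ} (lam : ℝ) (φ : Fin P → S → ℝ) (X : Fin N → S)
    (y : Fin N → ℝ) (x : S) : ℝ :=
  linearModel φ (optimalParam lam φ X y) x

/-- `f⁽¹⁾, …, f⁽ᴾ⁾` are i.i.d. samples of the centered Gaussian process with covariance `K`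
(the mean and the covariance determine the law of a Gaussian process, so that the `f⁽ʲ⁾` are
identically distributed). -/
structure IsGaussianFeatures {S Ω : Type*} [MeasurableSpace Ω] {P : ℕ} (K : S → S → ℝ)
    (f : Fin P → S → Ω → ℝ) (μ : Measure Ω) : Prop where
  measurable : ∀ j x, Measurable (f j x)
  isGaussianProcess : ∀ j, IsGaussianProcess (f j) μ
  mean : ∀ j x, ∫ ω, f j x ω ∂μ = 0
  covariance : ∀ j x x', ∫ ω, f j x ω * f j x' ω ∂μ = K x x'
  indep : iIndepFun (fun j ω x => f j x ω) μ

/-! ### Kernel quantities -/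

/-- The kernel matrix `K(X, X)`. -/
def gram {S : Type*} {N : ℕ} (K : S → S → ℝ) (X : Fin N → S) : Matrix (Fin N) (Fin N) ℝ :=
  Matrix.of fun i j => K (X i) (X j)

/-- The posterior covariance kernel
`K̃(x, x') = K(x, x') - K(x, X) K(X, X)⁻¹ K(X, x')`. -/
noncomputable def posteriorCov {S : Type*} {N : ℕ} (K : S → S → ℝ) (X : Fin N → S) (x x' : S) : ℝ :=
  K x x' - (fun i => K x (X i)) ⬝ᵥ ((gram K X)⁻¹ *ᵥ fun i => K (X i) x')

/-- The inverse kernel norm `‖y‖_{G⁻¹} = √(yᵀ G⁻¹ y)`. -/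
noncomputable def invKernelNorm {N : ℕ} (G : Matrix (Fin N) (Fin N) ℝ) (y : Fin N → ℝ) : ℝ :=
  √(y ⬝ᵥ (G⁻¹ *ᵥ y))

/-- `M_t = G (G + t I)⁻²`. -/
noncomputable def ridgeMatrix {N : ℕ} (G : Matrix (Fin N) (Fin N) ℝ) (t : ℝ) :
    Matrix (Fin N) (Fin N) ℝ :=
  G * ((G + t • (1 : Matrix (Fin N) (Fin N) ℝ))⁻¹) ^ 2

/-! ### The effective ridge -/

/-- `t` is a positive solution of the effective ridge equation
`t = λ + (t / γ) (1 / N) ∑ᵢ dᵢ / (t + dᵢ)`. -/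
def IsEffectiveRidge {N : ℕ} (d : Fin N → ℝ) (γ lam t : ℝ) : Prop :=
  0 < t ∧ t = lam + t / γ * ((1 / (N : ℝ)) * ∑ i, d i / (t + d i))

theorem existsUnique_isEffectiveRidge {N : ℕ} {d : Fin N → ℝ} (hd : ∀ i, 0 ≤ d i) {γ lam : ℝ}
    (hγ : 0 < γ) (hlam : 0 < lam) : ∃! t, IsEffectiveRidge d γ lam t := by
  have hN : (0 : ℝ) ≤ 1 / (N : ℝ) := by positivity
  set s : ℝ → ℝ := fun t => 1 / γ * ((1 / (N : ℝ)) * ∑ i, d i / (t + d i)) with hs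
  have hiff : ∀ t, IsEffectiveRidge d γ lam t ↔ 0 < t ∧ t - t * s t = lam := by
    intro t
    have e : t / γ * ((1 / (N : ℝ)) * ∑ i, d i / (t + d i)) = t * s t := by
      simp only [hs]; ring
    rw [IsEffectiveRidge, e]
    exact ⟨fun h => ⟨h.1, by linarith [h.2]⟩, fun h => ⟨h.1, by linarith [h.2]⟩⟩
  have hsnn : ∀ t, 0 < t → 0 ≤ s t := fun t ht => by
    have : 0 ≤ ∑ i, d i / (t + d i) :=
      Finset.sum_nonneg fun i _ => div_nonneg (hd i) (by linarith [hd i])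
    simp only [hs]; positivity
  have hanti : ∀ t t', 0 < t → t ≤ t' → s t' ≤ s t := fun t t' ht htt => by
    have : ∑ i, d i / (t' + d i) ≤ ∑ i, d i / (t + d i) :=
      Finset.sum_le_sum fun i _ =>
        div_le_div_of_nonneg_left (hd i) (by linarith [hd i]) (by linarith)
    simp only [hs]; gcongr
  have hlt : ∀ t t', 0 < t → t < t' → t - t * s t = lam → t' - t' * s t' ≠ lam := by
    intro t t' ht htt h h'
    have h1 : 0 < 1 - s t := by
      by_contra hc
      nlinarith
    nlinarith [hanti t t' ht htt.le]
  set B : ℝ := 1 / γ * ((1 / (N : ℝ)) * ∑ i, d i) with hB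
  have hBnn : 0 ≤ B := by
    have : 0 ≤ ∑ i, d i := Finset.sum_nonneg fun i _ => hd i
    positivity
  have htop : (lam + B) * s (lam + B) ≤ B := by
    have hp : 0 < lam + B := by linarith
    have : (lam + B) * ∑ i, d i / (lam + B + d i) ≤ ∑ i, d i := by
      rw [Finset.mul_sum]
      refine Finset.sum_le_sum fun i _ => ?_
      have : 0 < lam + B + d i := by linarith [hd i]
      rw [← mul_div_assoc, div_le_iff₀ this]
      nlinarith [hd i, mul_nonneg (hd i) (hd i)]
    calc (lam + B) * s (lam + B)
        = 1 / γ * ((1 / (N : ℝ)) * ((lam + B) * ∑ i, d i / (lam + B + d i))) := by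
          simp only [hs]; ring
      _ ≤ B := by rw [hB]; gcongr
  have hcont : ContinuousOn (fun t => t - t * s t) (Set.Icc lam (lam + B)) := by
    refine continuousOn_id.sub (continuousOn_id.mul ?_)
    refine continuousOn_const.mul (continuousOn_const.mul ?_)
    refine continuousOn_finsetSum _ fun i _ => ?_
    refine continuousOn_const.div (continuousOn_id.add continuousOn_const) fun t ht => ?_
    have := hd i
    have := ht.1
    exact (by simp only [id]; linarith : (0 : ℝ) < id t + d i).ne'
  obtain ⟨t, ht, hte⟩ := intermediate_value_Icc (by linarith) hcont
    (show lam ∈ Set.Icc _ _ from ⟨by nlinarith [hsnn lam hlam], by linarith⟩)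
  have htpos : 0 < t := lt_of_lt_of_le hlam ht.1
  refine ⟨t, (hiff t).2 ⟨htpos, hte⟩, fun t' h' => ?_⟩
  obtain ⟨hp', he'⟩ := (hiff t').1 h'
  rcases lt_trichotomy t t' with hc | hc | hc
  · exact absurd he' (hlt t t' htpos hc hte)
  · exact hc.symm
  · exact absurd hte (hlt t' t hp' hc he')

open Classical in
/-- The effective ridge `λ̃(λ, γ)` for the eigenvalues `d`: the unique positive solution of the
effective ridge equation (and `0` for parameters for which that makes no sense). -/
noncomputable def effectiveRidge {N : ℕ} (d : Fin N → ℝ) (γ lam : ℝ) : ℝ :=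
  if h : ∃! t, IsEffectiveRidge d γ lam t then h.choose else 0

theorem isEffectiveRidge_effectiveRidge {N : ℕ} {d : Fin N → ℝ} (hd : ∀ i, 0 ≤ d i) {γ lam : ℝ}
    (hγ : 0 < γ) (hlam : 0 < lam) : IsEffectiveRidge d γ lam (effectiveRidge d γ lam) := by
  have h := existsUnique_isEffectiveRidge hd hγ hlam
  rw [effectiveRidge, dif_pos h]
  exact h.choose_spec.1

end RandomFeatures

set_option linter.unusedSectionVars false

/-! Split the value of each feature at `x` into its regression on the data values and a residual
`gⱼ`. The residual is Gaussian with variance `K̃(x,x)`, and joint Gaussianity makes the residuals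
independent of all data values. The optimal parameters `θ̂` depend only on the data values, so the
predictor is a function of the data plus `P^{-1/2} ∑ⱼ θ̂ⱼ gⱼ`. The second term is centred and
uncorrelated with the first, whence `Var ≥ K̃(x,x) E‖θ̂‖² / P` (`le_variance_rfPredictor`). It
remains to bound `E‖θ̂‖²` from below by `∂λ̃ · yᵀMy - C ‖y‖²_{K⁻¹} / P`; the factor `K̃(x,x) ≤
K(x,x)` then gives the stated error.

Diagonalize the kernel matrix as `U diag(d) Uᵀ` and whiten: the rows `zₖ` of `diag(d)^{-1/2} Uᵀ
(f⁽ʲ⁾(xᵢ))ᵢⱼ` are independent standard Gaussian vectors in `ℝᴾ`. With `H = (λ I + ∑ₖ (dₖ/P) zₖ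
zₖᵀ)⁻¹` one has `θ̂ = H ∑ₖ cₖ zₖ`, where `cₖ = P^{-1/2} dₖ vₖ`, `vₖ = (Uᵀy)ₖ / √dₖ` and `∑ vₖ² =
‖y‖²_{K⁻¹}`. Reversing the sign of one row preserves the law and `H`, so cross terms vanish and
`E‖θ̂‖² = ∑ cₖ² E‖H zₖ‖²`.

By Sherman–Morrison, `‖H zₖ‖² = B / (1 + (dₖ/P) A)²`, where `A` and `B` are the quadratic forms of
`zₖ` for `H₋ₖ` and `H₋ₖ²`, `H₋ₖ` being the resolvent without that row. Since `zₖ` is independent of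
`H₋ₖ`, both `A/P` and `B/P` have mean and mean square deviation within `O(1/P)` of those of the
constants `m = E tr H / P` and `q = E tr H² / P` (`looBounds`). A second-order expansion therefore
costs only `O(1/P)`, the linear term being small on average.

Taking traces in `H H⁻¹ = I` and `H H H⁻¹ = H` gives approximate equations for `m` and `q`. The
exact equation for `m` is solved by `1/λ̃`, and stability (`self_consistent_stability`) gives `m =
1/λ̃ + O(1/P)` and a lower bound for `q` in which the derivative of the effective ridge appears
(`le_integral_diagonal`).

Individual eigenvalues are not bounded in terms of `λ, γ, T`, only their mean is. Hence the
estimates use `d/(1+dm) ≤ 1/m`, with `m ≥ 1/(λ + T/γ)` by convexity, and the final expansion is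
one-sided, which suffices for a lower bound. -/

namespace RandomFeatures

/-! ### Resolvents of weighted Gram matrices, deterministic estimates. -/

section Resolvent

variable {ι κ : Type*} [Fintype ι] [DecidableEq ι] [Fintype κ] [DecidableEq κ]

/-- The weighted Gram matrix `∑ₖ uₖ zₖ zₖᵀ` of the rows `zₖ` of `Z`. -/
def weightedGram (u : ι → ℝ) (Z : ι → κ → ℝ) : Matrix κ κ ℝ :=
  ∑ k, u k • vecMulVec (Z k) (Z k)

/-- The resolvent `(l I + ∑ₖ uₖ zₖ zₖᵀ)⁻¹`. -/
noncomputable def resolvent (l : ℝ) (u : ι → ℝ) (Z : ι → κ → ℝ) : Matrix κ κ ℝ :=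
  (l • (1 : Matrix κ κ ℝ) + weightedGram u Z)⁻¹

theorem posSemidef_weightedGram {u : ι → ℝ} (hu : ∀ k, 0 ≤ u k) (Z : ι → κ → ℝ) :
    (weightedGram u Z).PosSemidef := by
  refine Matrix.posSemidef_sum _ fun k _ => ?_
  have := (Matrix.posSemidef_vecMulVec_self_star (Z k)).smul (hu k)
  simpa using this

/-- Removal of a row is modelled by setting it to zero, which deletes its rank-one term and leaves
the index type unchanged. -/
theorem weightedGram_eq_update_add (u : ι → ℝ) (Z : ι → κ → ℝ) (k : ι) :
    weightedGram u Z = weightedGram u (Function.update Z k 0) + u k • vecMulVec (Z k) (Z k) := by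
  unfold weightedGram
  rw [← Finset.add_sum_erase _ _ (Finset.mem_univ k),
    ← Finset.add_sum_erase Finset.univ (fun i => u i • vecMulVec (Function.update Z k 0 i) _)
      (Finset.mem_univ k)]
  rw [add_comm]
  congr 1
  simp only [Function.update_self, Matrix.zero_vecMulVec, smul_zero, zero_add]
  refine Finset.sum_congr rfl fun i hi => ?_
  rw [Function.update_of_ne (Finset.ne_of_mem_erase hi)]

variable {l : ℝ} {u : ι → ℝ}

theorem posDef_ridge (hl : 0 < l) (hu : ∀ k, 0 ≤ u k) (Z : ι → κ → ℝ) :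
    (l • (1 : Matrix κ κ ℝ) + weightedGram u Z).PosDef :=
  (Matrix.PosDef.one.smul hl).add_posSemidef (posSemidef_weightedGram hu Z)

theorem resolvent_mul (hl : 0 < l) (hu : ∀ k, 0 ≤ u k) (Z : ι → κ → ℝ) :
    resolvent l u Z * (l • (1 : Matrix κ κ ℝ) + weightedGram u Z) = 1 :=
  Matrix.nonsing_inv_mul _ ((Matrix.isUnit_iff_isUnit_det _).1 (posDef_ridge hl hu Z).isUnit)

theorem mul_resolvent (hl : 0 < l) (hu : ∀ k, 0 ≤ u k) (Z : ι → κ → ℝ) :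
    (l • (1 : Matrix κ κ ℝ) + weightedGram u Z) * resolvent l u Z = 1 :=
  Matrix.mul_nonsing_inv _ ((Matrix.isUnit_iff_isUnit_det _).1 (posDef_ridge hl hu Z).isUnit)

theorem transpose_resolvent (hl : 0 < l) (hu : ∀ k, 0 ≤ u k) (Z : ι → κ → ℝ) :
    (resolvent l u Z)ᵀ = resolvent l u Z := by
  have := (posDef_ridge hl hu Z).inv.isHermitian
  rwa [Matrix.IsHermitian, Matrix.conjTranspose_eq_transpose_of_trivial] at this

theorem dotProduct_resolvent_comm (hl : 0 < l) (hu : ∀ k, 0 ≤ u k) (Z : ι → κ → ℝ)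
    (v w : κ → ℝ) : v ⬝ᵥ (resolvent l u Z *ᵥ w) = (resolvent l u Z *ᵥ v) ⬝ᵥ w := by
  rw [Matrix.dotProduct_mulVec, ← Matrix.mulVec_transpose, transpose_resolvent hl hu]

/-- With `w = H v` one has `v = l w + W w` and `W ≥ 0`; pair with `w`. This is `l H² ≤ H`, the
source of all bounds by powers of `1/l` below. -/
theorem resolvent_sq_le (hl : 0 < l) (hu : ∀ k, 0 ≤ u k) (Z : ι → κ → ℝ) (v : κ → ℝ) :
    l * ((resolvent l u Z *ᵥ v) ⬝ᵥ (resolvent l u Z *ᵥ v)) ≤ v ⬝ᵥ (resolvent l u Z *ᵥ v) := by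
  set w := resolvent l u Z *ᵥ v with hw
  have hv : (l • (1 : Matrix κ κ ℝ) + weightedGram u Z) *ᵥ w = v := by
    rw [hw, Matrix.mulVec_mulVec, mul_resolvent hl hu, Matrix.one_mulVec]
  have hnn : 0 ≤ w ⬝ᵥ (weightedGram u Z *ᵥ w) := by
    simpa using (posSemidef_weightedGram hu Z).dotProduct_mulVec_nonneg w
  conv_rhs => rw [← hv]
  rw [Matrix.add_mulVec, Matrix.smul_mulVec, Matrix.one_mulVec, add_dotProduct, smul_dotProduct,
    dotProduct_comm (weightedGram u Z *ᵥ w)]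
  simpa using hnn

theorem dotProduct_self_nonneg' (v : κ → ℝ) : 0 ≤ v ⬝ᵥ v :=
  Finset.sum_nonneg fun _ _ => mul_self_nonneg _

theorem dotProduct_resolvent_nonneg (hl : 0 < l) (hu : ∀ k, 0 ≤ u k) (Z : ι → κ → ℝ)
    (v : κ → ℝ) : 0 ≤ v ⬝ᵥ (resolvent l u Z *ᵥ v) :=
  (mul_nonneg hl.le (dotProduct_self_nonneg' _)).trans (resolvent_sq_le hl hu Z v)

theorem dotProduct_resolvent_le (hl : 0 < l) (hu : ∀ k, 0 ≤ u k) (Z : ι → κ → ℝ)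
    (v : κ → ℝ) : v ⬝ᵥ (resolvent l u Z *ᵥ v) ≤ (v ⬝ᵥ v) / l := by
  have h := resolvent_sq_le hl hu Z v
  set w := resolvent l u Z *ᵥ v
  -- Expanding this square and using `l (w ⬝ᵥ w) ≤ v ⬝ᵥ w` leaves `l (v ⬝ᵥ w) ≤ v ⬝ᵥ v`.
  have h2 : 0 ≤ (v - l • w) ⬝ᵥ (v - l • w) := dotProduct_self_nonneg' _
  simp only [sub_dotProduct, dotProduct_sub, smul_dotProduct, dotProduct_smul, smul_eq_mul] at h2
  rw [dotProduct_comm w v] at h2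
  rw [le_div_iff₀ hl]
  nlinarith

theorem resolvent_mulVec_sq_le (hl : 0 < l) (hu : ∀ k, 0 ≤ u k) (Z : ι → κ → ℝ) (v : κ → ℝ) :
    (resolvent l u Z *ᵥ v) ⬝ᵥ (resolvent l u Z *ᵥ v) ≤ (v ⬝ᵥ v) / l ^ 2 := by
  have h := resolvent_sq_le hl hu Z v
  have h2 := dotProduct_resolvent_le hl hu Z v
  rw [le_div_iff₀ hl] at h2
  rw [le_div_iff₀ (by positivity)]
  nlinarith

theorem trace_resolvent_sq (hl : 0 < l) (hu : ∀ k, 0 ≤ u k) (Z : ι → κ → ℝ) :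
    (resolvent l u Z * resolvent l u Z).trace = ∑ i, ∑ j, resolvent l u Z i j ^ 2 := by
  simp only [Matrix.trace, Matrix.diag, Matrix.mul_apply]
  refine Finset.sum_congr rfl fun i _ => Finset.sum_congr rfl fun j _ => ?_
  have := congrFun (congrFun (transpose_resolvent hl hu Z) i) j
  rw [Matrix.transpose_apply] at this
  rw [this, sq]

theorem sum_resolvent_col_sq_le (hl : 0 < l) (hu : ∀ k, 0 ≤ u k) (Z : ι → κ → ℝ) (j : κ) :
    ∑ i, resolvent l u Z i j ^ 2 ≤ 1 / l ^ 2 := by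
  have := resolvent_mulVec_sq_le hl hu Z (Pi.single j 1)
  simpa [dotProduct, Matrix.mulVec_single_one, Matrix.col_apply, sq, Pi.single_apply] using this

theorem trace_resolvent_sq_le (hl : 0 < l) (hu : ∀ k, 0 ≤ u k) (Z : ι → κ → ℝ) :
    (resolvent l u Z * resolvent l u Z).trace ≤ Fintype.card κ / l ^ 2 := by
  rw [trace_resolvent_sq hl hu, Finset.sum_comm]
  calc _ ≤ ∑ _j : κ, 1 / l ^ 2 := Finset.sum_le_sum fun j _ => sum_resolvent_col_sq_le hl hu Z j
    _ = _ := by simp [div_eq_mul_inv]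

theorem trace_resolvent_sq_nonneg (hl : 0 < l) (hu : ∀ k, 0 ≤ u k) (Z : ι → κ → ℝ) :
    0 ≤ (resolvent l u Z * resolvent l u Z).trace := by
  rw [trace_resolvent_sq hl hu]
  exact Finset.sum_nonneg fun i _ => Finset.sum_nonneg fun j _ => sq_nonneg _

theorem resolvent_diag_nonneg (hl : 0 < l) (hu : ∀ k, 0 ≤ u k) (Z : ι → κ → ℝ) (i : κ) :
    0 ≤ resolvent l u Z i i := by
  simpa [Matrix.mulVec_single_one] using dotProduct_resolvent_nonneg hl hu Z (Pi.single i 1)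

theorem trace_resolvent_nonneg (hl : 0 < l) (hu : ∀ k, 0 ≤ u k) (Z : ι → κ → ℝ) :
    0 ≤ (resolvent l u Z).trace :=
  Finset.sum_nonneg fun i _ => resolvent_diag_nonneg hl hu Z i

theorem trace_resolvent_le (hl : 0 < l) (hu : ∀ k, 0 ≤ u k) (Z : ι → κ → ℝ) :
    (resolvent l u Z).trace ≤ Fintype.card κ / l := by
  calc (resolvent l u Z).trace ≤ ∑ _i : κ, 1 / l := Finset.sum_le_sum fun i _ => by
        simpa [Matrix.mulVec_single_one] using dotProduct_resolvent_le hl hu Z (Pi.single i 1)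
    _ = _ := by simp [div_eq_mul_inv]

theorem sum_sq_resolvent_sq_le (hl : 0 < l) (hu : ∀ k, 0 ≤ u k) (Z : ι → κ → ℝ) :
    ∑ i, ∑ j, (resolvent l u Z * resolvent l u Z) i j ^ 2 ≤ Fintype.card κ / l ^ 4 := by
  rw [Finset.sum_comm]
  calc _ ≤ ∑ _j : κ, 1 / l ^ 4 := Finset.sum_le_sum fun j _ => by
        have h1 := resolvent_mulVec_sq_le hl hu Z (resolvent l u Z *ᵥ Pi.single j 1)
        have h2 := sum_resolvent_col_sq_le hl hu Z j
        rw [Matrix.mulVec_mulVec] at h1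
        simp only [dotProduct, Matrix.mulVec_single_one, Matrix.col_apply, ← sq (_ : ℝ)] at h1
        calc _ ≤ _ := h1
          _ ≤ (1 / l ^ 2) / l ^ 2 := by gcongr
          _ = 1 / l ^ 4 := by field_simp
    _ = _ := by simp [div_eq_mul_inv]

theorem dotProduct_resolvent_sq (hl : 0 < l) (hu : ∀ k, 0 ≤ u k) (Z : ι → κ → ℝ) (v : κ → ℝ) :
    (resolvent l u Z *ᵥ v) ⬝ᵥ (resolvent l u Z *ᵥ v) =
      v ⬝ᵥ ((resolvent l u Z * resolvent l u Z) *ᵥ v) := by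
  rw [← Matrix.mulVec_mulVec, dotProduct_resolvent_comm hl hu Z v]

/-! ### Removing one row -/

/-- The quadratic form `zₖᵀ H₋ₖ zₖ`, where `H₋ₖ` is the resolvent without the row `zₖ`. -/
noncomputable def looForm (l : ℝ) (u : ι → ℝ) (k : ι) (Z : ι → κ → ℝ) : ℝ :=
  Z k ⬝ᵥ (resolvent l u (Function.update Z k 0) *ᵥ Z k)

/-- The quadratic form `zₖᵀ H₋ₖ² zₖ`, where `H₋ₖ` is the resolvent without the row `zₖ`. -/
noncomputable def looFormSq (l : ℝ) (u : ι → ℝ) (k : ι) (Z : ι → κ → ℝ) : ℝ :=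
  (resolvent l u (Function.update Z k 0) *ᵥ Z k) ⬝ᵥ
    (resolvent l u (Function.update Z k 0) *ᵥ Z k)

theorem looForm_nonneg (hl : 0 < l) (hu : ∀ k, 0 ≤ u k) (k : ι) (Z : ι → κ → ℝ) :
    0 ≤ looForm l u k Z := dotProduct_resolvent_nonneg hl hu _ _

theorem looFormSq_nonneg (k : ι) (Z : ι → κ → ℝ) : 0 ≤ looFormSq l u k Z :=
  dotProduct_self_nonneg' _

theorem looFormSq_le (hl : 0 < l) (hu : ∀ k, 0 ≤ u k) (k : ι) (Z : ι → κ → ℝ) :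
    looFormSq l u k Z ≤ looForm l u k Z / l := by
  rw [le_div_iff₀ hl, mul_comm]
  exact resolvent_sq_le hl hu _ _

theorem one_add_looForm_pos (hl : 0 < l) (hu : ∀ k, 0 ≤ u k) (k : ι) (Z : ι → κ → ℝ) :
    0 < 1 + u k * looForm l u k Z := by
  have := mul_nonneg (hu k) (looForm_nonneg hl hu k Z)
  linarith

/-- Sherman–Morrison on the removed vector: the full matrix sends `H₋ₖ zₖ` to `(1 + uₖ zₖᵀH₋ₖzₖ)
zₖ`. It confines the dependence of `H zₖ` on `uₖ` to a scalar. -/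
theorem resolvent_mulVec_row (hl : 0 < l) (hu : ∀ k, 0 ≤ u k) (k : ι) (Z : ι → κ → ℝ) :
    resolvent l u Z *ᵥ Z k =
      (1 + u k * looForm l u k Z)⁻¹ • (resolvent l u (Function.update Z k 0) *ᵥ Z k) := by
  set w := resolvent l u (Function.update Z k 0) *ᵥ Z k with hw
  have h1 : (l • (1 : Matrix κ κ ℝ) + weightedGram u Z) *ᵥ w =
      (1 + u k * looForm l u k Z) • Z k := by
    rw [weightedGram_eq_update_add u Z k, ← add_assoc, Matrix.add_mulVec, hw, Matrix.mulVec_mulVec,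
      mul_resolvent hl hu, Matrix.one_mulVec, Matrix.smul_mulVec, Matrix.vecMulVec_mulVec,
      op_smul_eq_smul, smul_smul, add_smul, one_smul]
    rfl
  have h2 := congrArg (fun v => resolvent l u Z *ᵥ v) h1
  simp only [Matrix.mulVec_mulVec, resolvent_mul hl hu, Matrix.one_mulVec,
    Matrix.mulVec_smul] at h2
  rw [h2, smul_smul, inv_mul_cancel₀ (one_add_looForm_pos hl hu k Z).ne', one_smul]

theorem resolvent_update_sub (hl : 0 < l) (hu : ∀ k, 0 ≤ u k) (k : ι) (Z : ι → κ → ℝ) :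
    resolvent l u (Function.update Z k 0) - resolvent l u Z =
      (u k * (1 + u k * looForm l u k Z)⁻¹) •
        vecMulVec (resolvent l u (Function.update Z k 0) *ᵥ Z k)
          (resolvent l u (Function.update Z k 0) *ᵥ Z k) := by
  set H := resolvent l u Z with hH
  set G := resolvent l u (Function.update Z k 0) with hG
  -- Second resolvent identity; the perturbation has rank one.
  have e : G - H = H * (u k • vecMulVec (Z k) (Z k)) * G := by
    have : u k • vecMulVec (Z k) (Z k) = (l • (1 : Matrix κ κ ℝ) + weightedGram u Z) -
        (l • (1 : Matrix κ κ ℝ) + weightedGram u (Function.update Z k 0)) := by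
      rw [weightedGram_eq_update_add u Z k]; abel
    rw [this, Matrix.mul_sub, Matrix.sub_mul, hH, resolvent_mul hl hu, Matrix.one_mul,
      Matrix.mul_assoc, hG, mul_resolvent hl hu, Matrix.mul_one]
  have hr : Z k ᵥ* G = G *ᵥ Z k := by
    rw [← Matrix.mulVec_transpose, hG, transpose_resolvent hl hu]
  rw [e, Matrix.mul_smul, Matrix.smul_mul, Matrix.mul_vecMulVec, Matrix.vecMulVec_mul, hr,
    hH, resolvent_mulVec_row hl hu, Matrix.smul_vecMulVec, smul_smul]

theorem looFormSq_ratio_nonneg (hl : 0 < l) (hu : ∀ k, 0 ≤ u k) (k : ι) (Z : ι → κ → ℝ) :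
    0 ≤ u k * (1 + u k * looForm l u k Z)⁻¹ * looFormSq l u k Z :=
  mul_nonneg (mul_nonneg (hu k) (inv_nonneg.2 (one_add_looForm_pos hl hu k Z).le))
    (looFormSq_nonneg k Z)

/-- From `H₋ₖ² ≤ H₋ₖ / l` the quantity is at most `x / (l (1 + x))` with `x = uₖ zₖᵀH₋ₖzₖ`. The
bound is free of `uₖ` and `zₖ`, so one row moves the trace by at most `1/l`, however large its
weight. -/
theorem looFormSq_ratio_le (hl : 0 < l) (hu : ∀ k, 0 ≤ u k) (k : ι) (Z : ι → κ → ℝ) :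
    u k * (1 + u k * looForm l u k Z)⁻¹ * looFormSq l u k Z ≤ 1 / l := by
  have h := one_add_looForm_pos hl hu k Z
  have h2 := looFormSq_le hl hu k Z
  rw [le_div_iff₀ hl] at h2 ⊢
  have : u k * (1 + u k * looForm l u k Z)⁻¹ * looFormSq l u k Z * l =
      (u k * (looFormSq l u k Z * l)) / (1 + u k * looForm l u k Z) := by
    field_simp
  rw [this, div_le_one h]
  nlinarith [mul_le_mul_of_nonneg_left h2 (hu k)]

theorem trace_resolvent_update_sub (hl : 0 < l) (hu : ∀ k, 0 ≤ u k) (k : ι) (Z : ι → κ → ℝ) :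
    (resolvent l u (Function.update Z k 0)).trace - (resolvent l u Z).trace =
      u k * (1 + u k * looForm l u k Z)⁻¹ * looFormSq l u k Z := by
  rw [← Matrix.trace_sub, resolvent_update_sub hl hu, Matrix.trace_smul, Matrix.trace_vecMulVec]
  rfl

theorem trace_resolvent_sq_update_sub_mem (hl : 0 < l) (hu : ∀ k, 0 ≤ u k) (k : ι)
    (Z : ι → κ → ℝ) :
    (resolvent l u (Function.update Z k 0) * resolvent l u (Function.update Z k 0)).trace -
      (resolvent l u Z * resolvent l u Z).trace ∈ Set.Icc 0 (2 / l ^ 2) := by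
  have hd := resolvent_update_sub hl hu k Z
  set H := resolvent l u Z with hH
  set G := resolvent l u (Function.update Z k 0) with hG
  set w := G *ᵥ Z k with hw
  set c := u k * (1 + u k * looForm l u k Z)⁻¹ with hc
  -- Cyclicity of the trace gives `tr G² - tr H² = tr ((G - H)(G + H))`, a quadratic form because `G
  -- - H` has rank one.
  have e : (G * G).trace - (H * H).trace = c * (w ⬝ᵥ (G *ᵥ w) + w ⬝ᵥ (H *ᵥ w)) := by
    have : (G * G).trace - (H * H).trace = ((G - H) * (G + H)).trace := by
      rw [Matrix.sub_mul, Matrix.mul_add, Matrix.mul_add, Matrix.trace_sub, Matrix.trace_add,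
        Matrix.trace_add, Matrix.trace_mul_comm H G]
      ring
    rw [this, hd, Matrix.smul_mul, Matrix.trace_smul, Matrix.vecMulVec_mul,
      Matrix.trace_vecMulVec, smul_eq_mul, ← dotProduct_add, ← Matrix.add_mulVec,
      dotProduct_comm w, dotProduct_comm w, ← Matrix.dotProduct_mulVec, dotProduct_comm w]
  have hcnn : 0 ≤ c := mul_nonneg (hu k) (inv_nonneg.2 (one_add_looForm_pos hl hu k Z).le)
  have h1 := dotProduct_resolvent_nonneg hl hu (Function.update Z k 0) w
  have h2 := dotProduct_resolvent_nonneg hl hu Z w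
  have h3 := dotProduct_resolvent_le hl hu (Function.update Z k 0) w
  have h4 := dotProduct_resolvent_le hl hu Z w
  have h5 : c * (w ⬝ᵥ w) ≤ 1 / l := looFormSq_ratio_le hl hu k Z
  rw [e]
  refine ⟨mul_nonneg hcnn (add_nonneg h1 h2), ?_⟩
  calc c * (w ⬝ᵥ (G *ᵥ w) + w ⬝ᵥ (H *ᵥ w)) ≤ c * ((w ⬝ᵥ w) / l + (w ⬝ᵥ w) / l) :=
        mul_le_mul_of_nonneg_left (add_le_add h3 h4) hcnn
    _ = 2 / l * (c * (w ⬝ᵥ w)) := by ring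
    _ ≤ 2 / l * (1 / l) := mul_le_mul_of_nonneg_left h5 (by positivity)
    _ = 2 / l ^ 2 := by field_simp

/-! ### Trace identities -/

theorem trace_mul_weightedGram (M : Matrix κ κ ℝ) (Z : ι → κ → ℝ) :
    (M * weightedGram u Z).trace = ∑ k, u k * (Z k ⬝ᵥ (M *ᵥ Z k)) := by
  simp only [weightedGram, Matrix.mul_sum, Matrix.trace_sum, Matrix.mul_smul, Matrix.trace_smul,
    Matrix.mul_vecMulVec, Matrix.trace_vecMulVec, smul_eq_mul, dotProduct_comm]

/-- The trace of `H (l I + W) = I`, with each `zₖᵀ H zₖ` rewritten by removing row `k`. Its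
expectation becomes the equation for `m`. -/
theorem card_eq_trace_resolvent (hl : 0 < l) (hu : ∀ k, 0 ≤ u k) (Z : ι → κ → ℝ) :
    (Fintype.card κ : ℝ) = l * (resolvent l u Z).trace +
      ∑ k, u k * looForm l u k Z / (1 + u k * looForm l u k Z) := by
  have h := congrArg Matrix.trace (resolvent_mul hl hu Z)
  rw [Matrix.mul_add, Matrix.trace_add, Matrix.mul_smul, Matrix.mul_one, Matrix.trace_smul,
    trace_mul_weightedGram, Matrix.trace_one, smul_eq_mul] at h
  rw [← h]
  congr 1
  refine Finset.sum_congr rfl fun k _ => ?_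
  rw [resolvent_mulVec_row hl hu, dotProduct_smul, smul_eq_mul]
  change u k * (_ * looForm l u k Z) = _
  ring

/-- The same with `H H (l I + W) = H`; its expectation becomes the equation for `q`, given `m`. -/
theorem trace_resolvent_eq (hl : 0 < l) (hu : ∀ k, 0 ≤ u k) (Z : ι → κ → ℝ) :
    (resolvent l u Z).trace = l * (resolvent l u Z * resolvent l u Z).trace +
      ∑ k, u k * looFormSq l u k Z / (1 + u k * looForm l u k Z) ^ 2 := by
  have h := congrArg (fun M => (resolvent l u Z * M).trace) (resolvent_mul hl hu Z)
  simp only [← Matrix.mul_assoc, Matrix.mul_one] at h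
  rw [Matrix.mul_add, Matrix.trace_add, Matrix.mul_smul, Matrix.mul_one, Matrix.trace_smul,
    trace_mul_weightedGram, smul_eq_mul] at h
  conv_lhs => rw [← h]
  congr 1
  refine Finset.sum_congr rfl fun k _ => ?_
  rw [← dotProduct_resolvent_sq hl hu, resolvent_mulVec_row hl hu, dotProduct_smul, smul_dotProduct,
    smul_eq_mul, smul_eq_mul]
  change u k * (_ * (_ * looFormSq l u k Z)) = _
  rw [div_eq_mul_inv, ← inv_pow]
  ring

theorem trace_weightedGram (u : ι → ℝ) (Z : ι → κ → ℝ) :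
    (weightedGram u Z).trace = ∑ k, u k * (Z k ⬝ᵥ Z k) := by
  simpa using trace_mul_weightedGram (u := u) 1 Z

/-- The tangent-line bound `1/x ≥ 2c - c²x` for matrices: `(1 - cA) H (1 - cA) = H - 2c + c²A` is
positive semidefinite. The right-hand side is affine in the squared row norms, so its expectation is
explicit. -/
theorem le_trace_resolvent (hl : 0 < l) (hu : ∀ k, 0 ≤ u k) (Z : ι → κ → ℝ) (c : ℝ) :
    2 * c * Fintype.card κ - c ^ 2 * (l * Fintype.card κ + ∑ k, u k * (Z k ⬝ᵥ Z k)) ≤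
      (resolvent l u Z).trace := by
  set A := l • (1 : Matrix κ κ ℝ) + weightedGram u Z with hA
  set H := resolvent l u Z with hH
  have hAT : Aᵀ = A := by
    have := (posDef_ridge hl hu Z).isHermitian
    rwa [Matrix.IsHermitian, Matrix.conjTranspose_eq_transpose_of_trivial] at this
  have hHA : H * A = 1 := resolvent_mul hl hu Z
  have hAH : A * H = 1 := mul_resolvent hl hu Z
  have hps : ((1 - c • A)ᵀ * H * (1 - c • A)).PosSemidef := by
    have := (posDef_ridge hl hu Z).inv.posSemidef.conjTranspose_mul_mul_same (1 - c • A)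
    rwa [Matrix.conjTranspose_eq_transpose_of_trivial] at this
  have htr := hps.trace_nonneg
  have e : (1 - c • A)ᵀ * H * (1 - c • A) = H - (2 * c) • (1 : Matrix κ κ ℝ) + c ^ 2 • A := by
    rw [Matrix.transpose_sub, Matrix.transpose_smul, hAT, Matrix.transpose_one]
    simp only [Matrix.sub_mul, Matrix.mul_sub, Matrix.smul_mul, Matrix.mul_smul, Matrix.one_mul,
      Matrix.mul_one, hHA, hAH]
    module
  have hAtr : A.trace = l * Fintype.card κ + ∑ k, u k * (Z k ⬝ᵥ Z k) := by
    rw [hA, Matrix.trace_add, Matrix.trace_smul, Matrix.trace_one, trace_weightedGram, smul_eq_mul]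
  rw [e, Matrix.trace_add, Matrix.trace_sub, Matrix.trace_smul, Matrix.trace_smul, hAtr,
    Matrix.trace_one, smul_eq_mul, smul_eq_mul] at htr
  linarith

/-! ### Continuity -/

theorem continuous_resolvent (hl : 0 < l) (hu : ∀ k, 0 ≤ u k) :
    Continuous fun Z : ι → κ → ℝ => resolvent l u Z := by
  have hA : Continuous fun Z : ι → κ → ℝ => l • (1 : Matrix κ κ ℝ) + weightedGram u Z := by
    unfold weightedGram
    refine continuous_const.add (continuous_finsetSum _ fun k _ => ?_)
    have hk : Continuous fun Z : ι → κ → ℝ => Z k := continuous_apply k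
    exact Continuous.const_smul (hk.matrix_vecMulVec hk) (u k)
  unfold resolvent
  simp only [Matrix.inv_def, Ring.inverse_eq_inv']
  -- Cramer's rule: the adjugate is polynomial and the determinant never vanishes.
  exact (hA.matrix_det.inv₀ fun Z => (posDef_ridge hl hu Z).det_pos.ne').smul hA.matrix_adjugate

theorem continuous_update_zero (k : ι) :
    Continuous fun Z : ι → κ → ℝ => Function.update Z k 0 :=
  continuous_id.update k continuous_const

end Resolvent

/-! ### Resampling one coordinate of a product measure. -/

section Resampling

variable {ι α : Type*} [Fintype ι] [DecidableEq ι] [MeasurableSpace α]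
  {μ : Measure α} [IsProbabilityMeasure μ]

/-- Resampling one coordinate preserves a product measure. -/
theorem measurePreserving_update (k : ι) :
    MeasurePreserving (fun p : (ι → α) × α => Function.update p.1 k p.2)
      ((Measure.pi fun _ : ι => μ).prod μ) (Measure.pi fun _ : ι => μ) := by
  refine ⟨measurable_update', ?_⟩
  symm
  refine Measure.pi_eq fun s hs => ?_
  rw [Measure.map_apply measurable_update' (MeasurableSet.univ_pi hs)]
  have e : (fun p : (ι → α) × α => Function.update p.1 k p.2) ⁻¹' Set.univ.pi s =
      (Set.univ.pi (Function.update s k Set.univ)) ×ˢ s k := by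
    ext ⟨x, z⟩
    simp only [Set.mem_preimage, Set.mem_pi, Set.mem_univ, true_implies, Set.mem_prod]
    constructor
    · intro h
      refine ⟨fun i => ?_, by simpa using h k⟩
      by_cases hi : i = k
      · subst hi; simp
      · simpa [Function.update_of_ne hi] using h i
    · rintro ⟨h1, h2⟩ i
      by_cases hi : i = k
      · subst hi; simpa using h2
      · simpa [Function.update_of_ne hi] using h1 i
  rw [e, Measure.prod_prod, Measure.pi_pi, ← Finset.prod_erase_mul _ _ (Finset.mem_univ k),
    ← Finset.prod_erase_mul Finset.univ (fun i => μ (s i)) (Finset.mem_univ k)]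
  simp only [Function.update_self, measure_univ, mul_one]
  congr 1
  refine Finset.prod_congr rfl fun i hi => ?_
  rw [Function.update_of_ne (Finset.ne_of_mem_erase hi)]

theorem integral_eq_integral_update (k : ι) {f : (ι → α) → ℝ} (hf : Measurable f) :
    ∫ x, f x ∂(Measure.pi fun _ : ι => μ) =
      ∫ p : (ι → α) × α, f (Function.update p.1 k p.2) ∂((Measure.pi fun _ : ι => μ).prod μ) := by
  conv_lhs => rw [← (measurePreserving_update (μ := μ) k).map_eq]
  rw [integral_map measurable_update'.aemeasurable hf.aestronglyMeasurable]

theorem integrable_comp_update (k : ι) {f : (ι → α) → ℝ}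
    (hf : Integrable f (Measure.pi fun _ : ι => μ)) :
    Integrable (fun p : (ι → α) × α => f (Function.update p.1 k p.2))
      ((Measure.pi fun _ : ι => μ).prod μ) :=
  (measurePreserving_update k).integrable_comp_of_integrable hf

/-- A coordinate is independent of any function that does not involve it. -/
theorem integral_coord_mul (k : ι) {φ : α → ℝ} {g : (ι → α) → ℝ} (hφ : Measurable φ)
    (hg : Measurable g) (h : ∀ x z, g (Function.update x k z) = g x) :
    ∫ x, φ (x k) * g x ∂(Measure.pi fun _ : ι => μ) =
      (∫ z, φ z ∂μ) * ∫ x, g x ∂(Measure.pi fun _ : ι => μ) := by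
  have hm : Measurable fun x : ι → α => φ (x k) * g x :=
    (hφ.comp (measurable_pi_apply k)).mul hg
  rw [integral_eq_integral_update k hm]
  simp only [Function.update_self, h]
  rw [mul_comm, ← integral_prod_mul]
  refine integral_congr_ae (Filter.Eventually.of_forall fun p => ?_)
  simp only
  ring

end Resampling

/-! ### An Efron–Stein type variance bound. -/

section BoundedDifferences

variable {α : Type*} [MeasurableSpace α] {μ : Measure α} [IsProbabilityMeasure μ]

/-- The variance of a function of `n` independent variables that changes by at most `c` when one
of the variables is changed is at most `n c²`. -/
theorem integral_sub_sq_le_of_bounded_differences {c C : ℝ} (n : ℕ) {f : (Fin n → α) → ℝ}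
    (hf : Measurable f) (hC : ∀ x, |f x| ≤ C)
    (hc : ∀ k x z, |f (Function.update x k z) - f x| ≤ c) :
    ∫ x, (f x - ∫ x', f x' ∂(Measure.pi fun _ => μ)) ^ 2 ∂(Measure.pi fun _ => μ) ≤
      n * c ^ 2 := by
  induction n with
  | zero =>
    have : ∀ x x', f x = f x' := fun x x' => by rw [Subsingleton.elim x x']
    have h0 : ∀ x, f x - ∫ x', f x' ∂(Measure.pi fun _ : Fin 0 => μ) = 0 := fun x => by
      simp [fun x' => this x' x]
    simp [h0]
  | succ n ih =>
    set ν := Measure.pi fun _ : Fin n => μ with hν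
    have hmp := (measurePreserving_piFinSuccAbove (fun _ : Fin (n + 1) => μ) 0).symm
    have hcoe : ∀ p : α × (Fin n → α),
        (MeasurableEquiv.piFinSuccAbove (fun _ : Fin (n + 1) => α) 0).symm p =
          Fin.cons p.1 p.2 := fun p => by
      simp [MeasurableEquiv.piFinSuccAbove, Fin.insertNthEquiv, Fin.insertNth_zero']
    have key : ∀ g : (Fin (n + 1) → α) → ℝ, ∫ x, g x ∂(Measure.pi fun _ => μ) =
        ∫ p : α × (Fin n → α), g (Fin.cons p.1 p.2) ∂(μ.prod ν) := fun g => by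
      rw [← hmp.integral_comp']
      simp only [hcoe]
      rfl
    have hcons : Measurable fun p : α × (Fin n → α) => (Fin.cons p.1 p.2 : Fin (n + 1) → α) := by
      simp only [← hcoe]
      exact (MeasurableEquiv.piFinSuccAbove (fun _ : Fin (n + 1) => α) 0).symm.measurable
    have hfm : Measurable fun p : α × (Fin n → α) => f (Fin.cons p.1 p.2) := hf.comp hcons
    have hfa : ∀ a, Measurable fun t : Fin n → α => f (Fin.cons a t) := fun a =>
      hfm.comp measurable_prodMk_left
    have hint : ∀ a, Integrable (fun t : Fin n → α => f (Fin.cons a t)) ν := fun a =>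
      Integrable.of_bound (hfa a).aestronglyMeasurable C (Filter.Eventually.of_forall fun t => hC _)
    set F : α → ℝ := fun a => ∫ t, f (Fin.cons a t) ∂ν with hF
    have hFm : Measurable F := hfm.stronglyMeasurable.integral_prod_right'.measurable
    have hFC : ∀ a, |F a| ≤ C := fun a => by
      have := norm_integral_le_of_norm_le_const (μ := ν) (f := fun t => f (Fin.cons a t)) (C := C)
        (Filter.Eventually.of_forall fun t => hC _)
      simpa using this
    have hFi : Integrable F μ :=
      Integrable.of_bound hFm.aestronglyMeasurable C (Filter.Eventually.of_forall hFC)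
    set m := ∫ x, f x ∂(Measure.pi fun _ => μ) with hm
    have hmF : m = ∫ a, F a ∂μ := by
      rw [hm, key f, integral_prod]
      exact Integrable.of_bound hfm.aestronglyMeasurable C (Filter.Eventually.of_forall fun t => hC _)
    have hF1 : ∀ a b, |F a - F b| ≤ c := fun a b => by
      have e : F a - F b = ∫ t, (f (Fin.cons a t) - f (Fin.cons b t)) ∂ν :=
        (integral_sub (hint a) (hint b)).symm
      have := norm_integral_le_of_norm_le_const (μ := ν)
        (f := fun t => f (Fin.cons a t) - f (Fin.cons b t)) (C := c)
        (Filter.Eventually.of_forall fun t => by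
          have := hc 0 (Fin.cons b t) a
          rwa [Fin.update_cons_zero] at this)
      rw [e]
      simpa using this
    have hF2 : ∀ a, |F a - m| ≤ c := fun a => by
      have e : F a - m = ∫ b, (F a - F b) ∂μ := by
        rw [integral_sub (integrable_const _) hFi, ← hmF]
        simp
      have := norm_integral_le_of_norm_le_const (μ := μ) (f := fun b => F a - F b) (C := c)
        (Filter.Eventually.of_forall fun b => hF1 a b)
      rw [e]
      simpa using this
    -- Given the first coordinate, the mean square about `m` is the conditional variance, at most `n
    -- c²` by induction, plus `(F a - m)²`, at most `c²`.
    have hin : ∀ a, ∫ t, (f (Fin.cons a t) - m) ^ 2 ∂ν ≤ n * c ^ 2 + c ^ 2 := fun a => by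
      have h1 := ih (hfa a) (fun t => hC _) (fun k t z => by
        have := hc k.succ (Fin.cons a t) z
        rwa [← Fin.cons_update] at this)
      have hsq : Integrable (fun t => (f (Fin.cons a t) - F a) ^ 2) ν := by
        refine Integrable.of_bound (((hfa a).sub_const _).pow_const 2).aestronglyMeasurable
          ((C + C) ^ 2) (Filter.Eventually.of_forall fun t => ?_)
        rw [norm_pow]
        refine pow_le_pow_left₀ (norm_nonneg _) ?_ 2
        exact (norm_sub_le _ _).trans (add_le_add (hC _) (hFC a))
      have e : ∫ t, (f (Fin.cons a t) - m) ^ 2 ∂ν =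
          ∫ t, (f (Fin.cons a t) - F a) ^ 2 ∂ν + (F a - m) ^ 2 := by
        have e1 : ∀ t : Fin n → α, (f (Fin.cons a t) - m) ^ 2 = (f (Fin.cons a t) - F a) ^ 2 +
            (2 * (F a - m) * f (Fin.cons a t) + ((F a - m) ^ 2 - 2 * (F a - m) * F a)) := fun t => by
          ring
        simp only [e1]
        have hlin : Integrable (fun t : Fin n → α => 2 * (F a - m) * f (Fin.cons a t) +
            ((F a - m) ^ 2 - 2 * (F a - m) * F a)) ν :=
          ((hint a).const_mul _).add (integrable_const _)
        rw [integral_add hsq hlin,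
          integral_add ((hint a).const_mul _) (integrable_const _), integral_const_mul]
        change _ + (2 * (F a - m) * F a + _) = _
        simp
      rw [e]
      refine add_le_add h1 ?_
      rw [← sq_abs]
      exact pow_le_pow_left₀ (abs_nonneg _) (hF2 a) 2
    rw [key, integral_prod]
    · calc ∫ a, ∫ t, (f (Fin.cons a t) - m) ^ 2 ∂ν ∂μ ≤ ∫ _a, (n * c ^ 2 + c ^ 2) ∂μ :=
            integral_mono_of_nonneg (Filter.Eventually.of_forall fun a =>
              integral_nonneg fun t => sq_nonneg _) (integrable_const _)
              (Filter.Eventually.of_forall hin)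
        _ = _ := by simp; ring
    · refine Integrable.of_bound ((hfm.sub_const _).pow_const 2).aestronglyMeasurable
        ((C + |m|) ^ 2) (Filter.Eventually.of_forall fun t => ?_)
      rw [norm_pow]
      refine pow_le_pow_left₀ (norm_nonneg _) ?_ 2
      exact (norm_sub_le _ _).trans (add_le_add (hC _) le_rfl)

end BoundedDifferences

/-! ### Mean and variance of Gaussian quadratic forms. -/

section QuadraticForm

variable {κ : Type*} [Fintype κ] [DecidableEq κ]

/-- The standard Gaussian measure on `κ → ℝ`. -/
noncomputable def stdGauss (κ : Type*) [Fintype κ] : Measure (κ → ℝ) :=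
  Measure.pi fun _ : κ => gaussianReal 0 1

instance : IsProbabilityMeasure (stdGauss κ) := by unfold stdGauss; infer_instance

/-- An upper bound for the second moments of the variables `z a * z b - δ a b`. -/
noncomputable def momentBound : ℝ := 1 + ∫ z, (z ^ 2 - 1) ^ 2 ∂(gaussianReal 0 1)

theorem one_le_momentBound : 1 ≤ momentBound := by
  have : 0 ≤ ∫ z, (z ^ 2 - 1) ^ 2 ∂(gaussianReal 0 1) := integral_nonneg fun z => sq_nonneg _
  unfold momentBound
  linarith

theorem integral_gaussian_sq : ∫ z, z ^ 2 ∂(gaussianReal 0 1) = 1 := by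
  have h := variance_fun_id_gaussianReal (μ := 0) (v := 1)
  rw [variance_of_integral_eq_zero (by fun_prop) integral_id_gaussianReal] at h
  simpa using h

theorem integrable_gaussian_sq : Integrable (fun z : ℝ => z ^ 2) (gaussianReal 0 1) :=
  (memLp_id_gaussianReal' 2 (by simp)).integrable_sq

theorem integral_gaussian_sq_sub_one : ∫ z, (z ^ 2 - 1) ∂(gaussianReal 0 1) = 0 := by
  rw [integral_sub integrable_gaussian_sq (integrable_const _), integral_gaussian_sq]
  simp

theorem memLp_coord (a : κ) : MemLp (fun z : κ → ℝ => z a) 4 (stdGauss κ) :=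
  (memLp_id_gaussianReal' (μ := 0) (v := 1) 4 (by simp)).comp_measurePreserving
    (measurePreserving_eval (fun _ : κ => gaussianReal 0 1) a)

instance : ENNReal.HolderTriple 4 4 2 := ⟨by
  rw [← ENNReal.toReal_eq_toReal_iff' (by simp) (by simp), ENNReal.toReal_add (by simp) (by simp)]
  simp
  norm_num⟩

theorem memLp_coord_mul (a b : κ) : MemLp (fun z : κ → ℝ => z a * z b) 2 (stdGauss κ) :=
  (memLp_coord b).mul (memLp_coord a)

/-- The centred products `z a * z b - δ a b`. -/
def centredProd (a b : κ) (z : κ → ℝ) : ℝ := z a * z b - if a = b then 1 else 0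

theorem measurable_centredProd (a b : κ) : Measurable (centredProd a b) := by
  unfold centredProd
  fun_prop

theorem memLp_centredProd (a b : κ) : MemLp (centredProd a b) 2 (stdGauss κ) :=
  (memLp_coord_mul a b).sub (memLp_const _)

theorem centredProd_comm (a b : κ) : centredProd a b = centredProd b a := by
  ext z
  simp only [centredProd, eq_comm, mul_comm]

theorem centredProd_update {a b i : κ} (ha : a ≠ i) (hb : b ≠ i) (z : κ → ℝ) (t : ℝ) :
    centredProd a b (Function.update z i t) = centredProd a b z := by
  simp [centredProd, Function.update_of_ne ha, Function.update_of_ne hb]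

theorem integral_coord_mul_eq_zero (i : κ) {g : (κ → ℝ) → ℝ} (hg : Measurable g)
    (h : ∀ x z, g (Function.update x i z) = g x) : ∫ z, z i * g z ∂(stdGauss κ) = 0 := by
  unfold stdGauss
  rw [integral_coord_mul i (φ := fun t => t) measurable_id hg h, integral_id_gaussianReal, zero_mul]

theorem integral_centredProd (a b : κ) : ∫ z, centredProd a b z ∂(stdGauss κ) = 0 := by
  by_cases hab : a = b
  · subst hab
    have := integral_coord_mul (μ := gaussianReal 0 1) a (φ := fun t => t ^ 2 - 1)
      (g := fun _ : κ → ℝ => (1 : ℝ)) (by fun_prop) measurable_const (fun _ _ => rfl)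
    rw [integral_gaussian_sq_sub_one, zero_mul] at this
    rw [← this]
    simp [centredProd, stdGauss, sq]
  · have := integral_coord_mul_eq_zero a (g := fun z : κ → ℝ => z b) (measurable_pi_apply b)
      (fun x z => Function.update_of_ne (Ne.symm hab) _ _)
    simpa [centredProd, hab] using this

theorem integral_centredProd_mul_of_ne {a b c d : κ} (hab : a ≠ b) (hc : c ≠ a) (hd : d ≠ a) :
    ∫ z, centredProd a b z * centredProd c d z ∂(stdGauss κ) = 0 := by
  have := integral_coord_mul_eq_zero a (g := fun z : κ → ℝ => z b * centredProd c d z)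
    ((measurable_pi_apply b).mul (measurable_centredProd c d))
    (fun x z => by rw [centredProd_update hc hd, Function.update_of_ne (Ne.symm hab)])
  rw [← this]
  simp only [centredProd, hab, if_false, sub_zero, mul_assoc]

/-- If the unordered pairs differ, either some coordinate occurs exactly once, and its mean is zero,
or the product is `(z_a² - 1)(z_c² - 1)` with `a ≠ c`, whose factors are independent and centred. -/
theorem integral_centredProd_mul_eq_zero {a b c d : κ} (h1 : ¬(a = c ∧ b = d))
    (h2 : ¬(a = d ∧ b = c)) : ∫ z, centredProd a b z * centredProd c d z ∂(stdGauss κ) = 0 := by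
  have comm : ∀ a b c d : κ, ∫ z, centredProd a b z * centredProd c d z ∂(stdGauss κ) =
      ∫ z, centredProd c d z * centredProd a b z ∂(stdGauss κ) := fun a b c d => by
    simp only [mul_comm]
  by_cases hab : a = b
  · subst hab
    by_cases hcd : c = d
    · subst hcd
      have hac : c ≠ a := fun h => h1 ⟨h.symm, h.symm⟩
      have := integral_coord_mul (μ := gaussianReal 0 1) a (φ := fun t => t ^ 2 - 1)
        (by fun_prop) (measurable_centredProd c c) (fun x z => centredProd_update hac hac x z)
      rw [integral_gaussian_sq_sub_one, zero_mul] at this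
      rw [← this]
      simp [centredProd, stdGauss, sq]
    · rw [comm]
      by_cases hca : a = c
      · subst hca
        rw [centredProd_comm a d]
        exact integral_centredProd_mul_of_ne (Ne.symm hcd) hcd hcd
      · exact integral_centredProd_mul_of_ne hcd hca hca
  · by_cases hc : c = a
    · subst hc
      have hdb : d ≠ b := fun h => h1 ⟨rfl, h.symm⟩
      rw [centredProd_comm c b]
      exact integral_centredProd_mul_of_ne (Ne.symm hab) hab hdb
    · by_cases hd : d = a
      · subst hd
        have hcb : c ≠ b := fun h => h2 ⟨rfl, h.symm⟩
        rw [centredProd_comm d b]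
        exact integral_centredProd_mul_of_ne (Ne.symm hab) hcb hab
      · exact integral_centredProd_mul_of_ne hab hc hd

theorem integral_centredProd_sq_le (a b : κ) :
    ∫ z, centredProd a b z ^ 2 ∂(stdGauss κ) ≤ momentBound := by
  by_cases hab : a = b
  · subst hab
    have := integral_coord_mul (μ := gaussianReal 0 1) a (φ := fun t => (t ^ 2 - 1) ^ 2)
      (g := fun _ : κ → ℝ => (1 : ℝ)) (by fun_prop) measurable_const (fun _ _ => rfl)
    have e : ∫ z, centredProd a a z ^ 2 ∂(stdGauss κ) =
        ∫ z, (z ^ 2 - 1) ^ 2 ∂(gaussianReal 0 1) := by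
      simpa [centredProd, stdGauss, sq] using this
    rw [e, momentBound]
    linarith
  · have h1 := integral_coord_mul (μ := gaussianReal 0 1) a (φ := fun t => t ^ 2)
      (g := fun z : κ → ℝ => z b ^ 2) (by fun_prop) (by fun_prop)
      (fun x z => by rw [Function.update_of_ne (Ne.symm hab)])
    have h2 := integral_coord_mul (μ := gaussianReal 0 1) b (φ := fun t => t ^ 2)
      (g := fun _ : κ → ℝ => (1 : ℝ)) (by fun_prop) measurable_const (fun _ _ => rfl)
    simp only [mul_one, integral_const, probReal_univ, smul_eq_mul] at h2
    rw [h2, integral_gaussian_sq, one_mul] at h1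
    have e : ∫ z, centredProd a b z ^ 2 ∂(stdGauss κ) = 1 := by
      rw [← h1]
      simp [centredProd, stdGauss, hab, mul_pow]
    rw [e]
    exact one_le_momentBound

theorem integrable_centredProd_mul (a b c d : κ) :
    Integrable (fun z => centredProd a b z * centredProd c d z) (stdGauss κ) :=
  (memLp_centredProd a b).integrable_mul (memLp_centredProd c d)

theorem abs_integral_centredProd_mul_le (a b c d : κ) :
    |∫ z, centredProd a b z * centredProd c d z ∂(stdGauss κ)| ≤
      momentBound * ((if a = c ∧ b = d then 1 else 0) + if a = d ∧ b = c then 1 else 0) := by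
  have hK := one_le_momentBound
  have hb : |∫ z, centredProd a b z * centredProd c d z ∂(stdGauss κ)| ≤ momentBound := by
    have i1 := (memLp_centredProd (κ := κ) a b).integrable_sq
    have i2 := (memLp_centredProd (κ := κ) c d).integrable_sq
    have h1 := integral_centredProd_sq_le a b
    have h2 := integral_centredProd_sq_le c d
    calc _ ≤ ∫ z, |centredProd a b z * centredProd c d z| ∂(stdGauss κ) :=
          abs_integral_le_integral_abs
      _ ≤ ∫ z, (1 / 2 * centredProd a b z ^ 2 + 1 / 2 * centredProd c d z ^ 2) ∂(stdGauss κ) := by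
          refine integral_mono (integrable_centredProd_mul a b c d).abs
            ((i1.const_mul _).add (i2.const_mul _)) fun z => ?_
          simp only
          rw [abs_mul]
          nlinarith [sq_nonneg (|centredProd a b z| - |centredProd c d z|),
            sq_abs (centredProd a b z), sq_abs (centredProd c d z)]
      _ ≤ momentBound := by
          rw [integral_add (i1.const_mul _) (i2.const_mul _), integral_const_mul,
            integral_const_mul]
          linarith
  by_cases h1 : a = c ∧ b = d
  · rw [if_pos h1]
    split_ifs <;> linarith
  · by_cases h2 : a = d ∧ b = c
    · rw [if_neg h1, if_pos h2]; linarith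
    · rw [integral_centredProd_mul_eq_zero h1 h2]
      simp [h1, h2]

theorem quadForm_sub_trace (A : Matrix κ κ ℝ) (z : κ → ℝ) :
    z ⬝ᵥ (A *ᵥ z) - A.trace = ∑ a, ∑ b, A a b * centredProd a b z := by
  simp only [dotProduct, Matrix.mulVec, Matrix.trace, Matrix.diag, centredProd, mul_sub,
    Finset.sum_sub_distrib, Finset.mul_sum]
  congr 1
  · exact Finset.sum_congr rfl fun a _ => Finset.sum_congr rfl fun b _ => by ring
  · simp

theorem memLp_quadForm_sub (A : Matrix κ κ ℝ) :
    MemLp (fun z : κ → ℝ => z ⬝ᵥ (A *ᵥ z) - A.trace) 2 (stdGauss κ) := by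
  simp only [quadForm_sub_trace]
  exact memLp_finsetSum _ fun a _ => memLp_finsetSum _ fun b _ =>
    (memLp_centredProd a b).const_mul _

theorem memLp_quadForm (A : Matrix κ κ ℝ) :
    MemLp (fun z : κ → ℝ => z ⬝ᵥ (A *ᵥ z)) 2 (stdGauss κ) := by
  have := (memLp_quadForm_sub A).add (memLp_const A.trace)
  convert! this using 2 with z
  simp

theorem integral_quadForm (A : Matrix κ κ ℝ) :
    ∫ z, z ⬝ᵥ (A *ᵥ z) ∂(stdGauss κ) = A.trace := by
  have h : ∫ z, (z ⬝ᵥ (A *ᵥ z) - A.trace) ∂(stdGauss κ) = 0 := by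
    simp only [quadForm_sub_trace]
    have i : ∀ a b : κ, Integrable (fun z => A a b * centredProd a b z) (stdGauss κ) := fun a b =>
      ((memLp_centredProd a b).integrable (by norm_num)).const_mul _
    rw [integral_finsetSum _ fun a _ => integrable_finsetSum _ fun b _ => i a b]
    refine Finset.sum_eq_zero fun a _ => ?_
    rw [integral_finsetSum _ fun b _ => i a b]
    refine Finset.sum_eq_zero fun b _ => ?_
    rw [integral_const_mul, integral_centredProd, mul_zero]
  rw [integral_sub ((memLp_quadForm A).integrable (by norm_num)) (integrable_const _)] at h
  simpa [sub_eq_zero] using h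

/-- Expanding the square over four indices, only the two pairings `(c, d) = (a, b)` and `(c, d) =
(b, a)` survive. By symmetry of `A` each contributes at most a multiple of the squared Frobenius
norm. -/
theorem integral_quadForm_sub_sq_le {A : Matrix κ κ ℝ} (hA : Aᵀ = A) :
    ∫ z, (z ⬝ᵥ (A *ᵥ z) - A.trace) ^ 2 ∂(stdGauss κ) ≤
      2 * momentBound * ∑ a, ∑ b, A a b ^ 2 := by
  have hs : ∀ a b, A b a = A a b := fun a b => by
    have := congrFun (congrFun hA a) b
    rwa [Matrix.transpose_apply] at this
  have e : ∀ z : κ → ℝ, (z ⬝ᵥ (A *ᵥ z) - A.trace) ^ 2 =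
      ∑ a, ∑ b, ∑ c, ∑ d, (A a b * A c d) * (centredProd a b z * centredProd c d z) := fun z => by
    rw [quadForm_sub_trace, sq, Finset.sum_mul_sum]
    simp only [Finset.sum_mul_sum]
    refine Finset.sum_congr rfl fun a _ => ?_
    rw [Finset.sum_comm]
    exact Finset.sum_congr rfl fun b _ => Finset.sum_congr rfl fun c _ =>
      Finset.sum_congr rfl fun d _ => by ring
  have i : ∀ a b c d : κ, Integrable
      (fun z => (A a b * A c d) * (centredProd a b z * centredProd c d z)) (stdGauss κ) :=
    fun a b c d => (integrable_centredProd_mul a b c d).const_mul _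
  simp only [e]
  rw [integral_finsetSum _ fun a _ => integrable_finsetSum _ fun b _ =>
    integrable_finsetSum _ fun c _ => integrable_finsetSum _ fun d _ => i a b c d]
  rw [Finset.mul_sum]
  refine Finset.sum_le_sum fun a _ => ?_
  rw [integral_finsetSum _ fun b _ => integrable_finsetSum _ fun c _ =>
    integrable_finsetSum _ fun d _ => i a b c d, Finset.mul_sum]
  refine Finset.sum_le_sum fun b _ => ?_
  rw [integral_finsetSum _ fun c _ => integrable_finsetSum _ fun d _ => i a b c d]
  calc _ ≤ ∑ c, ∑ d, momentBound * ((if a = c ∧ b = d then |A a b * A c d| else 0) +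
        if a = d ∧ b = c then |A a b * A c d| else 0) := by
        refine Finset.sum_le_sum fun c _ => ?_
        rw [integral_finsetSum _ fun d _ => i a b c d]
        refine Finset.sum_le_sum fun d _ => ?_
        rw [integral_const_mul]
        refine (le_abs_self _).trans ?_
        rw [abs_mul]
        refine (mul_le_mul_of_nonneg_left (abs_integral_centredProd_mul_le a b c d)
          (abs_nonneg _)).trans (le_of_eq ?_)
        split_ifs <;> ring
    _ = _ := by
        simp only [← Finset.mul_sum, Finset.sum_add_distrib, ite_and]
        simp only [Finset.sum_ite_eq, Finset.mem_univ, if_true, Finset.sum_ite_irrel,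
          Finset.sum_const_zero, hs b a, abs_mul_self]
        ring

end QuadraticForm

/-! ### Quadratic forms of a row in a matrix independent of that row. -/

section LeaveOneOut

variable {ι κ : Type*} [Fintype ι] [DecidableEq ι] [Fintype κ] [DecidableEq κ]

/-- The law of a matrix with independent standard Gaussian entries. -/
noncomputable def gaussRows (ι κ : Type*) [Fintype ι] [Fintype κ] : Measure (ι → κ → ℝ) :=
  Measure.pi fun _ : ι => stdGauss κ

instance : IsProbabilityMeasure (gaussRows ι κ) := by unfold gaussRows; infer_instance

theorem memLp_row_dotProduct_self (k : ι) :
    MemLp (fun Z : ι → κ → ℝ => Z k ⬝ᵥ Z k) 2 (gaussRows ι κ) := by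
  have h := (memLp_quadForm (1 : Matrix κ κ ℝ)).comp_measurePreserving
    (measurePreserving_eval (fun _ : ι => stdGauss κ) k)
  simpa [Function.comp_def, gaussRows] using h

theorem integral_row_dotProduct_self (k : ι) :
    ∫ Z, Z k ⬝ᵥ Z k ∂(gaussRows ι κ) = Fintype.card κ := by
  have h := integral_quadForm (1 : Matrix κ κ ℝ)
  have hmp := measurePreserving_eval (fun _ : ι => stdGauss κ) k
  simp only [Matrix.one_mulVec, Matrix.trace_one] at h
  rw [← h, ← hmp.map_eq, integral_map hmp.measurable.aemeasurable
    (by fun_prop)]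
  rfl

variable {M : (ι → κ → ℝ) → Matrix κ κ ℝ} {B S : ℝ}

theorem measurable_rowForm (hM : Continuous M) (k : ι) :
    Measurable fun Z : ι → κ → ℝ => Z k ⬝ᵥ (M (Function.update Z k 0) *ᵥ Z k) :=
  ((continuous_apply k).dotProduct
    ((hM.comp (continuous_update_zero k)).matrix_mulVec (continuous_apply k))).measurable

theorem memLp_rowForm (hM : Continuous M) (hB : ∀ Z v, |v ⬝ᵥ (M Z *ᵥ v)| ≤ B * (v ⬝ᵥ v)) (k : ι) :
    MemLp (fun Z => Z k ⬝ᵥ (M (Function.update Z k 0) *ᵥ Z k)) 2 (gaussRows ι κ) := by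
  refine (memLp_row_dotProduct_self k).of_le_mul (c := B)
    (measurable_rowForm hM k).aestronglyMeasurable (Filter.Eventually.of_forall fun Z => ?_)
  simp only [Real.norm_eq_abs]
  rw [abs_of_nonneg (dotProduct_self_nonneg' (Z k))]
  exact hB _ _

/-- The matrix does not see row `k`, so this row can be resampled and integrated first. -/
theorem integral_rowForm (hM : Continuous M) (hB : ∀ Z v, |v ⬝ᵥ (M Z *ᵥ v)| ≤ B * (v ⬝ᵥ v))
    (k : ι) : ∫ Z, Z k ⬝ᵥ (M (Function.update Z k 0) *ᵥ Z k) ∂(gaussRows ι κ) =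
      ∫ Z, (M (Function.update Z k 0)).trace ∂(gaussRows ι κ) := by
  have hi := (memLp_rowForm hM hB k).integrable (by norm_num)
  have h2 := integrable_comp_update k hi
  unfold gaussRows at *
  rw [integral_eq_integral_update k (measurable_rowForm hM k), integral_prod _ h2]
  simp only [Function.update_self, Function.update_idem, integral_quadForm]

/-- Conditionally on the other rows this is the variance of a Gaussian quadratic form, and the
Frobenius bound `S` is uniform in those rows. -/
theorem integral_rowForm_sub_trace_sq_le (hM : Continuous M)
    (hB : ∀ Z v, |v ⬝ᵥ (M Z *ᵥ v)| ≤ B * (v ⬝ᵥ v)) (hsym : ∀ Z, (M Z)ᵀ = M Z)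
    (hS : ∀ Z, ∑ a, ∑ b, M Z a b ^ 2 ≤ S) {C : ℝ} (hC : ∀ Z, |(M Z).trace| ≤ C) (k : ι) :
    MemLp (fun Z => Z k ⬝ᵥ (M (Function.update Z k 0) *ᵥ Z k) -
        (M (Function.update Z k 0)).trace) 2 (gaussRows ι κ) ∧
    ∫ Z, (Z k ⬝ᵥ (M (Function.update Z k 0) *ᵥ Z k) - (M (Function.update Z k 0)).trace) ^ 2
      ∂(gaussRows ι κ) ≤ 2 * momentBound * S := by
  have hmt : Measurable fun Z : ι → κ → ℝ => (M (Function.update Z k 0)).trace :=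
    (hM.comp (continuous_update_zero k)).matrix_trace.measurable
  have hLp : MemLp (fun Z => Z k ⬝ᵥ (M (Function.update Z k 0) *ᵥ Z k) -
        (M (Function.update Z k 0)).trace) 2 (gaussRows ι κ) :=
    (memLp_rowForm hM hB k).sub (MemLp.of_bound hmt.aestronglyMeasurable C
      (Filter.Eventually.of_forall fun Z => hC _))
  refine ⟨hLp, ?_⟩
  have hi := hLp.integrable_sq
  have h2 := integrable_comp_update k hi
  have hms : Measurable fun Z : ι → κ → ℝ => (Z k ⬝ᵥ (M (Function.update Z k 0) *ᵥ Z k) -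
        (M (Function.update Z k 0)).trace) ^ 2 := ((measurable_rowForm hM k).sub hmt).pow_const 2
  unfold gaussRows at *
  rw [integral_eq_integral_update k hms, integral_prod _ h2]
  simp only [Function.update_self, Function.update_idem]
  have hK := one_le_momentBound
  calc _ ≤ ∫ _Z, 2 * momentBound * S ∂(Measure.pi fun _ : ι => stdGauss κ) := by
        refine integral_mono_of_nonneg (Filter.Eventually.of_forall fun Z =>
          integral_nonneg fun z => sq_nonneg _) (integrable_const _)
          (Filter.Eventually.of_forall fun Z => ?_)
        refine (integral_quadForm_sub_sq_le (hsym _)).trans ?_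
        exact mul_le_mul_of_nonneg_left (hS _) (by linarith)
    _ = _ := by simp

end LeaveOneOut

/-- Approximate mean and variance of the leave-one-out quadratic forms. -/
structure LooBounds {Ω : Type*} [MeasurableSpace Ω] (μ : Measure Ω) (a b : Ω → ℝ)
    (l m q A ε : ℝ) : Prop where
  memLp_left : MemLp a 2 μ
  memLp_right : MemLp b 2 μ
  nonneg_left : ∀ ω, 0 ≤ a ω
  nonneg_right : ∀ ω, 0 ≤ b ω
  right_le : ∀ ω, b ω ≤ a ω / l
  mean_left : |∫ ω, a ω ∂μ - m| ≤ A * ε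
  mean_right : |∫ ω, b ω ∂μ - q| ≤ A * ε
  var_left : ∫ ω, (a ω - m) ^ 2 ∂μ ≤ A * ε
  var_right : ∫ ω, (b ω - q) ^ 2 ∂μ ≤ A * ε

/-! ### Concentration of the normalized traces and leave-one-out forms. -/

section Normalized

variable {N P : ℕ} {l : ℝ} {u : Fin N → ℝ}

/-- The normalized trace of the resolvent. -/
noncomputable def normTrace (l : ℝ) (u : Fin N → ℝ) (Z : Fin N → Fin P → ℝ) : ℝ :=
  (resolvent l u Z).trace / P

/-- The normalized trace of the square of the resolvent. -/
noncomputable def normTraceSq (l : ℝ) (u : Fin N → ℝ) (Z : Fin N → Fin P → ℝ) : ℝ :=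
  (resolvent l u Z * resolvent l u Z).trace / P

/-- Both values lie in the interval of length `c` below the value with row `k` set to zero, so no
factor `2` is lost. -/
theorem abs_sub_update_le {f : (Fin N → Fin P → ℝ) → ℝ} {c : ℝ}
    (h : ∀ k Z, f (Function.update Z k 0) - f Z ∈ Set.Icc 0 c) (k : Fin N)
    (Z : Fin N → Fin P → ℝ) (z : Fin P → ℝ) : |f (Function.update Z k z) - f Z| ≤ c := by
  have h1 := h k Z
  have h2 := h k (Function.update Z k z)
  rw [Function.update_idem] at h2
  rw [abs_le]
  constructor <;> linarith [h1.1, h1.2, h2.1, h2.2]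

theorem normTrace_update_sub_mem (hl : 0 < l) (hu : ∀ k, 0 ≤ u k) (k : Fin N)
    (Z : Fin N → Fin P → ℝ) :
    normTrace l u (Function.update Z k 0) - normTrace l u Z ∈ Set.Icc 0 (1 / l / P) := by
  unfold normTrace
  rw [← sub_div, trace_resolvent_update_sub hl hu]
  have h1 := looFormSq_ratio_nonneg hl hu k Z
  have h2 := looFormSq_ratio_le hl hu k Z
  exact ⟨by positivity, by gcongr⟩

theorem normTraceSq_update_sub_mem (hl : 0 < l) (hu : ∀ k, 0 ≤ u k) (k : Fin N)
    (Z : Fin N → Fin P → ℝ) :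
    normTraceSq l u (Function.update Z k 0) - normTraceSq l u Z ∈ Set.Icc 0 (2 / l ^ 2 / P) := by
  unfold normTraceSq
  rw [← sub_div]
  obtain ⟨h1, h2⟩ := trace_resolvent_sq_update_sub_mem hl hu k Z
  exact ⟨by positivity, by gcongr⟩

theorem normTrace_mem (hl : 0 < l) (hu : ∀ k, 0 ≤ u k) (hP : 0 < P) (Z : Fin N → Fin P → ℝ) :
    normTrace l u Z ∈ Set.Icc 0 (1 / l) := by
  have hP' : (0 : ℝ) < P := by exact_mod_cast hP
  have h1 := trace_resolvent_nonneg hl hu Z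
  have h2 := trace_resolvent_le hl hu Z
  refine ⟨div_nonneg h1 hP'.le, ?_⟩
  rw [normTrace, div_le_iff₀ hP']
  simp only [Fintype.card_fin] at h2
  calc _ ≤ _ := h2
    _ = _ := by ring

theorem normTraceSq_mem (hl : 0 < l) (hu : ∀ k, 0 ≤ u k) (hP : 0 < P) (Z : Fin N → Fin P → ℝ) :
    normTraceSq l u Z ∈ Set.Icc 0 (1 / l ^ 2) := by
  have hP' : (0 : ℝ) < P := by exact_mod_cast hP
  have h1 := trace_resolvent_sq_nonneg hl hu Z
  have h2 := trace_resolvent_sq_le hl hu Z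
  refine ⟨div_nonneg h1 hP'.le, ?_⟩
  rw [normTraceSq, div_le_iff₀ hP']
  simp only [Fintype.card_fin] at h2
  calc _ ≤ _ := h2
    _ = _ := by ring

theorem continuous_normTrace (hl : 0 < l) (hu : ∀ k, 0 ≤ u k) :
    Continuous (normTrace (P := P) l u) :=
  (continuous_resolvent hl hu).matrix_trace.div_const _

theorem continuous_normTraceSq (hl : 0 < l) (hu : ∀ k, 0 ≤ u k) :
    Continuous (normTraceSq (P := P) l u) :=
  ((continuous_resolvent hl hu).matrix_mul (continuous_resolvent hl hu)).matrix_trace.div_const _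

/-- Assembling the mean and variance bounds for a leave-one-out quantity `a` from those for the
fluctuation of `a` around `g` without the `k`-th row, and the stability of `g`. -/
theorem mean_var_of_stability {a g : (Fin N → Fin P → ℝ) → ℝ} {k : Fin N} {C V c ε r : ℝ}
    (hε : 0 ≤ ε) (hε1 : ε ≤ 1) (hr : N * ε = r)
    (hg : Measurable g) (hgC : ∀ Z, |g Z| ≤ C)
    (hst : ∀ k Z, g (Function.update Z k 0) - g Z ∈ Set.Icc 0 (c * ε))
    (ha : MemLp a 2 (gaussRows (Fin N) (Fin P)))
    (hmean : ∫ Z, a Z ∂(gaussRows (Fin N) (Fin P)) =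
      ∫ Z, g (Function.update Z k 0) ∂(gaussRows (Fin N) (Fin P)))
    (hvar : ∫ Z, (a Z - g (Function.update Z k 0)) ^ 2 ∂(gaussRows (Fin N) (Fin P)) ≤ V * ε) :
    |∫ Z, a Z ∂(gaussRows (Fin N) (Fin P)) - ∫ Z, g Z ∂(gaussRows (Fin N) (Fin P))| ≤ c * ε ∧
    ∫ Z, (a Z - ∫ Z', g Z' ∂(gaussRows (Fin N) (Fin P))) ^ 2 ∂(gaussRows (Fin N) (Fin P)) ≤
      3 * (V + c ^ 2 + r * c ^ 2) * ε := by
  set π := gaussRows (Fin N) (Fin P) with hπ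
  set m := ∫ Z, g Z ∂π with hm
  have hbg : MemLp g 2 π := MemLp.of_bound hg.aestronglyMeasurable C
    (Filter.Eventually.of_forall hgC)
  have hgk : Measurable fun Z : Fin N → Fin P → ℝ => g (Function.update Z k 0) :=
    hg.comp (continuous_update_zero k).measurable
  have hbgk : MemLp (fun Z => g (Function.update Z k 0)) 2 π :=
    MemLp.of_bound hgk.aestronglyMeasurable C (Filter.Eventually.of_forall fun Z => hgC _)
  constructor
  · rw [hmean, hm, ← integral_sub (hbgk.integrable (by norm_num)) (hbg.integrable (by norm_num))]
    have := norm_integral_le_of_norm_le_const (μ := π)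
      (f := fun Z => g (Function.update Z k 0) - g Z) (C := c * ε)
      (Filter.Eventually.of_forall fun Z => by
        rw [Real.norm_eq_abs, abs_of_nonneg (hst k Z).1]; exact (hst k Z).2)
    simpa using this
  · have hv := integral_sub_sq_le_of_bounded_differences (μ := stdGauss (Fin P)) N hg hgC
      (fun k Z z => abs_sub_update_le hst k Z z)
    change ∫ Z, (g Z - m) ^ 2 ∂π ≤ N * (c * ε) ^ 2 at hv
    have hv' : N * (c * ε) ^ 2 ≤ r * c ^ 2 * ε := le_of_eq (by rw [← hr]; ring)
    have i1 := (ha.sub hbgk).integrable_sq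
    have i2 := (hbg.sub (memLp_const m)).integrable_sq
    simp only [Pi.sub_apply] at i1 i2
    have hi : Integrable (fun Z => 3 * (a Z - g (Function.update Z k 0)) ^ 2 +
        (3 * (g Z - m) ^ 2 + 3 * (c * ε) ^ 2)) π :=
      (i1.const_mul 3).add ((i2.const_mul 3).add (integrable_const _))
    calc ∫ Z, (a Z - m) ^ 2 ∂π ≤ ∫ Z, (3 * (a Z - g (Function.update Z k 0)) ^ 2 +
          (3 * (g Z - m) ^ 2 + 3 * (c * ε) ^ 2)) ∂π := by
          refine integral_mono_of_nonneg (Filter.Eventually.of_forall fun Z => sq_nonneg _) hi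
            (Filter.Eventually.of_forall fun Z => ?_)
          simp only
          obtain ⟨h1, h2⟩ := hst k Z
          set x := a Z - g (Function.update Z k 0)
          set y := g (Function.update Z k 0) - g Z
          set w := g Z - m
          have e : a Z - m = x + y + w := by simp only [x, y, w]; ring
          have h3 : y ^ 2 ≤ (c * ε) ^ 2 := pow_le_pow_left₀ h1 h2 2
          rw [e]
          -- This is `(x + y + w)² ≤ 3 (x² + y² + w²)`: conditional fluctuation, effect of restoring
          -- the row, and fluctuation of `g`.
          nlinarith [sq_nonneg (x - y), sq_nonneg (x - w), sq_nonneg (y - w)]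
      _ = 3 * ∫ Z, (a Z - g (Function.update Z k 0)) ^ 2 ∂π +
          (3 * ∫ Z, (g Z - m) ^ 2 ∂π + 3 * (c * ε) ^ 2) := by
          have hi3 : Integrable (fun Z => 3 * (g Z - m) ^ 2 + 3 * (c * ε) ^ 2) π :=
            (i2.const_mul 3).add (integrable_const _)
          rw [integral_add (i1.const_mul 3) hi3,
            integral_add (i2.const_mul 3) (integrable_const _), integral_const_mul,
            integral_const_mul]
          simp
      _ ≤ 3 * (V + c ^ 2 + r * c ^ 2) * ε := by
          have : (c * ε) ^ 2 ≤ c ^ 2 * ε := by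
            rw [mul_pow]
            exact mul_le_mul_of_nonneg_left (by nlinarith) (sq_nonneg c)
          nlinarith

/-- A bound for all error constants, in terms of the ridge `l`, the ratio `r = N / P` and the
normalized trace `τ`. -/
noncomputable def errorConst (l r τ : ℝ) : ℝ :=
  1 + 1 / l + 2 / l ^ 2 + 3 * (2 * momentBound / l ^ 2 + (1 / l) ^ 2 + r * (1 / l) ^ 2) +
    3 * (2 * momentBound / l ^ 4 + (2 / l ^ 2) ^ 2 + r * (2 / l ^ 2) ^ 2) + (l + τ)

/-- `H` and `H²` have squared Frobenius norms at most `P/l²` and `P/l⁴`. After division by `P²` the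
conditional variances are `O(1/P)`, as are the effects of one row on the normalized traces. -/
theorem looBounds (hl : 0 < l) (hu : ∀ k, 0 ≤ u k) (hP : 0 < P) {r τ : ℝ} (hr : (N : ℝ) / P = r)
    (hτ : 0 ≤ τ) (k : Fin N) :
    LooBounds (gaussRows (Fin N) (Fin P)) (fun Z => looForm l u k Z / P)
      (fun Z => looFormSq l u k Z / P) l
      (∫ Z, normTrace l u Z ∂(gaussRows (Fin N) (Fin P)))
      (∫ Z, normTraceSq l u Z ∂(gaussRows (Fin N) (Fin P))) (errorConst l r τ) (1 / P) := by
  have hP' : (0 : ℝ) < P := by exact_mod_cast hP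
  have hP1 : (1 : ℝ) ≤ P := by exact_mod_cast hP
  have hK := one_le_momentBound
  have hr0 : 0 ≤ r := by rw [← hr]; positivity
  have hε1 : 1 / (P : ℝ) ≤ 1 := by rw [div_le_one hP']; exact hP1
  have hr' : N * (1 / (P : ℝ)) = r := by rw [← hr]; ring
  have hMc := continuous_resolvent (κ := Fin P) hl hu
  have hMc2 : Continuous fun Z : Fin N → Fin P → ℝ => resolvent l u Z * resolvent l u Z :=
    hMc.matrix_mul hMc
  have hB : ∀ (Z : Fin N → Fin P → ℝ) v, |v ⬝ᵥ (resolvent l u Z *ᵥ v)| ≤ 1 / l * (v ⬝ᵥ v) :=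
    fun Z v => by
      rw [abs_of_nonneg (dotProduct_resolvent_nonneg hl hu Z v)]
      exact (dotProduct_resolvent_le hl hu Z v).trans (le_of_eq (by ring))
  have hB2 : ∀ (Z : Fin N → Fin P → ℝ) v,
      |v ⬝ᵥ ((resolvent l u Z * resolvent l u Z) *ᵥ v)| ≤ 1 / l ^ 2 * (v ⬝ᵥ v) := fun Z v => by
    rw [← dotProduct_resolvent_sq hl hu, abs_of_nonneg (dotProduct_self_nonneg' _)]
    exact (resolvent_mulVec_sq_le hl hu Z v).trans (le_of_eq (by ring))
  have hsym2 : ∀ Z : Fin N → Fin P → ℝ,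
      (resolvent l u Z * resolvent l u Z)ᵀ = resolvent l u Z * resolvent l u Z := fun Z => by
    rw [Matrix.transpose_mul, transpose_resolvent hl hu]
  have hC : ∀ Z : Fin N → Fin P → ℝ, |(resolvent l u Z).trace| ≤ P / l := fun Z => by
    rw [abs_of_nonneg (trace_resolvent_nonneg hl hu Z)]
    simpa using trace_resolvent_le hl hu Z
  have hC2 : ∀ Z : Fin N → Fin P → ℝ,
      |(resolvent l u Z * resolvent l u Z).trace| ≤ P / l ^ 2 := fun Z => by
    rw [abs_of_nonneg (trace_resolvent_sq_nonneg hl hu Z)]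
    simpa using trace_resolvent_sq_le hl hu Z
  have hS : ∀ Z : Fin N → Fin P → ℝ, ∑ a, ∑ b, resolvent l u Z a b ^ 2 ≤ P / l ^ 2 := fun Z => by
    rw [← trace_resolvent_sq hl hu]
    simpa using trace_resolvent_sq_le hl hu Z
  have hS2 : ∀ Z : Fin N → Fin P → ℝ,
      ∑ a, ∑ b, (resolvent l u Z * resolvent l u Z) a b ^ 2 ≤ P / l ^ 4 := fun Z => by
    simpa using sum_sq_resolvent_sq_le hl hu Z
  have ea : ∀ Z : Fin N → Fin P → ℝ, looForm l u k Z =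
      Z k ⬝ᵥ (resolvent l u (Function.update Z k 0) *ᵥ Z k) := fun _ => rfl
  have eb : ∀ Z : Fin N → Fin P → ℝ, looFormSq l u k Z =
      Z k ⬝ᵥ ((resolvent l u (Function.update Z k 0) * resolvent l u (Function.update Z k 0)) *ᵥ
        Z k) := fun Z => dotProduct_resolvent_sq hl hu _ _
  have ha : MemLp (fun Z => looForm l u k Z / P) 2 (gaussRows (Fin N) (Fin P)) := by
    simp only [ea, div_eq_mul_inv]
    exact (memLp_rowForm hMc hB k).mul_const _
  have hb : MemLp (fun Z => looFormSq l u k Z / P) 2 (gaussRows (Fin N) (Fin P)) := by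
    simp only [eb, div_eq_mul_inv]
    exact (memLp_rowForm hMc2 hB2 k).mul_const _
  have h1 := mean_var_of_stability (k := k) (C := 1 / l) (V := 2 * momentBound / l ^ 2)
    (c := 1 / l) (by positivity) hε1 hr' (continuous_normTrace hl hu).measurable
    (fun Z => by
      have := normTrace_mem hl hu hP Z
      rw [abs_of_nonneg this.1]; exact this.2)
    (fun k Z => by
      have := normTrace_update_sub_mem hl hu k Z
      rwa [div_eq_mul_one_div (1 / l) (P : ℝ)] at this)
    ha
    (by
      simp only [ea, normTrace, integral_div]
      rw [integral_rowForm hMc hB k])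
    (by
      have := (integral_rowForm_sub_trace_sq_le hMc hB (transpose_resolvent hl hu) hS hC k).2
      have e : ∀ Z : Fin N → Fin P → ℝ,
          (looForm l u k Z / P - normTrace l u (Function.update Z k 0)) ^ 2 =
          (Z k ⬝ᵥ (resolvent l u (Function.update Z k 0) *ᵥ Z k) -
            (resolvent l u (Function.update Z k 0)).trace) ^ 2 / (P : ℝ) ^ 2 := fun Z => by
        rw [ea, normTrace]; field_simp
      simp only [e, integral_div]
      rw [div_le_iff₀ (by positivity)]
      refine this.trans (le_of_eq ?_)
      field_simp)
  have h2 := mean_var_of_stability (k := k) (C := 1 / l ^ 2) (V := 2 * momentBound / l ^ 4)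
    (c := 2 / l ^ 2) (by positivity) hε1 hr' (continuous_normTraceSq hl hu).measurable
    (fun Z => by
      have := normTraceSq_mem hl hu hP Z
      rw [abs_of_nonneg this.1]; exact this.2)
    (fun k Z => by
      have := normTraceSq_update_sub_mem hl hu k Z
      rwa [div_eq_mul_one_div (2 / l ^ 2) (P : ℝ)] at this)
    hb
    (by
      simp only [eb, normTraceSq, integral_div]
      rw [integral_rowForm hMc2 hB2 k])
    (by
      have := (integral_rowForm_sub_trace_sq_le hMc2 hB2 hsym2 hS2 hC2 k).2
      have e : ∀ Z : Fin N → Fin P → ℝ,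
          (looFormSq l u k Z / P - normTraceSq l u (Function.update Z k 0)) ^ 2 =
          (Z k ⬝ᵥ ((resolvent l u (Function.update Z k 0) *
              resolvent l u (Function.update Z k 0)) *ᵥ Z k) -
            (resolvent l u (Function.update Z k 0) *
              resolvent l u (Function.update Z k 0)).trace) ^ 2 / (P : ℝ) ^ 2 := fun Z => by
        rw [eb, normTraceSq]; field_simp
      simp only [e, integral_div]
      rw [div_le_iff₀ (by positivity)]
      refine this.trans (le_of_eq ?_)
      field_simp)
  have p1 : 0 ≤ 1 / l := by positivity
  have p2 : 0 ≤ 2 / l ^ 2 := by positivity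
  have p3 : 0 ≤ 3 * (2 * momentBound / l ^ 2 + (1 / l) ^ 2 + r * (1 / l) ^ 2) := by positivity
  have p4 : 0 ≤ 3 * (2 * momentBound / l ^ 4 + (2 / l ^ 2) ^ 2 + r * (2 / l ^ 2) ^ 2) := by
    positivity
  have hε : 0 ≤ 1 / (P : ℝ) := by positivity
  have hle : ∀ {x : ℝ}, x ≤ errorConst l r τ → x * (1 / P) ≤ errorConst l r τ * (1 / P) :=
    fun h => mul_le_mul_of_nonneg_right h hε
  refine ⟨ha, hb, fun Z => div_nonneg (looForm_nonneg hl hu k Z) hP'.le,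
    fun Z => div_nonneg (looFormSq_nonneg k Z) hP'.le, fun Z => ?_, h1.1.trans (hle ?_),
    h2.1.trans (hle ?_), h1.2.trans (hle ?_), h2.2.trans (hle ?_)⟩
  · rw [div_right_comm]
    exact div_le_div_of_nonneg_right (looFormSq_le hl hu k Z) hP'.le
  all_goals unfold errorConst; linarith

/-- Averages the tangent-line bound, using `E ‖zₖ‖² = P`; `c = 1/(l + τ)` is the optimal slope
parameter. Only the sum of the weights enters, which keeps later constants independent of individual
eigenvalues. -/
theorem le_integral_normTrace (hl : 0 < l) (hu : ∀ k, 0 ≤ u k) (hP : 0 < P) {τ : ℝ}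
    (hτ : ∑ k, u k = τ) :
    1 / (l + τ) ≤ ∫ Z, normTrace l u Z ∂(gaussRows (Fin N) (Fin P)) := by
  have hP' : (0 : ℝ) < P := by exact_mod_cast hP
  have hτ0 : 0 ≤ τ := hτ ▸ Finset.sum_nonneg fun k _ => hu k
  have hlt : 0 < l + τ := by linarith
  set c := 1 / (l + τ) with hc
  have i : ∀ k, Integrable (fun Z : Fin N → Fin P → ℝ => u k * (Z k ⬝ᵥ Z k))
      (gaussRows (Fin N) (Fin P)) := fun k =>
    ((memLp_row_dotProduct_self k).integrable (by norm_num)).const_mul _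
  have hsum : ∫ Z, ∑ k, u k * (Z k ⬝ᵥ Z k) ∂(gaussRows (Fin N) (Fin P)) = τ * P := by
    rw [integral_finsetSum _ fun k _ => i k]
    simp only [integral_const_mul, integral_row_dotProduct_self, Fintype.card_fin]
    rw [← Finset.sum_mul, hτ]
  have hi2 : Integrable (fun Z : Fin N → Fin P → ℝ =>
      (2 * c - c ^ 2 * l) - c ^ 2 / P * ∑ k, u k * (Z k ⬝ᵥ Z k)) (gaussRows (Fin N) (Fin P)) :=
    (integrable_const _).sub ((integrable_finsetSum _ fun k _ => i k).const_mul _)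
  have hi : Integrable (normTrace (P := P) l u) (gaussRows (Fin N) (Fin P)) :=
    Integrable.of_bound (continuous_normTrace hl hu).aestronglyMeasurable (1 / l)
      (Filter.Eventually.of_forall fun Z => by
        have := normTrace_mem hl hu hP Z
        rw [Real.norm_eq_abs, abs_of_nonneg this.1]; exact this.2)
  calc c = (2 * c - c ^ 2 * l) - c ^ 2 / P * (τ * P) := by
        rw [hc]; field_simp; ring
    _ = ∫ Z, ((2 * c - c ^ 2 * l) - c ^ 2 / P * ∑ k, u k * (Z k ⬝ᵥ Z k))
        ∂(gaussRows (Fin N) (Fin P)) := by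
        rw [integral_sub (integrable_const _)
          ((integrable_finsetSum _ fun k _ => i k).const_mul _), integral_const_mul, hsum]
        simp
    _ ≤ _ := by
        refine integral_mono hi2 hi fun Z => ?_
        have := le_trace_resolvent hl hu Z c
        simp only [Fintype.card_fin] at this
        simp only [normTrace]
        rw [le_div_iff₀ hP']
        refine le_trans (le_of_eq ?_) this
        field_simp
        ring

end Normalized

/-! ### Taylor expansions with remainders controlled for arbitrarily large `d`. -/

section Expansion

variable {a b d l m : ℝ}

/-- The remainder is exactly `-d² (a - m)² / ((1 + dm)² (1 + da))`, and `d/(1 + dm) ≤ 1/m` removes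
`d`. -/
theorem abs_ratio_expansion_le (ha : 0 ≤ a) (hd : 0 ≤ d) (hm : 0 < m) :
    |d * a / (1 + d * a) - (d * m / (1 + d * m) + d / (1 + d * m) ^ 2 * (a - m))| ≤
      (1 / m) ^ 2 * (a - m) ^ 2 := by
  have hda : 0 ≤ d * a := mul_nonneg hd ha
  have hdm : 0 ≤ d * m := mul_nonneg hd hm.le
  have hu : 0 < 1 + d * a := by linarith
  have hw : 0 < 1 + d * m := by linarith
  have e : d * a / (1 + d * a) - (d * m / (1 + d * m) + d / (1 + d * m) ^ 2 * (a - m)) =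
      -(d ^ 2 / ((1 + d * m) ^ 2 * (1 + d * a)) * (a - m) ^ 2) := by
    field_simp
    ring
  rw [e, abs_neg, abs_of_nonneg (by positivity)]
  refine mul_le_mul_of_nonneg_right ?_ (sq_nonneg _)
  rw [one_div, inv_pow, ← one_div, div_le_div_iff₀ (by positivity) (by positivity)]
  nlinarith [mul_nonneg (sq_nonneg (1 + d * m)) hda]

theorem inv_sq_expansion (d a m : ℝ) (hu : 0 < 1 + d * a) (hw : 0 < 1 + d * m) :
    1 / (1 + d * a) ^ 2 = 1 / (1 + d * m) ^ 2 - 2 * d / (1 + d * m) ^ 3 * (a - m) +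
      d ^ 2 * (a - m) ^ 2 * (2 * (1 + d * a) + (1 + d * m)) /
        ((1 + d * a) ^ 2 * (1 + d * m) ^ 3) := by
  field_simp
  ring

/-- Only the denominator is expanded. In the remainder one factor is absorbed by `d b/(1 + da) ≤
1/l`, a consequence of `b ≤ a/l`, and two by `d/(1 + dm) ≤ 1/m`. -/
theorem abs_sq_ratio_expansion_le (ha : 0 ≤ a) (hb : 0 ≤ b) (hl : 0 < l) (hba : b ≤ a / l)
    (hd : 0 ≤ d) (hm : 0 < m) :
    |d * b / (1 + d * a) ^ 2 -
        (d / (1 + d * m) ^ 2 * b - 2 * d ^ 2 / (1 + d * m) ^ 3 * (b * (a - m)))| ≤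
      3 * (1 / l) * (1 / m) ^ 2 * (a - m) ^ 2 := by
  have hda : 0 ≤ d * a := mul_nonneg hd ha
  have hdm : 0 ≤ d * m := mul_nonneg hd hm.le
  have hu : 0 < 1 + d * a := by linarith
  have hw : 0 < 1 + d * m := by linarith
  have e : d * b / (1 + d * a) ^ 2 -
      (d / (1 + d * m) ^ 2 * b - 2 * d ^ 2 / (1 + d * m) ^ 3 * (b * (a - m))) =
      (d * b / (1 + d * a)) * (d / (1 + d * m)) ^ 2 * (2 / (1 + d * m) + 1 / (1 + d * a)) *
        (a - m) ^ 2 := by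
    rw [div_eq_mul_one_div (d * b) ((1 + d * a) ^ 2), inv_sq_expansion d a m hu hw]
    field_simp
    ring
  have h1 : d * b / (1 + d * a) ≤ 1 / l := by
    rw [div_le_div_iff₀ hu hl]
    rw [le_div_iff₀ hl] at hba
    nlinarith [mul_le_mul_of_nonneg_left hba hd]
  have h2 : d / (1 + d * m) ≤ 1 / m := by
    rw [div_le_div_iff₀ hw hm]; linarith
  have h3 : 2 / (1 + d * m) + 1 / (1 + d * a) ≤ 3 := by
    have e1 : 2 / (1 + d * m) ≤ 2 := div_le_self (by norm_num) (by linarith)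
    have e2 : 1 / (1 + d * a) ≤ 1 := div_le_self (by norm_num) (by linarith)
    linarith
  rw [e, abs_of_nonneg (by positivity)]
  refine mul_le_mul_of_nonneg_right ?_ (sq_nonneg _)
  calc _ ≤ 1 / l * (1 / m) ^ 2 * 3 := by gcongr
    _ = _ := by ring

/-- With the extra factor `d` the remainder has no bound uniform in `d`, since `a` may be close to
zero. It is nonnegative, however, and is dropped. -/
theorem sq_ratio_expansion_ge (ha : 0 ≤ a) (hb : 0 ≤ b) (hd : 0 ≤ d) (hm : 0 < m) :
    d ^ 2 / (1 + d * m) ^ 2 * b - 2 * d ^ 3 / (1 + d * m) ^ 3 * (b * (a - m)) ≤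
      d ^ 2 * b / (1 + d * a) ^ 2 := by
  have hda : 0 ≤ d * a := mul_nonneg hd ha
  have hdm : 0 ≤ d * m := mul_nonneg hd hm.le
  have hu : 0 < 1 + d * a := by linarith
  have hw : 0 < 1 + d * m := by linarith
  rw [div_eq_mul_one_div (d ^ 2 * b) ((1 + d * a) ^ 2), inv_sq_expansion d a m hu hw]
  have hnn : 0 ≤ d ^ 2 * b * (d ^ 2 * (a - m) ^ 2 * (2 * (1 + d * a) + (1 + d * m)) /
        ((1 + d * a) ^ 2 * (1 + d * m) ^ 3)) := by positivity
  have e : d ^ 2 / (1 + d * m) ^ 2 * b - 2 * d ^ 3 / (1 + d * m) ^ 3 * (b * (a - m)) =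
      d ^ 2 * b * (1 / (1 + d * m) ^ 2 - 2 * d / (1 + d * m) ^ 3 * (a - m)) := by
    field_simp
  rw [e, mul_add]
  linarith

theorem abs_div_sq_sub_le {m₀ : ℝ} (hd : 0 ≤ d) (hm : 0 < m) (hm₀ : 0 < m₀) :
    |d / (1 + d * m) ^ 2 - d / (1 + d * m₀) ^ 2| ≤ 2 * (1 / m) * (1 / m₀) * |m - m₀| := by
  have hdm : 0 ≤ d * m := mul_nonneg hd hm.le
  have hdm0 : 0 ≤ d * m₀ := mul_nonneg hd hm₀.le
  have hw : 0 < 1 + d * m := by linarith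
  have hw0 : 0 < 1 + d * m₀ := by linarith
  have e : d / (1 + d * m) ^ 2 - d / (1 + d * m₀) ^ 2 =
      (1 / (1 + d * m₀) + 1 / (1 + d * m)) * (d / (1 + d * m)) * (d / (1 + d * m₀)) *
        -(m - m₀) := by
    field_simp
    ring
  have h1 : d / (1 + d * m) ≤ 1 / m := by
    rw [div_le_div_iff₀ hw hm]; linarith
  have h2 : d / (1 + d * m₀) ≤ 1 / m₀ := by
    rw [div_le_div_iff₀ hw0 hm₀]; linarith
  have h3 : 1 / (1 + d * m₀) + 1 / (1 + d * m) ≤ 2 := by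
    have e1 : 1 / (1 + d * m) ≤ 1 := div_le_self (by norm_num) (by linarith)
    have e2 : 1 / (1 + d * m₀) ≤ 1 := div_le_self (by norm_num) (by linarith)
    linarith
  rw [e, abs_mul, abs_neg, abs_of_nonneg (by positivity)]
  refine mul_le_mul_of_nonneg_right ?_ (abs_nonneg _)
  gcongr

end Expansion

/-! ### Expectations of the expanded ratios, up to order `ε`. -/

section Expectation

variable {Ω : Type*} [MeasurableSpace Ω] {μ : Measure Ω}

theorem abs_integral_sub_le_of_abs_sub_le {f X Y : Ω → ℝ} (hf : AEStronglyMeasurable f μ)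
    (hX : Integrable X μ) (hY : Integrable Y μ) (h : ∀ ω, |f ω - X ω| ≤ Y ω) :
    Integrable f μ ∧ |∫ ω, f ω ∂μ - ∫ ω, X ω ∂μ| ≤ ∫ ω, Y ω ∂μ := by
  have hd : Integrable (fun ω => f ω - X ω) μ :=
    hY.mono' (hf.sub hX.aestronglyMeasurable) (Filter.Eventually.of_forall h)
  have hfi : Integrable f μ := by
    have := hd.add hX
    exact this.congr (Filter.Eventually.of_forall fun ω => sub_add_cancel (f ω) (X ω))
  refine ⟨hfi, ?_⟩
  rw [← integral_sub hfi hX]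
  exact abs_integral_le_integral_abs.trans (integral_mono hd.abs hY h)

variable [IsProbabilityMeasure μ] {a b : Ω → ℝ} {l m q A ε d : ℝ}

theorem LooBounds.integrable_left (h : LooBounds μ a b l m q A ε) : Integrable a μ :=
  h.memLp_left.integrable (by norm_num)

theorem LooBounds.integrable_right (h : LooBounds μ a b l m q A ε) : Integrable b μ :=
  h.memLp_right.integrable (by norm_num)

theorem LooBounds.integrable_sq_left (h : LooBounds μ a b l m q A ε) :
    Integrable (fun ω => (a ω - m) ^ 2) μ :=
  (h.memLp_left.sub (memLp_const m)).integrable_sq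

theorem LooBounds.integrable_sq_right (h : LooBounds μ a b l m q A ε) :
    Integrable (fun ω => (b ω - q) ^ 2) μ :=
  (h.memLp_right.sub (memLp_const q)).integrable_sq

theorem LooBounds.integrable_mul_sub (h : LooBounds μ a b l m q A ε) (c : ℝ) :
    Integrable (fun ω => b ω * (a ω - c)) μ :=
  h.memLp_right.integrable_mul (h.memLp_left.sub (memLp_const c))

/-- Write `b (a - m) = (b - q)(a - m) + q (a - m)`. The first term is bounded by the two mean
squares, the second by the bias of `a`, so the result has order `ε` although `a - m` may have order
`√ε`. -/
theorem LooBounds.abs_integral_mul_sub_le (h : LooBounds μ a b l m q A ε) (hA : 1 ≤ A)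
    (hε : 0 ≤ ε) (hq0 : 0 ≤ q) (hq : q ≤ A) :
    |∫ ω, b ω * (a ω - m) ∂μ| ≤ 2 * A ^ 2 * ε := by
  have i1 : Integrable (fun ω => (b ω - q) * (a ω - m)) μ :=
    (h.memLp_right.sub (memLp_const q)).integrable_mul (h.memLp_left.sub (memLp_const m))
  have i2 : Integrable (fun ω => q * (a ω - m)) μ :=
    (h.integrable_left.sub (integrable_const _)).const_mul _
  have e : ∫ ω, b ω * (a ω - m) ∂μ =
      ∫ ω, (b ω - q) * (a ω - m) ∂μ + q * (∫ ω, a ω ∂μ - m) := by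
    have e1 : ∀ ω, b ω * (a ω - m) = (b ω - q) * (a ω - m) + q * (a ω - m) := fun ω => by ring
    simp only [e1]
    rw [integral_add i1 i2, integral_const_mul,
      integral_sub h.integrable_left (integrable_const _)]
    simp
  have h1 : |∫ ω, (b ω - q) * (a ω - m) ∂μ| ≤ A * ε := by
    calc _ ≤ ∫ ω, |(b ω - q) * (a ω - m)| ∂μ := abs_integral_le_integral_abs
      _ ≤ ∫ ω, (1 / 2 * (b ω - q) ^ 2 + 1 / 2 * (a ω - m) ^ 2) ∂μ := by
          refine integral_mono i1.abs ((h.integrable_sq_right.const_mul _).add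
            (h.integrable_sq_left.const_mul _)) fun ω => ?_
          simp only
          rw [abs_mul]
          nlinarith [sq_nonneg (|b ω - q| - |a ω - m|), sq_abs (b ω - q), sq_abs (a ω - m)]
      _ = 1 / 2 * ∫ ω, (b ω - q) ^ 2 ∂μ + 1 / 2 * ∫ ω, (a ω - m) ^ 2 ∂μ := by
          rw [integral_add (h.integrable_sq_right.const_mul _) (h.integrable_sq_left.const_mul _),
            integral_const_mul, integral_const_mul]
      _ ≤ A * ε := by linarith [h.var_left, h.var_right]
  have h2 : |q * (∫ ω, a ω ∂μ - m)| ≤ A * (A * ε) := by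
    rw [abs_mul, abs_of_nonneg hq0]
    exact mul_le_mul hq h.mean_left (abs_nonneg _) (by linarith)
  rw [e]
  refine (abs_add_le _ _).trans ((add_le_add h1 h2).trans ?_)
  nlinarith [mul_nonneg (mul_nonneg (sub_nonneg.2 hA) (by linarith : 0 ≤ A)) hε]

theorem LooBounds.integral_ratio (h : LooBounds μ a b l m q A ε) (hA : 1 ≤ A) (hε : 0 ≤ ε)
    (hm : 0 < m) (hmA : 1 / m ≤ A) (hd : 0 ≤ d) :
    Integrable (fun ω => d * a ω / (1 + d * a ω)) μ ∧
    |∫ ω, d * a ω / (1 + d * a ω) ∂μ - d * m / (1 + d * m)| ≤ 2 * A ^ 3 * ε := by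
  have hdm : 0 ≤ d * m := mul_nonneg hd hm.le
  have hw : 0 < 1 + d * m := by linarith
  have hia := h.integrable_left
  have hX : Integrable (fun ω => d * m / (1 + d * m) + d / (1 + d * m) ^ 2 * (a ω - m)) μ :=
    (integrable_const _).add ((hia.sub (integrable_const _)).const_mul _)
  have hf : AEStronglyMeasurable (fun ω => d * a ω / (1 + d * a ω)) μ := by
    have := hia.aemeasurable
    exact ((this.const_mul d).div ((this.const_mul d).const_add 1)).aestronglyMeasurable
  obtain ⟨hi, hle⟩ := abs_integral_sub_le_of_abs_sub_le hf hX (h.integrable_sq_left.const_mul _)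
    (fun ω => abs_ratio_expansion_le (h.nonneg_left ω) hd hm)
  refine ⟨hi, ?_⟩
  have e : ∫ ω, (d * m / (1 + d * m) + d / (1 + d * m) ^ 2 * (a ω - m)) ∂μ =
      d * m / (1 + d * m) + d / (1 + d * m) ^ 2 * (∫ ω, a ω ∂μ - m) := by
    have hc : Integrable (fun ω => d / (1 + d * m) ^ 2 * (a ω - m)) μ :=
      (hia.sub (integrable_const _)).const_mul _
    rw [integral_add (integrable_const _) hc,
      integral_const_mul, integral_sub hia (integrable_const _)]
    simp
  rw [e, integral_const_mul] at hle
  have hc : d / (1 + d * m) ^ 2 ≤ A := by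
    refine le_trans ?_ hmA
    rw [div_le_div_iff₀ (by positivity) hm]
    nlinarith
  have h1 : |d / (1 + d * m) ^ 2 * (∫ ω, a ω ∂μ - m)| ≤ A * (A * ε) := by
    rw [abs_mul, abs_of_nonneg (by positivity)]
    exact mul_le_mul hc h.mean_left (abs_nonneg _) (by linarith)
  have h2 : (1 / m) ^ 2 * ∫ ω, (a ω - m) ^ 2 ∂μ ≤ A ^ 2 * (A * ε) :=
    mul_le_mul (pow_le_pow_left₀ (by positivity) hmA 2) h.var_left
      (integral_nonneg fun ω => sq_nonneg _) (by positivity)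
  have h3 : A * (A * ε) ≤ A ^ 3 * ε := by
    have : A ^ 2 ≤ A ^ 3 := pow_le_pow_right₀ hA (by norm_num)
    nlinarith
  calc _ = |(∫ ω, d * a ω / (1 + d * a ω) ∂μ -
        (d * m / (1 + d * m) + d / (1 + d * m) ^ 2 * (∫ ω, a ω ∂μ - m))) +
        d / (1 + d * m) ^ 2 * (∫ ω, a ω ∂μ - m)| := by congr 1; ring
    _ ≤ A ^ 2 * (A * ε) + A * (A * ε) :=
        (abs_add_le _ _).trans (add_le_add (hle.trans h2) h1)
    _ ≤ 2 * A ^ 3 * ε := by linarith [show A ^ 2 * (A * ε) = A ^ 3 * ε by ring]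

theorem LooBounds.integral_sq_ratio (h : LooBounds μ a b l m q A ε) (hA : 1 ≤ A) (hε : 0 ≤ ε)
    (hl : 0 < l) (hlA : 1 / l ≤ A) (hm : 0 < m) (hmA : 1 / m ≤ A) (hq0 : 0 ≤ q) (hq : q ≤ A)
    (hd : 0 ≤ d) :
    Integrable (fun ω => d * b ω / (1 + d * a ω) ^ 2) μ ∧
    |∫ ω, d * b ω / (1 + d * a ω) ^ 2 ∂μ - d * q / (1 + d * m) ^ 2| ≤ 8 * A ^ 4 * ε := by
  have hdm : 0 ≤ d * m := mul_nonneg hd hm.le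
  have hw : 0 < 1 + d * m := by linarith
  have hia := h.integrable_left
  have hib := h.integrable_right
  have hX : Integrable (fun ω => d / (1 + d * m) ^ 2 * b ω -
      2 * d ^ 2 / (1 + d * m) ^ 3 * (b ω * (a ω - m))) μ :=
    (hib.const_mul _).sub ((h.integrable_mul_sub m).const_mul _)
  have hf : AEStronglyMeasurable (fun ω => d * b ω / (1 + d * a ω) ^ 2) μ :=
    ((hib.aemeasurable.const_mul d).div
      (((hia.aemeasurable.const_mul d).const_add 1).pow_const 2)).aestronglyMeasurable
  obtain ⟨hi, hle⟩ := abs_integral_sub_le_of_abs_sub_le hf hX (h.integrable_sq_left.const_mul _)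
    (fun ω => abs_sq_ratio_expansion_le (h.nonneg_left ω) (h.nonneg_right ω) hl (h.right_le ω)
      hd hm)
  refine ⟨hi, ?_⟩
  rw [integral_sub (hib.const_mul _) ((h.integrable_mul_sub m).const_mul _), integral_const_mul,
    integral_const_mul, integral_const_mul] at hle
  have hdw : d / (1 + d * m) ≤ A := by
    refine le_trans ?_ hmA
    rw [div_le_div_iff₀ (by positivity) hm]
    nlinarith
  have hc : d / (1 + d * m) ^ 2 ≤ A := by
    refine le_trans ?_ hdw
    exact div_le_div_of_nonneg_left hd hw (by nlinarith)
  have hc2 : 2 * d ^ 2 / (1 + d * m) ^ 3 ≤ 2 * A ^ 2 := by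
    calc 2 * d ^ 2 / (1 + d * m) ^ 3 ≤ 2 * d ^ 2 / (1 + d * m) ^ 2 := by
          refine div_le_div_of_nonneg_left (by positivity) (by positivity) ?_
          exact pow_le_pow_right₀ (by linarith) (by norm_num)
      _ = 2 * (d / (1 + d * m)) ^ 2 := by rw [div_pow, mul_div_assoc]
      _ ≤ 2 * A ^ 2 := by gcongr
  have h1 : |d / (1 + d * m) ^ 2 * (∫ ω, b ω ∂μ - q)| ≤ A * (A * ε) := by
    rw [abs_mul, abs_of_nonneg (by positivity)]
    exact mul_le_mul hc h.mean_right (abs_nonneg _) (by linarith)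
  have h2 : |2 * d ^ 2 / (1 + d * m) ^ 3 * ∫ ω, b ω * (a ω - m) ∂μ| ≤
      2 * A ^ 2 * (2 * A ^ 2 * ε) := by
    rw [abs_mul, abs_of_nonneg (by positivity)]
    exact mul_le_mul hc2 (h.abs_integral_mul_sub_le hA hε hq0 hq) (abs_nonneg _) (by positivity)
  have h3 : 3 * (1 / l) * (1 / m) ^ 2 * ∫ ω, (a ω - m) ^ 2 ∂μ ≤ 3 * A * A ^ 2 * (A * ε) := by
    refine mul_le_mul ?_ h.var_left (integral_nonneg fun ω => sq_nonneg _) (by positivity)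
    gcongr
  have h4 : A * (A * ε) ≤ A ^ 4 * ε := by
    have : A ^ 2 ≤ A ^ 4 := pow_le_pow_right₀ hA (by norm_num)
    nlinarith
  calc _ = |((∫ ω, d * b ω / (1 + d * a ω) ^ 2 ∂μ -
        (d / (1 + d * m) ^ 2 * ∫ ω, b ω ∂μ -
          2 * d ^ 2 / (1 + d * m) ^ 3 * ∫ ω, b ω * (a ω - m) ∂μ)) +
        d / (1 + d * m) ^ 2 * (∫ ω, b ω ∂μ - q)) -
        2 * d ^ 2 / (1 + d * m) ^ 3 * ∫ ω, b ω * (a ω - m) ∂μ| := by congr 1; ring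
    _ ≤ 3 * A * A ^ 2 * (A * ε) + A * (A * ε) + 2 * A ^ 2 * (2 * A ^ 2 * ε) :=
        (abs_sub _ _).trans (add_le_add ((abs_add_le _ _).trans (add_le_add (hle.trans h3) h1)) h2)
    _ ≤ 8 * A ^ 4 * ε := by nlinarith

/-- The expansion is made at the limiting value `m₀`, not at `m`, so that the limiting coefficient
appears at once; the price is the term in `B`. -/
theorem LooBounds.le_integral_sq_ratio (h : LooBounds μ a b l m q A ε) (hA : 1 ≤ A) (hε : 0 ≤ ε)
    (hε1 : ε ≤ 1) (hq0 : 0 ≤ q) (hq : q ≤ A) (hd : 0 ≤ d)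
    {m₀ B : ℝ} (hm₀ : 0 < m₀) (hmA : 1 / m₀ ≤ A) (hB : 0 ≤ B) (hmB : |m - m₀| ≤ B * ε)
    (hi : Integrable (fun ω => d ^ 2 * b ω / (1 + d * a ω) ^ 2) μ) :
    d ^ 2 / (1 + d * m₀) ^ 2 * q - (5 * A ^ 5 + 4 * A ^ 4 * B) * ε ≤
      ∫ ω, d ^ 2 * b ω / (1 + d * a ω) ^ 2 ∂μ := by
  have hdm : 0 ≤ d * m₀ := mul_nonneg hd hm₀.le
  have hw : 0 < 1 + d * m₀ := by linarith
  have hia := h.integrable_left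
  have hib := h.integrable_right
  have hX : Integrable (fun ω => d ^ 2 / (1 + d * m₀) ^ 2 * b ω -
      2 * d ^ 3 / (1 + d * m₀) ^ 3 * (b ω * (a ω - m₀))) μ :=
    (hib.const_mul _).sub ((h.integrable_mul_sub m₀).const_mul _)
  have hle := integral_mono hX hi
    (fun ω => sq_ratio_expansion_ge (h.nonneg_left ω) (h.nonneg_right ω) hd hm₀)
  rw [integral_sub (hib.const_mul _) ((h.integrable_mul_sub m₀).const_mul _), integral_const_mul,
    integral_const_mul] at hle
  have hdw : d / (1 + d * m₀) ≤ A := by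
    refine le_trans ?_ hmA
    rw [div_le_div_iff₀ (by positivity) hm₀]
    nlinarith
  have hc2 : d ^ 2 / (1 + d * m₀) ^ 2 ≤ A ^ 2 := by
    rw [← div_pow]; exact pow_le_pow_left₀ (by positivity) hdw 2
  have hc3 : 2 * d ^ 3 / (1 + d * m₀) ^ 3 ≤ 2 * A ^ 3 := by
    rw [mul_div_assoc, ← div_pow]
    have := pow_le_pow_left₀ (by positivity) hdw 3
    linarith
  have hb0 : 0 ≤ ∫ ω, b ω ∂μ := integral_nonneg h.nonneg_right
  -- From `q ≤ A` and a bias of at most `A ε ≤ A`.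
  have hb1 : ∫ ω, b ω ∂μ ≤ 2 * A := by
    have := (abs_le.1 h.mean_right).2
    nlinarith
  have e : ∫ ω, b ω * (a ω - m₀) ∂μ =
      ∫ ω, b ω * (a ω - m) ∂μ + (m - m₀) * ∫ ω, b ω ∂μ := by
    rw [← integral_const_mul, ← integral_add (h.integrable_mul_sub m) (hib.const_mul _)]
    exact integral_congr_ae (Filter.Eventually.of_forall fun ω => by simp only; ring)
  have h1 : ∫ ω, b ω * (a ω - m₀) ∂μ ≤ 2 * A ^ 2 * ε + B * ε * (2 * A) := by
    rw [e]
    refine add_le_add ((le_abs_self _).trans (h.abs_integral_mul_sub_le hA hε hq0 hq)) ?_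
    exact mul_le_mul ((le_abs_self _).trans hmB) hb1 hb0 (by positivity)
  have h2 : 2 * d ^ 3 / (1 + d * m₀) ^ 3 * ∫ ω, b ω * (a ω - m₀) ∂μ ≤
      2 * A ^ 3 * (2 * A ^ 2 * ε + B * ε * (2 * A)) := by
    refine (mul_le_mul_of_nonneg_left h1 (by positivity)).trans ?_
    exact mul_le_mul_of_nonneg_right hc3 (by positivity)
  have h3 : d ^ 2 / (1 + d * m₀) ^ 2 * (q - ∫ ω, b ω ∂μ) ≤ A ^ 2 * (A * ε) := by
    have : q - ∫ ω, b ω ∂μ ≤ A * ε := by linarith [(abs_le.1 h.mean_right).1]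
    refine (mul_le_mul_of_nonneg_left this (by positivity)).trans ?_
    exact mul_le_mul_of_nonneg_right hc2 (by positivity)
  have h4 : A ^ 3 * ε ≤ A ^ 5 * ε :=
    mul_le_mul_of_nonneg_right (pow_le_pow_right₀ hA (by norm_num)) hε
  nlinarith

end Expectation

/-! ### Stability of the self-consistent equations. -/

section SelfConsistent

/-- Stability of the self-consistent equations: approximate solutions `m`, `q` of the equations
for the normalized traces of the resolvent and its square are close to the exact ones. -/
theorem self_consistent_stability {ι : Type*} [Fintype ι] {d E₁ E₂ : ι → ℝ}
    {l m q m₀ A ε r : ℝ} (hl : 0 < l) (hlA : 1 / l ≤ A) (hA : 1 ≤ A) (hε : 0 ≤ ε)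
    (hr : Fintype.card ι * ε = r) (hd : ∀ k, 0 ≤ d k) (hm : 0 < m) (hmA : 1 / m ≤ A)
    (hm₀ : 0 < m₀) (hm₀A : 1 / m₀ ≤ A) (hq0 : 0 ≤ q) (hq : q ≤ A)
    (h₀ : 1 = l * m₀ + ε * ∑ k, d k * m₀ / (1 + d k * m₀))
    (h₁ : 1 = l * m + ε * ∑ k, E₁ k)
    (hE₁ : ∀ k, |E₁ k - d k * m / (1 + d k * m)| ≤ 2 * A ^ 3 * ε)
    (h₂ : m = l * q + ε * ∑ k, E₂ k)
    (hE₂ : ∀ k, |E₂ k - d k * q / (1 + d k * m) ^ 2| ≤ 8 * A ^ 4 * ε) :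
    |m - m₀| ≤ 2 * A ^ 4 * r * ε ∧
    m₀ / (l + ε * ∑ k, d k / (1 + d k * m₀) ^ 2) -
      A * (2 * A ^ 4 * r + 8 * A ^ 4 * r + 4 * A ^ 7 * r ^ 2) * ε ≤ q := by
  have hr0 : 0 ≤ r := by rw [← hr]; positivity
  have sum_le : ∀ {x y : ι → ℝ} {c : ℝ}, (∀ k, |x k - y k| ≤ c) →
      |ε * ∑ k, x k - ε * ∑ k, y k| ≤ r * c := fun {x y c} h => by
    rw [← mul_sub, ← Finset.sum_sub_distrib, abs_mul, abs_of_nonneg hε, ← hr]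
    calc ε * |∑ k, (x k - y k)| ≤ ε * ∑ k, |x k - y k| := by
          gcongr; exact Finset.abs_sum_le_sum_abs _ _
      _ ≤ ε * ∑ _k : ι, c := by gcongr with k; exact h k
      _ = _ := by simp; ring
  have hw : ∀ {x : ℝ}, 0 < x → ∀ k, 0 < 1 + d k * x := fun hx k => by
    have := mul_nonneg (hd k) hx.le
    linarith
  have mono : ∀ {x y : ℝ}, 0 < x → x ≤ y →
      ε * ∑ k, d k * x / (1 + d k * x) ≤ ε * ∑ k, d k * y / (1 + d k * y) := fun {x y} hx hxy => by
    refine mul_le_mul_of_nonneg_left (Finset.sum_le_sum fun k _ => ?_) hε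
    rw [div_le_div_iff₀ (hw hx k) (hw (hx.trans_le hxy) k)]
    nlinarith [mul_le_mul_of_nonneg_left hxy (hd k)]
  have hs₁ := sum_le hE₁
  -- The map `x ↦ l x + ε ∑ d x/(1 + d x)` increases with slope at least `l`, so the defect in the
  -- equation for `m` controls `l |m - m₀|`.
  have key : l * |m - m₀| ≤ r * (2 * A ^ 3 * ε) := by
    rcases le_total m m₀ with hle | hle
    · have := mono hm hle
      rw [abs_of_nonpos (by linarith)]
      have := (abs_le.1 hs₁).2
      nlinarith
    · have := mono hm₀ hle
      rw [abs_of_nonneg (by linarith)]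
      have := (abs_le.1 hs₁).1
      nlinarith
  have hdiv : ∀ {x y : ℝ}, 0 ≤ y → l * x ≤ y → x ≤ A * y := fun {x y} hy h => by
    have : x ≤ 1 / l * y := by
      rw [one_div, inv_mul_eq_div, le_div_iff₀ hl, mul_comm]; exact h
    exact this.trans (mul_le_mul_of_nonneg_right hlA hy)
  have hmm : |m - m₀| ≤ 2 * A ^ 4 * r * ε :=
    (hdiv (by positivity) key).trans (le_of_eq (by ring))
  refine ⟨hmm, ?_⟩
  have hs₂ := sum_le hE₂
  have hphi := sum_le (x := fun k => d k / (1 + d k * m) ^ 2)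
    (y := fun k => d k / (1 + d k * m₀) ^ 2) (c := 2 * A * A * (2 * A ^ 4 * r * ε)) fun k => by
      refine (abs_div_sq_sub_le (hd k) hm hm₀).trans ?_
      gcongr
  set Φ := l + ε * ∑ k, d k / (1 + d k * m₀) ^ 2 with hΦ
  have hΦl : l ≤ Φ := by
    have : 0 ≤ ε * ∑ k, d k / (1 + d k * m₀) ^ 2 :=
      mul_nonneg hε (Finset.sum_nonneg fun k _ => div_nonneg (hd k) (sq_nonneg _))
    linarith
  have hΦ0 : 0 < Φ := hl.trans_le hΦl
  have e : ε * ∑ k, d k * q / (1 + d k * m) ^ 2 = q * (ε * ∑ k, d k / (1 + d k * m) ^ 2) := by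
    rw [mul_left_comm, Finset.mul_sum Finset.univ _ q]
    congr 1
    exact Finset.sum_congr rfl fun k _ => by ring
  rw [e] at hs₂
  have hq2 : q * (ε * ∑ k, d k / (1 + d k * m) ^ 2 - ε * ∑ k, d k / (1 + d k * m₀) ^ 2) ≤
      A * (r * (2 * A * A * (2 * A ^ 4 * r * ε))) := by
    refine (mul_le_mul_of_nonneg_left ((le_abs_self _).trans hphi) hq0).trans ?_
    exact mul_le_mul_of_nonneg_right hq (by positivity)
  -- The equation for `q` is linear. The three errors come from replacing `m` by `m₀` on the left,
  -- from the defects of `E₂`, and from replacing `m` by `m₀` in the coefficient of `q`.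
  have hfin : m₀ - q * Φ ≤ (2 * A ^ 4 * r + 8 * A ^ 4 * r + 4 * A ^ 7 * r ^ 2) * ε := by
    have := (abs_le.1 hmm).1
    have := (abs_le.1 hs₂).2
    rw [hΦ]
    nlinarith
  have hAq : m₀ / Φ - q ≤ A * ((2 * A ^ 4 * r + 8 * A ^ 4 * r + 4 * A ^ 7 * r ^ 2) * ε) := by
    have e2 : m₀ / Φ - q = (m₀ - q * Φ) / Φ := by field_simp
    rw [e2]
    set y := (2 * A ^ 4 * r + 8 * A ^ 4 * r + 4 * A ^ 7 * r ^ 2) * ε with hy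
    have hy0 : 0 ≤ y := by rw [hy]; positivity
    calc (m₀ - q * Φ) / Φ ≤ y / Φ := by gcongr
      _ ≤ y / l := div_le_div_of_nonneg_left hy0 hl hΦl
      _ = 1 / l * y := by ring
      _ ≤ A * y := by gcongr
  linarith

end SelfConsistent

/-! ### The lower bound for a diagonal term. -/

section DiagonalBound

variable {N P : ℕ} {l r τ t : ℝ} {d : Fin N → ℝ}

/-- The constant in the lower bound for the expected squared norm of the parameters. -/
noncomputable def lowerConst (l r τ : ℝ) : ℝ :=
  errorConst l r τ ^ 2 * (errorConst l r τ * (2 * errorConst l r τ ^ 4 * r +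
    8 * errorConst l r τ ^ 4 * r + 4 * errorConst l r τ ^ 7 * r ^ 2)) +
  (5 * errorConst l r τ ^ 5 + 4 * errorConst l r τ ^ 4 * (2 * errorConst l r τ ^ 4 * r))

theorem errorConst_bounds (hl : 0 < l) (hr : 0 ≤ r) (hτ : 0 ≤ τ) :
    1 ≤ errorConst l r τ ∧ 1 / l ≤ errorConst l r τ ∧ 1 / l ^ 2 ≤ errorConst l r τ ∧
      l + τ ≤ errorConst l r τ := by
  have hK := one_le_momentBound
  have p1 : 0 ≤ 1 / l := by positivity
  have p2 : 0 ≤ 1 / l ^ 2 := by positivity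
  have p3 : 0 ≤ 3 * (2 * momentBound / l ^ 2 + (1 / l) ^ 2 + r * (1 / l) ^ 2) := by positivity
  have p4 : 0 ≤ 3 * (2 * momentBound / l ^ 4 + (2 / l ^ 2) ^ 2 + r * (2 / l ^ 2) ^ 2) := by
    positivity
  have p5 : 2 / l ^ 2 = 2 * (1 / l ^ 2) := by ring
  unfold errorConst
  refine ⟨?_, ?_, ?_, ?_⟩ <;> linarith

theorem lowerConst_pos (hl : 0 < l) (hr : 0 ≤ r) (hτ : 0 ≤ τ) : 0 < lowerConst l r τ := by
  have := (errorConst_bounds hl hr hτ).1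
  have : 0 < errorConst l r τ := by linarith
  unfold lowerConst
  positivity

/-- Since `t d/(t + d) ≤ d`. It bounds `1/m₀` when `m₀ = 1/t`. -/
theorem effective_ridge_le (hP : 0 < P) (hd : ∀ k, 0 ≤ d k)
    (hτ : (∑ k, d k) / P = τ) (ht : 0 < t) (hte : t = l + t / P * ∑ k, d k / (t + d k)) :
    t ≤ l + τ := by
  have hP' : (0 : ℝ) < P := by exact_mod_cast hP
  have h : t * ∑ k, d k / (t + d k) ≤ ∑ k, d k := by
    rw [Finset.mul_sum]
    refine Finset.sum_le_sum fun k _ => ?_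
    have hk := hd k
    rw [← mul_div_assoc, div_le_iff₀ (by linarith)]
    nlinarith
  have h2 : t / P * ∑ k, d k / (t + d k) ≤ τ := by
    rw [div_mul_eq_mul_div, ← hτ]
    gcongr
  linarith

theorem integrable_of_bounded {f : (Fin N → Fin P → ℝ) → ℝ} (hf : Continuous f) {C : ℝ}
    (h : ∀ Z, f Z ∈ Set.Icc 0 C) : Integrable f (gaussRows (Fin N) (Fin P)) :=
  Integrable.of_bound hf.aestronglyMeasurable C (Filter.Eventually.of_forall fun Z => by
    rw [Real.norm_eq_abs, abs_of_nonneg (h Z).1]; exact (h Z).2)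

/-- Combines the stability of `m` and `q` with the one-sided expansion. The integrand is `d k ^ 2 /
P` times the squared norm of `H zₖ`, written through the forms without row `k`. -/
theorem le_integral_diagonal (hl : 0 < l) (hP : 0 < P) (hd : ∀ k, 0 ≤ d k)
    (hr : (N : ℝ) / P = r) (hτ : (∑ k, d k) / P = τ) (ht : 0 < t)
    (hte : t = l + t / P * ∑ k, d k / (t + d k)) (k : Fin N) :
    Integrable (fun Z => d k ^ 2 * (looFormSq l (fun k => d k / P) k Z / P) /
        (1 + d k * (looForm l (fun k => d k / P) k Z / P)) ^ 2) (gaussRows (Fin N) (Fin P)) ∧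
    (1 - 1 / P * ∑ k, d k ^ 2 / (t + d k) ^ 2)⁻¹ * (d k ^ 2 / (t + d k) ^ 2) -
        lowerConst l r τ / P ≤
      ∫ Z, d k ^ 2 * (looFormSq l (fun k => d k / P) k Z / P) /
        (1 + d k * (looForm l (fun k => d k / P) k Z / P)) ^ 2 ∂(gaussRows (Fin N) (Fin P)) := by
  have hP' : (0 : ℝ) < P := by exact_mod_cast hP
  have hP1 : (1 : ℝ) ≤ P := by exact_mod_cast hP
  set u : Fin N → ℝ := fun k => d k / P with hu_def
  have hu : ∀ k, 0 ≤ u k := fun k => div_nonneg (hd k) hP'.le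
  have hτ0 : 0 ≤ τ := by
    rw [← hτ]; exact div_nonneg (Finset.sum_nonneg fun k _ => hd k) hP'.le
  have hr0 : 0 ≤ r := by rw [← hr]; positivity
  set π := gaussRows (Fin N) (Fin P) with hπ
  set A := errorConst l r τ with hA_def
  obtain ⟨hA, hlA, hl2A, hltA⟩ := errorConst_bounds hl hr0 hτ0
  rw [← hA_def] at hA hlA hl2A hltA
  set m := ∫ Z, normTrace l u Z ∂π with hm_def
  set q := ∫ Z, normTraceSq l u Z ∂π with hq_def
  have hloo : ∀ k, LooBounds π (fun Z => looForm l u k Z / P) (fun Z => looFormSq l u k Z / P) l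
      m q A (1 / P) := fun k => looBounds hl hu hP hr hτ0 k
  have him := integrable_of_bounded (continuous_normTrace (P := P) hl hu)
    (fun Z => normTrace_mem hl hu hP Z)
  have hiq := integrable_of_bounded (continuous_normTraceSq (P := P) hl hu)
    (fun Z => normTraceSq_mem hl hu hP Z)
  have hlt : 0 < l + τ := by linarith
  have hmlow : 1 / (l + τ) ≤ m := le_integral_normTrace hl hu hP (by
    rw [← hτ, Finset.sum_div])
  have hm : 0 < m := lt_of_lt_of_le (by positivity) hmlow
  have hmA : 1 / m ≤ A := by
    refine le_trans ?_ hltA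
    rw [div_le_iff₀ hm]
    rwa [div_le_iff₀ hlt, mul_comm] at hmlow
  have hq0 : 0 ≤ q := integral_nonneg fun Z => (normTraceSq_mem hl hu hP Z).1
  have hqA : q ≤ A := by
    refine le_trans ?_ hl2A
    have := integral_mono hiq (integrable_const (1 / l ^ 2))
      (fun Z => (normTraceSq_mem hl hu hP Z).2)
    simpa using this
  have hε : 0 ≤ 1 / (P : ℝ) := by positivity
  have hε1 : 1 / (P : ℝ) ≤ 1 := by rw [div_le_one hP']; exact hP1
  have hm₀ : 0 < 1 / t := by positivity
  have hm₀A : 1 / (1 / t) ≤ A := by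
    rw [one_div_one_div]
    exact (effective_ridge_le hP hd hτ ht hte).trans hltA
  have htd : ∀ k, 0 < t + d k := fun k => by linarith [hd k]
  have htd1 : ∀ k, 0 < 1 + d k * (1 / t) := fun k => by
    have : 0 ≤ d k * (1 / t) := mul_nonneg (hd k) hm₀.le
    linarith
  -- The effective ridge equation divided by `t`: the exact solution is `m₀ = 1/t`.
  have h₀ : 1 = l * (1 / t) + 1 / P * ∑ k, d k * (1 / t) / (1 + d k * (1 / t)) := by
    have e : ∀ k, d k * (1 / t) / (1 + d k * (1 / t)) = d k / (t + d k) := fun k => by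
      have := htd k
      have := htd1 k
      field_simp
    simp only [e]
    have hl' : l = t - t / P * ∑ k, d k / (t + d k) := by linarith
    rw [hl']
    generalize ∑ k, d k / (t + d k) = S
    field_simp
    ring
  have hE₁ := fun k => (hloo k).integral_ratio hA hε hm hmA (hd k)
  have hE₂ := fun k => (hloo k).integral_sq_ratio hA hε hl hlA hm hmA hq0 hqA (hd k)
  -- The factor `1/P` in the weights normalizes the leave-one-out forms.
  have eu : ∀ (k : Fin N) (x : ℝ), u k * x = d k * (x / P) := fun k x => by
    simp only [hu_def]; ring
  have h₁ : 1 = l * m + 1 / P * ∑ k, ∫ Z, d k * (looForm l u k Z / P) /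
      (1 + d k * (looForm l u k Z / P)) ∂π := by
    rw [← integral_finsetSum _ fun k _ => (hE₁ k).1, hm_def, ← integral_const_mul,
      ← integral_const_mul, ← integral_add (him.const_mul _)
        ((integrable_finsetSum _ fun k _ => (hE₁ k).1).const_mul _)]
    have e : ∀ Z : Fin N → Fin P → ℝ, l * normTrace l u Z + 1 / P *
        ∑ k, d k * (looForm l u k Z / P) / (1 + d k * (looForm l u k Z / P)) = 1 := fun Z => by
      have := card_eq_trace_resolvent hl hu Z
      simp only [eu, Fintype.card_fin] at this
      rw [normTrace]
      field_simp
      field_simp at this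
      linarith
    simp only [e]
    simp
  have h₂ : m = l * q + 1 / P * ∑ k, ∫ Z, d k * (looFormSq l u k Z / P) /
      (1 + d k * (looForm l u k Z / P)) ^ 2 ∂π := by
    rw [← integral_finsetSum _ fun k _ => (hE₂ k).1, hm_def, hq_def, ← integral_const_mul,
      ← integral_const_mul, ← integral_add (hiq.const_mul _)
        ((integrable_finsetSum _ fun k _ => (hE₂ k).1).const_mul _)]
    refine integral_congr_ae (Filter.Eventually.of_forall fun Z => ?_)
    have := trace_resolvent_eq hl hu Z
    simp only [eu] at this
    simp only [normTrace, normTraceSq]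
    rw [this, add_div, mul_div_assoc, one_div, inv_mul_eq_div]
  have hrN : (Fintype.card (Fin N) : ℝ) * (1 / P) = r := by
    rw [← hr, Fintype.card_fin]; ring
  obtain ⟨hmm, hqlow⟩ := self_consistent_stability hl hlA hA hε hrN hd hm hmA hm₀ hm₀A hq0 hqA h₀
    h₁ (fun k => (hE₁ k).2) h₂ (fun k => (hE₂ k).2)
  have hint : Integrable (fun Z => d k ^ 2 * (looFormSq l u k Z / P) /
      (1 + d k * (looForm l u k Z / P)) ^ 2) π := by
    refine ((hE₂ k).1.const_mul (d k)).congr (Filter.Eventually.of_forall fun Z => ?_)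
    simp only
    ring
  refine ⟨hint, ?_⟩
  have hx := (hloo k).le_integral_sq_ratio hA hε hε1 hq0 hqA (hd k) hm₀ hm₀A
    (B := 2 * A ^ 4 * r) (by positivity) hmm hint
  refine le_trans ?_ hx
  set Φ := l + 1 / P * ∑ k, d k / (1 + d k * (1 / t)) ^ 2 with hΦ
  have hΦ0 : 0 < Φ := by
    have : 0 ≤ 1 / (P : ℝ) * ∑ k, d k / (1 + d k * (1 / t)) ^ 2 :=
      mul_nonneg hε (Finset.sum_nonneg fun k _ => div_nonneg (hd k) (sq_nonneg _))
    linarith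
  -- This is where the derivative of the effective ridge enters: `t / Φ` equals it, and `Φ` is the
  -- coefficient of `q` in the limiting equation.
  have hΦt : Φ = t * (1 - 1 / P * ∑ k, d k ^ 2 / (t + d k) ^ 2) := by
    have e : ∀ k, d k / (1 + d k * (1 / t)) ^ 2 =
        t * (d k / (t + d k)) - t * (d k ^ 2 / (t + d k) ^ 2) := fun k => by
      have := htd k
      have := htd1 k
      field_simp
      ring
    rw [hΦ]
    simp only [e, Finset.sum_sub_distrib, ← Finset.mul_sum]
    have hl' : l = t - t / P * ∑ k, d k / (t + d k) := by linarith
    rw [hl']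
    ring
  have e1 : (1 - 1 / P * ∑ k, d k ^ 2 / (t + d k) ^ 2)⁻¹ = t / Φ := by
    have : 1 - 1 / P * ∑ k, d k ^ 2 / (t + d k) ^ 2 = Φ / t := by rw [hΦt]; field_simp
    rw [this, inv_div]
  have e2 : d k ^ 2 / (1 + d k * (1 / t)) ^ 2 = t ^ 2 * (d k ^ 2 / (t + d k) ^ 2) := by
    have := htd k
    have := htd1 k
    field_simp
  have hc : d k ^ 2 / (1 + d k * (1 / t)) ^ 2 ≤ A ^ 2 := by
    rw [← div_pow]
    refine pow_le_pow_left₀ (div_nonneg (hd k) (htd1 k).le) (le_trans ?_ hm₀A) 2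
    rw [div_le_div_iff₀ (htd1 k) hm₀]
    linarith
  have hc0 : 0 ≤ d k ^ 2 / (1 + d k * (1 / t)) ^ 2 := by positivity
  have e3 : t / Φ * (d k ^ 2 / (t + d k) ^ 2) =
      d k ^ 2 / (1 + d k * (1 / t)) ^ 2 * (1 / t / Φ) := by
    rw [e2]; field_simp
  have hmain := mul_le_mul_of_nonneg_left hqlow hc0
  set D := A * (2 * A ^ 4 * r + 8 * A ^ 4 * r + 4 * A ^ 7 * r ^ 2) with hD
  have hD0 : 0 ≤ D := by rw [hD]; positivity
  have h5 : d k ^ 2 / (1 + d k * (1 / t)) ^ 2 * (D * (1 / P)) ≤ A ^ 2 * (D * (1 / P)) :=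
    mul_le_mul_of_nonneg_right hc (by positivity)
  have hLC : lowerConst l r τ / P = A ^ 2 * (D * (1 / P)) +
      (5 * A ^ 5 + 4 * A ^ 4 * (2 * A ^ 4 * r)) * (1 / P) := by
    rw [lowerConst, ← hA_def, hD]; ring
  rw [e1, e3, hLC]
  rw [mul_sub] at hmain
  linarith

end DiagonalBound

/-! ### Differentiability of the effective ridge. -/

section EffectiveRidge

variable {N : ℕ} {d : Fin N → ℝ} {γ : ℝ}

/-- The derivative of the effective ridge. -/
theorem hasDerivAt_effectiveRidge (hd : ∀ i, 0 ≤ d i) (hγ : 0 < γ) {lam : ℝ} (hlam : 0 < lam) :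
    HasDerivAt (effectiveRidge d γ)
      (1 - 1 / γ * (1 / (N : ℝ) * ∑ i, d i ^ 2 / (effectiveRidge d γ lam + d i) ^ 2))⁻¹ lam := by
  set t := effectiveRidge d γ lam with ht_def
  set s : ℝ → ℝ := fun x => 1 / γ * (1 / (N : ℝ) * ∑ i, d i / (x + d i)) with hs
  have hN : (0 : ℝ) ≤ 1 / (N : ℝ) := by positivity
  have hspec : ∀ l, 0 < l → 0 < effectiveRidge d γ l ∧
      effectiveRidge d γ l * (1 - s (effectiveRidge d γ l)) = l := fun l hl => by
    have h := isEffectiveRidge_effectiveRidge hd hγ hl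
    refine ⟨h.1, ?_⟩
    have h2 := h.2
    have e : effectiveRidge d γ l / γ * (1 / (N : ℝ) * ∑ i, d i / (effectiveRidge d γ l + d i)) =
        effectiveRidge d γ l * s (effectiveRidge d γ l) := by
      simp only [hs]; ring
    rw [e] at h2
    linarith
  have hanti : ∀ x y, 0 < x → x ≤ y → s y ≤ s x := fun x y hx hxy => by
    have : ∑ i, d i / (y + d i) ≤ ∑ i, d i / (x + d i) :=
      Finset.sum_le_sum fun i _ =>
        div_le_div_of_nonneg_left (hd i) (by linarith [hd i]) (by linarith)
    simp only [hs]
    gcongr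
  have hst : ∀ l, 0 < l → 0 < 1 - s (effectiveRidge d γ l) := fun l hl => by
    obtain ⟨h1, h2⟩ := hspec l hl
    by_contra hc
    nlinarith
  obtain ⟨ht, hte⟩ := hspec lam hlam
  have hone := hst lam hlam
  rw [← ht_def] at ht hte hone
  -- The ridge `l` equals `t (1 - s t)` with `s` antitone, so an increment of `l` is at least `1 - s
  -- t₁` times that of `t`; this is a local Lipschitz estimate for the inverse.
  have hmono : ∀ l₁ l₂, 0 < l₁ → l₁ ≤ l₂ → effectiveRidge d γ l₁ ≤ effectiveRidge d γ l₂ ∧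
      (effectiveRidge d γ l₂ - effectiveRidge d γ l₁) * (1 - s (effectiveRidge d γ l₁)) ≤
        l₂ - l₁ := fun l₁ l₂ hl₁ hle => by
    obtain ⟨h1, h2⟩ := hspec l₁ hl₁
    obtain ⟨h3, h4⟩ := hspec l₂ (hl₁.trans_le hle)
    have h5 := hst l₁ hl₁
    have h6 := hst l₂ (hl₁.trans_le hle)
    have hle' : effectiveRidge d γ l₁ ≤ effectiveRidge d γ l₂ := by
      by_contra hc
      push Not at hc
      have := hanti _ _ h3 hc.le
      nlinarith
    refine ⟨hle', ?_⟩
    have := hanti _ _ h1 hle'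
    nlinarith
  have hcont : ContinuousAt (effectiveRidge d γ) lam := by
    rw [Metric.continuousAt_iff']
    intro e he
    -- A lower bound for `1 - s` along ridges `x` in `[lam/2, lam]`: there `1 - s` equals `x` over
    -- the effective ridge of `x`, which is at most `t`.
    set c := (lam / 2) / t with hc
    have hc0 : 0 < c := by positivity
    have hev : ∀ᶠ x in nhds lam, x ∈ Set.Ioo (lam / 2) (2 * lam) :=
      Ioo_mem_nhds (by linarith) (by linarith)
    have hev2 : ∀ᶠ x in nhds lam, dist x lam < min (c * e) (lam) :=
      Metric.ball_mem_nhds _ (lt_min (by positivity) hlam)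
    filter_upwards [hev, hev2] with x hx hx2
    have hx0 : 0 < x := by linarith [hx.1]
    rw [Real.dist_eq] at hx2 ⊢
    have hx3 : |x - lam| < c * e := hx2.trans_le (min_le_left _ _)
    rcases le_total x lam with hle | hle
    · obtain ⟨h1, h2⟩ := hmono x lam hx0 hle
      obtain ⟨h3, h4⟩ := hspec x hx0
      have h5 : c ≤ 1 - s (effectiveRidge d γ x) := by
        rw [hc, div_le_iff₀ ht]
        have := hst x hx0
        rw [← ht_def] at h1
        nlinarith [hx.1]
      rw [abs_of_nonpos (by linarith)] at hx3 ⊢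
      rw [← ht_def] at *
      have : c * (t - effectiveRidge d γ x) < c * e := by nlinarith
      have := lt_of_mul_lt_mul_left this hc0.le
      linarith
    · obtain ⟨h1, h2⟩ := hmono lam x hlam hle
      have h5 : c ≤ 1 - s t := by
        rw [hc, div_le_iff₀ ht]
        linarith
      rw [abs_of_nonneg (by linarith)] at hx3 ⊢
      rw [← ht_def] at *
      have : c * (effectiveRidge d γ x - t) < c * e := by nlinarith
      exact lt_of_mul_lt_mul_left this hc0.le
  -- Makes the derivative of `x (1 - s x)` at `t` at least `1 - s t > 0`, so the inverse function
  -- rule applies.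
  have hcong : 1 / γ * (1 / (N : ℝ) * ∑ i, d i ^ 2 / (t + d i) ^ 2) ≤ s t := by
    have : ∑ i, d i ^ 2 / (t + d i) ^ 2 ≤ ∑ i, d i / (t + d i) := by
      refine Finset.sum_le_sum fun i _ => ?_
      have hi := hd i
      have htd : 0 < t + d i := by linarith
      rw [← div_pow, sq]
      exact mul_le_of_le_one_left (by positivity) ((div_le_one htd).2 (by linarith))
    simp only [hs]
    gcongr
  have hF : HasDerivAt (fun x => x * (1 - s x))
      (1 - 1 / γ * (1 / (N : ℝ) * ∑ i, d i ^ 2 / (t + d i) ^ 2)) t := by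
    have hsd : HasDerivAt s (1 / γ * (1 / (N : ℝ) * ∑ i, -(d i) / (t + d i) ^ 2)) t := by
      refine HasDerivAt.const_mul _ (HasDerivAt.const_mul _ (HasDerivAt.fun_sum fun i _ => ?_))
      have hne : t + d i ≠ 0 := by linarith [hd i]
      have := (hasDerivAt_const t (d i)).fun_div ((hasDerivAt_id t).add_const (d i)) hne
      simpa using this
    have := (hasDerivAt_id t).mul (hsd.const_sub 1)
    convert! this using 1
    simp only [hs, id, one_mul]
    have e : ∀ i, d i ^ 2 / (t + d i) ^ 2 = d i / (t + d i) + t * (-(d i) / (t + d i) ^ 2) :=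
      fun i => by
        have hne : t + d i ≠ 0 := by linarith [hd i]
        field_simp
        ring
    simp only [e, Finset.sum_add_distrib, ← Finset.mul_sum]
    ring
  refine HasDerivAt.of_local_left_inverse hcont hF (by linarith) ?_
  filter_upwards [Ioi_mem_nhds hlam] with x hx
  exact (hspec x hx).2

end EffectiveRidge

/-! ### Sign symmetry and the vanishing of cross terms. -/

section SignFlip

variable {ι κ : Type*} [Fintype ι] [DecidableEq ι] [Fintype κ] [DecidableEq κ]

/-- Changing the sign of one row. -/
def flipRow (k : ι) (Z : ι → κ → ℝ) : ι → κ → ℝ := fun i => if i = k then -Z i else Z i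

theorem measurePreserving_neg_stdGauss :
    MeasurePreserving (fun z : κ → ℝ => -z) (stdGauss κ) (stdGauss κ) := by
  have h : MeasurePreserving (fun x : ℝ => -x) (gaussianReal 0 1) (gaussianReal 0 1) :=
    ⟨measurable_neg, by rw [gaussianReal_map_neg, neg_zero]⟩
  exact measurePreserving_pi (fun _ : κ => gaussianReal 0 1) (fun _ : κ => gaussianReal 0 1)
    (f := fun _ x => -x) fun _ => h

theorem measurePreserving_flipRow (k : ι) :
    MeasurePreserving (flipRow (κ := κ) k) (gaussRows ι κ) (gaussRows ι κ) := by
  refine measurePreserving_pi (fun _ : ι => stdGauss κ) (fun _ : ι => stdGauss κ)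
    (f := fun i z => if i = k then -z else z) fun i => ?_
  by_cases hi : i = k
  · simpa [hi] using measurePreserving_neg_stdGauss
  · simp only [hi, if_false]
    exact MeasurePreserving.id (stdGauss κ)

theorem weightedGram_flipRow (u : ι → ℝ) (k : ι) (Z : ι → κ → ℝ) :
    weightedGram u (flipRow k Z) = weightedGram u Z := by
  unfold weightedGram flipRow
  refine Finset.sum_congr rfl fun i _ => ?_
  split_ifs
  · rw [Matrix.neg_vecMulVec, Matrix.vecMulVec_neg, neg_neg]
  · rfl

theorem resolvent_flipRow (l : ℝ) (u : ι → ℝ) (k : ι) (Z : ι → κ → ℝ) :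
    resolvent l u (flipRow k Z) = resolvent l u Z := by
  rw [resolvent, weightedGram_flipRow, resolvent]

/-- The inner product of `H zᵢ` and `H zₖ`. -/
noncomputable def crossForm (l : ℝ) (u : ι → ℝ) (i k : ι) (Z : ι → κ → ℝ) : ℝ :=
  (resolvent l u Z *ᵥ Z i) ⬝ᵥ (resolvent l u Z *ᵥ Z k)

variable {l : ℝ} {u : ι → ℝ}

theorem continuous_crossForm (hl : 0 < l) (hu : ∀ k, 0 ≤ u k) (i k : ι) :
    Continuous (crossForm (κ := κ) l u i k) :=
  ((continuous_resolvent hl hu).matrix_mulVec (continuous_apply i)).dotProduct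
    ((continuous_resolvent hl hu).matrix_mulVec (continuous_apply k))

theorem abs_crossForm_le (hl : 0 < l) (hu : ∀ k, 0 ≤ u k) (i k : ι) (Z : ι → κ → ℝ) :
    |crossForm l u i k Z| ≤ 1 / l ^ 2 * (Z i ⬝ᵥ Z i) + 1 / l ^ 2 * (Z k ⬝ᵥ Z k) := by
  have h1 := resolvent_mulVec_sq_le hl hu Z (Z i)
  have h2 := resolvent_mulVec_sq_le hl hu Z (Z k)
  unfold crossForm
  set x := resolvent l u Z *ᵥ Z i
  set y := resolvent l u Z *ᵥ Z k
  have h3 : 0 ≤ (x - y) ⬝ᵥ (x - y) := dotProduct_self_nonneg' _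
  have h4 : 0 ≤ (x + y) ⬝ᵥ (x + y) := dotProduct_self_nonneg' _
  have h5 : 0 ≤ x ⬝ᵥ x := dotProduct_self_nonneg' _
  have h6 : 0 ≤ y ⬝ᵥ y := dotProduct_self_nonneg' _
  simp only [sub_dotProduct, dotProduct_sub, add_dotProduct, dotProduct_add,
    dotProduct_comm y x] at h3 h4
  rw [one_div, inv_mul_eq_div, inv_mul_eq_div, abs_le]
  constructor <;> linarith

theorem integrable_crossForm (hl : 0 < l) (hu : ∀ k, 0 ≤ u k) (i k : ι) :
    Integrable (crossForm (κ := κ) l u i k) (gaussRows ι κ) := by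
  have h : ∀ k : ι, Integrable (fun Z : ι → κ → ℝ => 1 / l ^ 2 * (Z k ⬝ᵥ Z k)) (gaussRows ι κ) :=
    fun k => ((memLp_row_dotProduct_self k).integrable (by norm_num)).const_mul _
  exact ((h i).add (h k)).mono' (continuous_crossForm hl hu i k).aestronglyMeasurable
    (Filter.Eventually.of_forall fun Z => abs_crossForm_le hl hu i k Z)

/-- Changing the sign of `zₖ` preserves the Gaussian law and `H`, which is even in each row, and
negates the integrand. -/
theorem integral_crossForm_eq_zero (hl : 0 < l) (hu : ∀ k, 0 ≤ u k) {i k : ι} (hik : i ≠ k) :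
    ∫ Z, crossForm l u i k Z ∂(gaussRows ι κ) = 0 := by
  have hmp := measurePreserving_flipRow (κ := κ) k
  have h : ∫ Z, crossForm l u i k Z ∂(gaussRows ι κ) =
      ∫ Z, crossForm l u i k (flipRow k Z) ∂(gaussRows ι κ) := by
    conv_lhs => rw [← hmp.map_eq]
    rw [integral_map hmp.measurable.aemeasurable
      (continuous_crossForm hl hu i k).aestronglyMeasurable]
  have e : ∀ Z : ι → κ → ℝ, crossForm l u i k (flipRow k Z) = -crossForm l u i k Z := fun Z => by
    have h1 : flipRow k Z i = Z i := by simp [flipRow, hik]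
    have h2 : flipRow k Z k = -Z k := by simp [flipRow]
    rw [crossForm, resolvent_flipRow, h1, h2, Matrix.mulVec_neg, dotProduct_neg, crossForm]
  simp only [e, integral_neg] at h
  linarith

theorem crossForm_self (hl : 0 < l) (hu : ∀ k, 0 ≤ u k) (k : ι) (Z : ι → κ → ℝ) :
    crossForm l u k k Z = looFormSq l u k Z / (1 + u k * looForm l u k Z) ^ 2 := by
  rw [crossForm, resolvent_mulVec_row hl hu, dotProduct_smul, smul_dotProduct, smul_eq_mul,
    smul_eq_mul]
  change _ * (_ * looFormSq l u k Z) = _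
  rw [div_eq_mul_inv, ← inv_pow]
  ring

/-- The vector `H ∑ₖ cₖ zₖ`. -/
noncomputable def paramVec (l : ℝ) (u c : ι → ℝ) (Z : ι → κ → ℝ) : κ → ℝ :=
  resolvent l u Z *ᵥ ∑ k, c k • Z k

theorem continuous_paramVec (hl : 0 < l) (hu : ∀ k, 0 ≤ u k) (c : ι → ℝ) :
    Continuous (paramVec (κ := κ) l u c) :=
  (continuous_resolvent hl hu).matrix_mulVec
    (continuous_finsetSum _ fun k _ => Continuous.const_smul (continuous_apply k) (c k))

theorem paramVec_dotProduct_self (c : ι → ℝ) (Z : ι → κ → ℝ) :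
    paramVec l u c Z ⬝ᵥ paramVec l u c Z =
      ∑ i, ∑ k, c i * c k * crossForm l u i k Z := by
  have e : paramVec l u c Z = ∑ k, c k • (resolvent l u Z *ᵥ Z k) := by
    simp only [paramVec, Matrix.mulVec_sum, Matrix.mulVec_smul]
  rw [e, sum_dotProduct]
  refine Finset.sum_congr rfl fun i _ => ?_
  rw [dotProduct_sum]
  refine Finset.sum_congr rfl fun k _ => ?_
  rw [smul_dotProduct, dotProduct_smul, smul_eq_mul, smul_eq_mul, crossForm, mul_assoc]

theorem integral_paramVec_dotProduct_self (hl : 0 < l) (hu : ∀ k, 0 ≤ u k) (c : ι → ℝ) :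
    ∫ Z, paramVec l u c Z ⬝ᵥ paramVec l u c Z ∂(gaussRows ι κ) =
      ∑ k, c k ^ 2 * ∫ Z, crossForm l u k k Z ∂(gaussRows ι κ) := by
  have hi : ∀ i k : ι, Integrable (fun Z : ι → κ → ℝ => c i * c k * crossForm l u i k Z)
      (gaussRows ι κ) := fun i k => (integrable_crossForm hl hu i k).const_mul _
  simp only [paramVec_dotProduct_self]
  rw [integral_finsetSum _ fun i _ => integrable_finsetSum _ fun k _ => hi i k]
  refine Finset.sum_congr rfl fun i _ => ?_
  rw [integral_finsetSum _ fun k _ => hi i k, Finset.sum_eq_single i]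
  · rw [integral_const_mul, sq]
  · intro k _ hk
    rw [integral_const_mul, integral_crossForm_eq_zero hl hu (Ne.symm hk), mul_zero]
  · simp

end SignFlip

/-- Sums the diagonal bounds over `k`. With coefficients `P^{-1/2} dₖ vₖ`, the weight `dₖ²/P` is
exactly the one of the diagonal bound, and its error is summed against `vₖ²`. -/
theorem le_integral_paramVec {N P : ℕ} {l r τ t : ℝ} {d : Fin N → ℝ} (hl : 0 < l) (hP : 0 < P)
    (hd : ∀ k, 0 ≤ d k) (hr : (N : ℝ) / P = r) (hτ : (∑ k, d k) / P = τ) (ht : 0 < t)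
    (hte : t = l + t / P * ∑ k, d k / (t + d k)) (v : Fin N → ℝ) :
    (1 - 1 / P * ∑ k, d k ^ 2 / (t + d k) ^ 2)⁻¹ * ∑ k, v k ^ 2 * (d k ^ 2 / (t + d k) ^ 2) -
        lowerConst l r τ / P * ∑ k, v k ^ 2 ≤
      ∫ Z, paramVec l (fun k => d k / P) (fun k => 1 / √(P : ℝ) * (d k * v k)) Z ⬝ᵥ
        paramVec l (fun k => d k / P) (fun k => 1 / √(P : ℝ) * (d k * v k)) Z
          ∂(gaussRows (Fin N) (Fin P)) := by
  have hP' : (0 : ℝ) < P := by exact_mod_cast hP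
  have hu : ∀ k, 0 ≤ d k / (P : ℝ) := fun k => div_nonneg (hd k) hP'.le
  rw [integral_paramVec_dotProduct_self hl hu,
    Finset.mul_sum Finset.univ (fun k => v k ^ 2 * _), Finset.mul_sum Finset.univ (fun k => v k ^ 2),
    ← Finset.sum_sub_distrib]
  refine Finset.sum_le_sum fun k _ => ?_
  have h := (le_integral_diagonal hl hP hd hr hτ ht hte k).2
  have e : (1 / √(P : ℝ) * (d k * v k)) ^ 2 *
      ∫ Z, crossForm l (fun k => d k / (P : ℝ)) k k Z ∂(gaussRows (Fin N) (Fin P)) =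
      v k ^ 2 * ∫ Z, d k ^ 2 * (looFormSq l (fun k => d k / P) k Z / P) /
        (1 + d k * (looForm l (fun k => d k / P) k Z / P)) ^ 2 ∂(gaussRows (Fin N) (Fin P)) := by
    rw [← integral_const_mul, ← integral_const_mul]
    refine integral_congr_ae (Filter.Eventually.of_forall fun Z => ?_)
    simp only [crossForm_self hl hu]
    rw [mul_pow, div_pow, Real.sq_sqrt hP'.le, div_mul_eq_mul_div (d k) (P : ℝ), mul_div_assoc (d k)]
    ring
  rw [e]
  have := mul_le_mul_of_nonneg_left h (sq_nonneg (v k))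
  linarith

/-! ### From independent columns to independent rows. -/

section Transpose

variable {Ω : Type*} [MeasurableSpace Ω] {μ : Measure Ω}
  {O : Type*} [Fintype O] [DecidableEq O] {P : ℕ}

/-- If the columns of a random matrix are independent centred Gaussian vectors with uncorrelated
entries, then its rows are independent. -/
theorem iIndepFun_rows {W : Fin P → O → Ω → ℝ}
    (hG : ∀ j, HasGaussianLaw (fun ω o => W j o ω) μ)
    (hI : iIndepFun (fun j ω o => W j o ω) μ)
    (hmean : ∀ j o, ∫ ω, W j o ω ∂μ = 0)
    (hcov : ∀ j o o', o ≠ o' → ∫ ω, W j o ω * W j o' ω ∂μ = 0) :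
    iIndepFun (fun o ω j => W j o ω) μ := by
  have := hI.isProbabilityMeasure
  have hLp : ∀ j o, MemLp (W j o) 2 μ := fun j o => ((hG j).eval o).memLp_two
  have hj : HasGaussianLaw (fun ω j o => W j o ω) μ := iIndepFun.hasGaussianLaw hG hI
  let L : (Fin P → O → ℝ) →L[ℝ] (O → Fin P → ℝ) :=
    ContinuousLinearMap.pi fun o => ContinuousLinearMap.pi fun j =>
      (ContinuousLinearMap.proj (R := ℝ) (φ := fun _ : O => ℝ) o).comp
        (ContinuousLinearMap.proj (R := ℝ) (φ := fun _ : Fin P => O → ℝ) j)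
  have hT : HasGaussianLaw (fun ω o j => W j o ω) μ := hj.map_fun L
  refine HasGaussianLaw.iIndepFun_of_covariance_eval (X := fun o j => W j o) hT
    fun o o' hoo j j' => ?_
  by_cases hjj : j = j'
  · subst hjj
    rw [covariance_eq_sub (hLp j o) (hLp j o'), hmean, zero_mul, sub_zero]
    exact hcov j o o' hoo
  · have h1 : IndepFun (W j o) (W j' o') μ :=
      (hI.indepFun hjj).comp (φ := fun w : O → ℝ => w o) (ψ := fun w : O → ℝ => w o')
        (measurable_pi_apply o) (measurable_pi_apply o')
    exact h1.covariance_eq_zero (hLp j o) (hLp j' o')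

/-- The law of a row with unit variances. -/
theorem map_row_eq_stdGauss {W : Fin P → O → Ω → ℝ}
    (hG : ∀ j, HasGaussianLaw (fun ω o => W j o ω) μ)
    (hI : iIndepFun (fun j ω o => W j o ω) μ)
    (hmean : ∀ j o, ∫ ω, W j o ω ∂μ = 0) (o : O) (hvar : ∀ j, ∫ ω, W j o ω ^ 2 ∂μ = 1) :
    μ.map (fun ω j => W j o ω) = stdGauss (Fin P) := by
  have := hI.isProbabilityMeasure
  have hLp : ∀ j, MemLp (W j o) 2 μ := fun j => ((hG j).eval o).memLp_two
  have h := (hI.comp (fun _ w => w o) fun _ => measurable_pi_apply o)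
  have h2 := iIndepFun.map_fun_eq_pi_map
    (fun j => ((hG j).eval o).aemeasurable) h
  change μ.map (fun ω j => W j o ω) = _ at h2
  rw [h2, stdGauss]
  congr 1
  ext1 j
  rw [((hG j).eval o).map_eq_gaussianReal, hmean j o,
    variance_of_integral_eq_zero ((hG j).eval o).aemeasurable (hmean j o), hvar j]
  simp

end Transpose

/-! ### Linear combinations of feature values. -/

namespace IsGaussianFeatures

variable {S Ω : Type*} [MeasurableSpace Ω] {P : ℕ} {K : S → S → ℝ} {f : Fin P → S → Ω → ℝ}
  {μ : Measure Ω}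

theorem memLp_two (hf : IsGaussianFeatures K f μ) (j : Fin P) (x : S) : MemLp (f j x) 2 μ :=
  ((hf.isGaussianProcess j).hasGaussianLaw_eval x).memLp_two

variable {Q : Type*} [Fintype Q] {O : Type*} [Fintype O]

theorem integral_comb (hf : IsGaussianFeatures K f μ) (p : Q → S) (α : Q → ℝ) (j : Fin P) :
    ∫ ω, ∑ q, α q * f j (p q) ω ∂μ = 0 := by
  have := hf.indep.isProbabilityMeasure
  rw [integral_finsetSum _ fun q _ => ((hf.memLp_two j (p q)).integrable (by norm_num)).const_mul _]
  simp only [integral_const_mul, hf.mean, mul_zero, Finset.sum_const_zero]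

theorem memLp_comb (hf : IsGaussianFeatures K f μ) (p : Q → S) (α : Q → ℝ) (j : Fin P) :
    MemLp (fun ω => ∑ q, α q * f j (p q) ω) 2 μ :=
  memLp_finsetSum _ fun q _ => (hf.memLp_two j (p q)).const_mul _

theorem integral_comb_mul (hf : IsGaussianFeatures K f μ) (p : Q → S) (α β : Q → ℝ) (j : Fin P) :
    ∫ ω, (∑ q, α q * f j (p q) ω) * (∑ q, β q * f j (p q) ω) ∂μ =
      ∑ q, ∑ q', α q * β q' * K (p q) (p q') := by
  have e : ∀ ω, (∑ q, α q * f j (p q) ω) * (∑ q, β q * f j (p q) ω) =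
      ∑ q, ∑ q', α q * β q' * (f j (p q) ω * f j (p q') ω) := fun ω => by
    rw [Finset.sum_mul_sum]
    exact Finset.sum_congr rfl fun q _ => Finset.sum_congr rfl fun q' _ => by ring
  have i : ∀ q q', Integrable (fun ω => α q * β q' * (f j (p q) ω * f j (p q') ω)) μ :=
    fun q q' => ((hf.memLp_two j (p q)).integrable_mul (hf.memLp_two j (p q'))).const_mul _
  simp only [e]
  rw [integral_finsetSum _ fun q _ => integrable_finsetSum _ fun q' _ => i q q']
  refine Finset.sum_congr rfl fun q _ => ?_
  rw [integral_finsetSum _ fun q' _ => i q q']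
  simp only [integral_const_mul, hf.covariance]

theorem hasGaussianLaw_comb (hf : IsGaussianFeatures K f μ) (p : Q → S) (A : O → Q → ℝ)
    (j : Fin P) : HasGaussianLaw (fun ω o => ∑ q, A o q * f j (p q) ω) μ := by
  have h := ((hf.isGaussianProcess j).comp_right p).hasGaussianLaw Finset.univ
  let L : (↥(Finset.univ : Finset Q) → ℝ) →L[ℝ] (O → ℝ) :=
    ContinuousLinearMap.pi fun o => ∑ q : Q, A o q •
      ContinuousLinearMap.proj (R := ℝ) (φ := fun _ : ↥(Finset.univ : Finset Q) => ℝ)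
        ⟨q, Finset.mem_univ q⟩
  have h2 := h.map_fun L
  convert! h2 using 3 with ω o
  simp [L]

theorem iIndepFun_comb (hf : IsGaussianFeatures K f μ) (p : Q → S) (A : O → Q → ℝ) :
    iIndepFun (fun j ω o => ∑ q, A o q * f j (p q) ω) μ :=
  hf.indep.comp (fun _ φ o => ∑ q, A o q * φ (p q)) fun _ => by fun_prop

end IsGaussianFeatures

/-! ### Variance contributed by independent noise. -/

section ConditionalVariance

variable {Ω E : Type*} [MeasurableSpace Ω] [MeasurableSpace E] {μ : Measure Ω}
  [IsProbabilityMeasure μ] {P : ℕ}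

/-- A lower bound for the variance of `c ∑ⱼ θⱼ (hⱼ + gⱼ)`, where `θ` and `h` are functions of a
random variable `ζ` and the `gⱼ` are centred, uncorrelated and independent of `ζ`. -/
theorem le_variance_of_indep_noise {ζ : Ω → E} {g : Fin P → Ω → ℝ} {θ h : Fin P → E → ℝ}
    {C c s : ℝ} (hζ : Measurable ζ) (hgm : ∀ j, Measurable (g j))
    (hind : IndepFun ζ (fun ω j => g j ω) μ) (hθ : ∀ j, Measurable (θ j))
    (hh : ∀ j, Measurable (h j)) (hC : ∀ j ω, |θ j (ζ ω)| ≤ C)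
    (hhL : ∀ j, MemLp (fun ω => h j (ζ ω)) 2 μ) (hgL : ∀ j, MemLp (g j) 2 μ)
    (hg0 : ∀ j, ∫ ω, g j ω ∂μ = 0)
    (hgg : ∀ i j, ∫ ω, g i ω * g j ω ∂μ = if i = j then s else 0) :
    MemLp (fun ω => c * ∑ j, θ j (ζ ω) * (h j (ζ ω) + g j ω)) 2 μ ∧
    c ^ 2 * s * ∫ ω, ∑ j, θ j (ζ ω) ^ 2 ∂μ ≤
      variance (fun ω => c * ∑ j, θ j (ζ ω) * (h j (ζ ω) + g j ω)) μ := by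
  -- The variable is `A(ζ) + B`, where `B` carries the noise. Independence gives `E B = 0` and `E
  -- A(ζ)B = 0`, hence the variance is `Var A(ζ) + E B²`.
  set A : E → ℝ := fun e => c * ∑ j, θ j e * h j e with hA
  set B : Ω → ℝ := fun ω => c * ∑ j, θ j (ζ ω) * g j ω with hB
  have hAm : Measurable A :=
    (Finset.measurable_sum _ fun j _ => (hθ j).mul (hh j)).const_mul c
  have hmulL : ∀ (j : Fin P) {X : Ω → ℝ}, MemLp X 2 μ →
      MemLp (fun ω => θ j (ζ ω) * X ω) 2 μ := fun j X hX => by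
    refine hX.of_le_mul (c := C)
      (((hθ j).comp hζ).aestronglyMeasurable.mul hX.aestronglyMeasurable)
      (Filter.Eventually.of_forall fun ω => ?_)
    rw [norm_mul]
    exact mul_le_mul_of_nonneg_right (hC j ω) (norm_nonneg _)
  have hAL : MemLp (fun ω => A (ζ ω)) 2 μ :=
    (memLp_finsetSum _ fun j _ => hmulL j (hhL j)).const_mul c
  have hBL : MemLp B 2 μ := (memLp_finsetSum _ fun j _ => hmulL j (hgL j)).const_mul c
  have hfun : (fun ω => c * ∑ j, θ j (ζ ω) * (h j (ζ ω) + g j ω)) =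
      fun ω => A (ζ ω) + B ω := by
    funext ω
    simp only [hA, hB, mul_add, Finset.sum_add_distrib]
  have hprod : ∀ {φ : E → ℝ} {ψ : (Fin P → ℝ) → ℝ}, Measurable φ → Measurable ψ →
      ∫ ω, φ (ζ ω) * ψ (fun j => g j ω) ∂μ =
        (∫ ω, φ (ζ ω) ∂μ) * ∫ ω, ψ (fun j => g j ω) ∂μ := fun {φ ψ} hφ hψ =>
    (hind.comp hφ hψ).integral_fun_mul_eq_mul_integral (hφ.comp hζ).aestronglyMeasurable
      (hψ.comp (measurable_pi_lambda _ hgm)).aestronglyMeasurable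
  have hzero : ∀ (j : Fin P) {φ : E → ℝ}, Measurable φ → ∫ ω, φ (ζ ω) * g j ω ∂μ = 0 :=
    fun j φ hφ => by
      have := hprod (ψ := fun z => z j) hφ (measurable_pi_apply j)
      simp only at this
      rw [this, hg0, mul_zero]
  have hB0 : ∫ ω, B ω ∂μ = 0 := by
    rw [hB, integral_const_mul, integral_finsetSum _ fun j _ =>
      (hmulL j (hgL j)).integrable (by norm_num)]
    simp only [hzero _ (hθ _), Finset.sum_const_zero, mul_zero]
  have hAB : ∫ ω, A (ζ ω) * B ω ∂μ = 0 := by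
    have e : ∀ ω, A (ζ ω) * B ω = c * ∑ j, A (ζ ω) * (θ j (ζ ω) * g j ω) := fun ω => by
      simp only [hB, ← Finset.mul_sum]; ring
    have hi : ∀ j, Integrable (fun ω => A (ζ ω) * (θ j (ζ ω) * g j ω)) μ := fun j =>
      hAL.integrable_mul (hmulL j (hgL j))
    have hz : ∀ j, ∫ ω, A (ζ ω) * (θ j (ζ ω) * g j ω) ∂μ = 0 := fun j => by
      simp only [← mul_assoc]
      exact hzero j (φ := fun e => A e * θ j e) (hAm.mul (hθ j))
    simp only [e]
    rw [integral_const_mul, integral_finsetSum _ fun j _ => hi j]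
    simp only [hz, Finset.sum_const_zero, mul_zero]
  have hBB : ∫ ω, B ω ^ 2 ∂μ = c ^ 2 * s * ∫ ω, ∑ j, θ j (ζ ω) ^ 2 ∂μ := by
    have e : ∀ ω, B ω ^ 2 =
        c ^ 2 * ∑ i, ∑ j, (θ i (ζ ω) * θ j (ζ ω)) * (g i ω * g j ω) := fun ω => by
      rw [hB, mul_pow, sq (∑ j, _), Finset.sum_mul_sum]
      congr 1
      exact Finset.sum_congr rfl fun i _ => Finset.sum_congr rfl fun j _ => by ring
    have hi : ∀ i j, Integrable (fun ω => (θ i (ζ ω) * θ j (ζ ω)) * (g i ω * g j ω)) μ :=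
      fun i j => ((hmulL i (hgL i)).integrable_mul (hmulL j (hgL j))).congr
        (Filter.Eventually.of_forall fun ω => by simp only [Pi.mul_apply]; ring)
    have hij : ∀ i j, ∫ ω, (θ i (ζ ω) * θ j (ζ ω)) * (g i ω * g j ω) ∂μ =
        if i = j then (∫ ω, θ j (ζ ω) ^ 2 ∂μ) * s else 0 := fun i j => by
      have := hprod (φ := fun e => θ i e * θ j e) (ψ := fun z => z i * z j)
        ((hθ i).mul (hθ j)) (by fun_prop)
      simp only at this
      rw [this, hgg]
      split_ifs with hij
      · subst hij; simp only [sq]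
      · rw [mul_zero]
    have hθi : ∀ j, Integrable (fun ω => θ j (ζ ω) ^ 2) μ := fun j => by
      have : MemLp (fun ω => θ j (ζ ω)) 2 μ :=
        MemLp.of_bound ((hθ j).comp hζ).aestronglyMeasurable C (Filter.Eventually.of_forall (hC j))
      exact this.integrable_sq
    simp only [e]
    rw [integral_const_mul, integral_finsetSum _ fun i _ => integrable_finsetSum _ fun j _ => hi i j,
      integral_finsetSum _ fun j _ => hθi j]
    simp only [fun i => integral_finsetSum Finset.univ fun j _ => hi i j, hij, Finset.sum_ite_eq,
      Finset.mem_univ, if_true, ← Finset.sum_mul]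
    ring
  rw [hfun]
  refine ⟨hAL.add hBL, ?_⟩
  have hvar := variance_fun_add hAL hBL
  rw [hvar, covariance_eq_sub hAL hBL, hB0, mul_zero, sub_zero,
    variance_of_integral_eq_zero hBL.aemeasurable hB0, hBB]
  have h0 : ∫ ω, ((fun ω => A (ζ ω)) * B) ω ∂μ = 0 := hAB
  have h1 := variance_nonneg (fun ω => A (ζ ω)) μ
  rw [h0]
  linarith

end ConditionalVariance

/-! ### Kernel quantities in the eigenbasis. -/

section Spectral

variable {N : ℕ} {G U : Matrix (Fin N) (Fin N) ℝ} {d : Fin N → ℝ}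

theorem conj_diagonal_mul (hU : Uᵀ * U = 1) (a b : Fin N → ℝ) :
    (U * diagonal a * Uᵀ) * (U * diagonal b * Uᵀ) = U * diagonal (fun i => a i * b i) * Uᵀ := by
  rw [← Matrix.diagonal_mul_diagonal]
  calc _ = U * diagonal a * (Uᵀ * U) * diagonal b * Uᵀ := by simp only [Matrix.mul_assoc]
    _ = _ := by rw [hU, Matrix.mul_one]; simp only [Matrix.mul_assoc]

theorem conj_diagonal_inv (hU : Uᵀ * U = 1) (hU' : U * Uᵀ = 1) {a : Fin N → ℝ}
    (ha : ∀ i, a i ≠ 0) : (U * diagonal a * Uᵀ)⁻¹ = U * diagonal (fun i => (a i)⁻¹) * Uᵀ := by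
  refine Matrix.inv_eq_right_inv ?_
  rw [conj_diagonal_mul hU]
  simp only [mul_inv_cancel₀ (ha _), Matrix.diagonal_one, Matrix.mul_one, hU']

theorem dotProduct_conj_diagonal (a : Fin N → ℝ) (y : Fin N → ℝ) :
    y ⬝ᵥ ((U * diagonal a * Uᵀ) *ᵥ y) = ∑ k, a k * (Uᵀ *ᵥ y) k ^ 2 := by
  rw [← Matrix.mulVec_mulVec, ← Matrix.mulVec_mulVec, Matrix.dotProduct_mulVec,
    ← Matrix.mulVec_transpose]
  simp only [dotProduct, Matrix.mulVec_diagonal]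
  exact Finset.sum_congr rfl fun k _ => by ring

/-- The eigenvalues of the matrix are `dₖ/(t + dₖ)²`; one more factor `dₖ` appears because `(Uᵀy)ₖ²
= dₖ vₖ²`. -/
theorem dotProduct_ridgeMatrix (hU : Uᵀ * U = 1) (hU' : U * Uᵀ = 1)
    (hG : G = U * diagonal d * Uᵀ) (hd : ∀ i, 0 < d i) {t : ℝ} (ht : 0 < t) (y : Fin N → ℝ) :
    y ⬝ᵥ (ridgeMatrix G t *ᵥ y) =
      ∑ k, ((Uᵀ *ᵥ y) k / √(d k)) ^ 2 * (d k ^ 2 / (t + d k) ^ 2) := by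
  have h1 : G + t • (1 : Matrix (Fin N) (Fin N) ℝ) = U * diagonal (fun i => d i + t) * Uᵀ := by
    have : t • (1 : Matrix (Fin N) (Fin N) ℝ) = U * diagonal (fun _ => t) * Uᵀ := by
      rw [← Matrix.smul_one_eq_diagonal, Matrix.mul_smul, Matrix.mul_one, Matrix.smul_mul, hU']
    rw [this, hG, ← Matrix.add_mul, ← Matrix.mul_add, Matrix.diagonal_add]
  have hne : ∀ i, d i + t ≠ 0 := fun i => (add_pos (hd i) ht).ne'
  rw [ridgeMatrix, h1, conj_diagonal_inv hU hU' hne, sq, conj_diagonal_mul hU, hG,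
    conj_diagonal_mul hU, dotProduct_conj_diagonal]
  refine Finset.sum_congr rfl fun k _ => ?_
  have := hne k
  have hk := hd k
  have h2 : t + d k ≠ 0 := by rw [add_comm]; exact this
  rw [div_pow, Real.sq_sqrt hk.le, add_comm t]
  field_simp

theorem invKernelNorm_sq (hU : Uᵀ * U = 1) (hU' : U * Uᵀ = 1)
    (hG : G = U * diagonal d * Uᵀ) (hd : ∀ i, 0 < d i) (y : Fin N → ℝ) :
    invKernelNorm G y ^ 2 = ∑ k, ((Uᵀ *ᵥ y) k / √(d k)) ^ 2 := by
  have e : y ⬝ᵥ (G⁻¹ *ᵥ y) = ∑ k, ((Uᵀ *ᵥ y) k / √(d k)) ^ 2 := by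
    rw [hG, conj_diagonal_inv hU hU' fun i => (hd i).ne', dotProduct_conj_diagonal]
    refine Finset.sum_congr rfl fun k _ => ?_
    rw [div_pow, Real.sq_sqrt (hd k).le]
    ring
  rw [invKernelNorm, e, Real.sq_sqrt (Finset.sum_nonneg fun k _ => sq_nonneg _)]

end Spectral

/-! ### The optimal parameters in whitened coordinates. -/

section Parameters

variable {S : Type*} {N P : ℕ} {lam : ℝ}

/-- Compare the minimal loss with the loss at `θ = 0`. This deterministic bound supplies the
integrability of the predictor. -/
theorem sum_optimalParam_sq_le (hlam : 0 < lam) (hN : 0 < N) (φ : Fin P → S → ℝ) (X : Fin N → S)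
    (y : Fin N → ℝ) : ∑ j, optimalParam lam φ X y j ^ 2 ≤ (∑ i, y i ^ 2) / lam := by
  have hN' : (0 : ℝ) < N := by exact_mod_cast hN
  have hle : ridgeLoss lam φ X y (optimalParam lam φ X y) ≤ ridgeLoss lam φ X y 0 := by
    by_cases h : (0 : Fin P → ℝ) = optimalParam lam φ X y
    · rw [← h]
    · exact (ridgeLoss_optimalParam_lt hlam hN φ X y 0 h).le
  have h0 : ridgeLoss lam φ X y 0 = 1 / (N : ℝ) * ∑ i, y i ^ 2 := by
    simp [ridgeLoss, linearModel]
  have h1 : lam / N * ∑ j, optimalParam lam φ X y j ^ 2 ≤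
      ridgeLoss lam φ X y (optimalParam lam φ X y) := by
    unfold ridgeLoss
    have : 0 ≤ 1 / (N : ℝ) *
        ∑ i, (linearModel φ (optimalParam lam φ X y) (X i) - y i) ^ 2 :=
      mul_nonneg (by positivity) (Finset.sum_nonneg fun i _ => sq_nonneg _)
    linarith
  have h2 := h1.trans (hle.trans_eq h0)
  rw [le_div_iff₀ hlam]
  have h3 := mul_le_mul_of_nonneg_left h2 hN'.le
  calc _ = N * (lam / N * ∑ j, optimalParam lam φ X y j ^ 2) := by field_simp
    _ ≤ _ := h3
    _ = _ := by field_simp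

theorem abs_optimalParam_le (hlam : 0 < lam) (hN : 0 < N) (φ : Fin P → S → ℝ) (X : Fin N → S)
    (y : Fin N → ℝ) (j : Fin P) : |optimalParam lam φ X y j| ≤ √((∑ i, y i ^ 2) / lam) := by
  refine Real.abs_le_sqrt (le_trans ?_ (sum_optimalParam_sq_le hlam hN φ X y))
  exact Finset.single_le_sum (f := fun j => optimalParam lam φ X y j ^ 2)
    (fun _ _ => sq_nonneg _) (Finset.mem_univ j)

theorem weightedGram_eq_transpose_mul (u : Fin N → ℝ) (Z : Matrix (Fin N) (Fin P) ℝ) :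
    weightedGram u Z = Zᵀ * diagonal u * Z := by
  ext a b
  rw [Matrix.mul_apply]
  simp only [weightedGram, Matrix.sum_apply, Matrix.smul_apply, Matrix.vecMulVec_apply,
    smul_eq_mul, Matrix.mul_diagonal, Matrix.transpose_apply]
  exact Finset.sum_congr rfl fun k _ => by ring

/-- The optimal parameters in terms of the whitened data `diag(√d)⁻¹ Uᵀ Φ`, where
`Φ i j = φ j (X i)`. -/
theorem optimalParam_eq_paramVec (hlam : 0 < lam) (hP : 0 < P) {U : Matrix (Fin N) (Fin N) ℝ}
    {d : Fin N → ℝ} (hU' : U * Uᵀ = 1) (hd : ∀ i, 0 < d i) (φ : Fin P → S → ℝ)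
    (X : Fin N → S) (y : Fin N → ℝ) :
    optimalParam lam φ X y =
      paramVec lam (fun k => d k / P)
        (fun k => 1 / √(P : ℝ) * (d k * ((Uᵀ *ᵥ y) k / √(d k))))
        (fun k j => ∑ i, (√(d k))⁻¹ * U i k * φ j (X i)) := by
  have hP' : (0 : ℝ) < P := by exact_mod_cast hP
  set Φ : Matrix (Fin N) (Fin P) ℝ := Matrix.of fun i j => φ j (X i) with hΦ
  set D : Matrix (Fin N) (Fin N) ℝ := diagonal fun k => (√(d k))⁻¹ with hD
  have hZ : (fun k j => ∑ i, (√(d k))⁻¹ * U i k * φ j (X i)) = D * (Uᵀ * Φ) := by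
    ext k j
    rw [hD, Matrix.diagonal_mul, Matrix.mul_apply, Finset.mul_sum]
    exact Finset.sum_congr rfl fun i _ => by
      rw [Matrix.transpose_apply, hΦ, Matrix.of_apply]; ring
  have hF : dataMatrix φ X = (1 / √(P : ℝ)) • Φ := by
    ext i j
    simp [dataMatrix, hΦ]
  have hu : ∀ k, 0 ≤ d k / (P : ℝ) := fun k => div_nonneg (hd k).le hP'.le
  have hsq : ∀ k, √(d k) * √(d k) = d k := fun k => Real.mul_self_sqrt (hd k).le
  have hs0 : ∀ k, √(d k) ≠ 0 := fun k => (Real.sqrt_pos.2 (hd k)).ne'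
  have hPP : 1 / √(P : ℝ) * (1 / √(P : ℝ)) = 1 / P := by
    rw [div_mul_div_comm, one_mul, Real.mul_self_sqrt hP'.le]
  -- The weights `dₖ/P` undo the whitening, and `U Uᵀ = 1` removes the rotation.
  have hW : weightedGram (fun k => d k / (P : ℝ)) (D * (Uᵀ * Φ)) =
      (dataMatrix φ X)ᵀ * dataMatrix φ X := by
    rw [weightedGram_eq_transpose_mul, hF, Matrix.transpose_smul, Matrix.smul_mul, Matrix.mul_smul,
      smul_smul, hPP, Matrix.transpose_mul D, hD, Matrix.diagonal_transpose]
    have e : diagonal (fun k => (√(d k))⁻¹) * diagonal (fun k => d k / (P : ℝ)) *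
        diagonal (fun k => (√(d k))⁻¹) = (1 / (P : ℝ)) • (1 : Matrix (Fin N) (Fin N) ℝ) := by
      rw [Matrix.diagonal_mul_diagonal, Matrix.diagonal_mul_diagonal, Matrix.smul_one_eq_diagonal]
      congr 1
      funext k
      have := hsq k
      have := hs0 k
      field_simp
      rw [sq, hsq k]
    calc _ = (Uᵀ * Φ)ᵀ * (diagonal (fun k => (√(d k))⁻¹) * diagonal (fun k => d k / (P : ℝ)) *
        diagonal (fun k => (√(d k))⁻¹)) * (Uᵀ * Φ) := by simp only [Matrix.mul_assoc]
      _ = (1 / (P : ℝ)) • (Φᵀ * (U * Uᵀ) * Φ) := by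
        rw [e, Matrix.mul_smul, Matrix.mul_one, Matrix.smul_mul, Matrix.transpose_mul,
          Matrix.transpose_transpose]
        simp only [Matrix.mul_assoc]
      _ = _ := by rw [hU', Matrix.mul_one]
  have hvec : ∑ k, (1 / √(P : ℝ) * (d k * ((Uᵀ *ᵥ y) k / √(d k)))) • (D * (Uᵀ * Φ)) k =
      (dataMatrix φ X)ᵀ *ᵥ y := by
    have e1 : ∀ k, (1 / √(P : ℝ) * (d k * ((Uᵀ *ᵥ y) k / √(d k)))) • (D * (Uᵀ * Φ)) k =
        (1 / √(P : ℝ)) • (Uᵀ *ᵥ y) k • (Uᵀ * Φ) k := fun k => by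
      ext j
      simp only [Pi.smul_apply, smul_eq_mul, hD, Matrix.diagonal_mul]
      have h1 : d k * ((Uᵀ *ᵥ y) k / √(d k)) * (√(d k))⁻¹ = (Uᵀ *ᵥ y) k := by
        have h2 := hs0 k
        have h3 := hsq k
        generalize √(d k) = s at h2 h3 ⊢
        rw [← h3]
        field_simp
      calc _ = 1 / √(P : ℝ) * (d k * ((Uᵀ *ᵥ y) k / √(d k)) * (√(d k))⁻¹ * (Uᵀ * Φ) k j) := by ring
        _ = _ := by rw [h1]
    simp only [e1, ← Finset.smul_sum]
    have e2 : ∑ k, (Uᵀ *ᵥ y) k • (Uᵀ * Φ) k = (Uᵀ * Φ)ᵀ *ᵥ (Uᵀ *ᵥ y) := by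
      ext j
      simp only [Finset.sum_apply, Pi.smul_apply, smul_eq_mul]
      exact Finset.sum_congr rfl fun k _ => mul_comm _ _
    rw [e2, Matrix.transpose_mul, Matrix.transpose_transpose, Matrix.mulVec_mulVec,
      Matrix.mul_assoc, hU', Matrix.mul_one, hF, Matrix.transpose_smul, Matrix.smul_mulVec]
  have hR : resolvent lam (fun k => d k / (P : ℝ)) (D * (Uᵀ * Φ)) =
      (lam • (1 : Matrix (Fin P) (Fin P) ℝ) + (dataMatrix φ X)ᵀ * dataMatrix φ X)⁻¹ := by
    rw [← hW]
    rfl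
  rw [hZ]
  unfold paramVec
  rw [hvec, hR]
  set F := dataMatrix φ X with hF'
  have hpd : (F * Fᵀ + lam • (1 : Matrix (Fin N) (Fin N) ℝ)).PosDef := by
    refine Matrix.PosDef.posSemidef_add ?_ (Matrix.PosDef.one.smul hlam)
    simpa [Matrix.conjTranspose_eq_transpose_of_trivial] using
      Matrix.posSemidef_self_mul_conjTranspose F
  -- Push-through identity, which trades the `N × N` resolvent of the definition for the `P × P`
  -- one.
  have hpush : (lam • (1 : Matrix (Fin P) (Fin P) ℝ) + Fᵀ * F) * Fᵀ =
      Fᵀ * (F * Fᵀ + lam • (1 : Matrix (Fin N) (Fin N) ℝ)) := by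
    rw [Matrix.add_mul, Matrix.mul_add, Matrix.smul_mul, Matrix.one_mul, Matrix.mul_smul,
      Matrix.mul_one, Matrix.mul_assoc, add_comm]
  have hH : (lam • (1 : Matrix (Fin P) (Fin P) ℝ) + Fᵀ * F)⁻¹ *
      (lam • (1 : Matrix (Fin P) (Fin P) ℝ) + Fᵀ * F) = 1 := by
    have := resolvent_mul hlam hu (D * (Uᵀ * Φ))
    rwa [hR, hW] at this
  have hA : (F * Fᵀ + lam • (1 : Matrix (Fin N) (Fin N) ℝ)) *
      (F * Fᵀ + lam • (1 : Matrix (Fin N) (Fin N) ℝ))⁻¹ = 1 :=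
    Matrix.mul_nonsing_inv _ ((Matrix.isUnit_iff_isUnit_det _).1 hpd.isUnit)
  rw [optimalParam, ← hF', Matrix.mulVec_mulVec, Matrix.mulVec_mulVec]
  congr 1
  calc Fᵀ * (F * Fᵀ + lam • (1 : Matrix (Fin N) (Fin N) ℝ))⁻¹ =
        ((lam • (1 : Matrix (Fin P) (Fin P) ℝ) + Fᵀ * F)⁻¹ *
          (lam • (1 : Matrix (Fin P) (Fin P) ℝ) + Fᵀ * F)) * Fᵀ *
          (F * Fᵀ + lam • (1 : Matrix (Fin N) (Fin N) ℝ))⁻¹ := by rw [hH, Matrix.one_mul]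
    _ = (lam • (1 : Matrix (Fin P) (Fin P) ℝ) + Fᵀ * F)⁻¹ * Fᵀ *
          ((F * Fᵀ + lam • (1 : Matrix (Fin N) (Fin N) ℝ)) *
          (F * Fᵀ + lam • (1 : Matrix (Fin N) (Fin N) ℝ))⁻¹) := by
        rw [Matrix.mul_assoc _ _ Fᵀ, hpush]; simp only [Matrix.mul_assoc]
    _ = _ := by rw [hA, Matrix.mul_one]

end Parameters

/-! ### Covariances of the whitened data and the regression residual. -/

section Whitening

variable {S : Type*} {N P : ℕ} {K : S → S → ℝ} {X : Fin N → S} {x : S}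
  {U : Matrix (Fin N) (Fin N) ℝ} {d w : Fin N → ℝ}

/-- The data points, preceded by the test point `x`. -/
def testAndData (X : Fin N → S) (x : S) : Option (Fin N) → S
  | none => x
  | some i => X i

/-- The coefficients of the whitened data (rows `some k`) and of the residual of the regression of
the value at the test point on the data (row `none`). -/
noncomputable def whitening (U : Matrix (Fin N) (Fin N) ℝ) (d w : Fin N → ℝ) :
    Option (Fin N) → Option (Fin N) → ℝ
  | none, none => 1
  | none, some i => -w i
  | some _, none => 0
  | some k, some i => (√(d k))⁻¹ * U i k

/-- The covariance of two combinations of values of the process. -/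
noncomputable def combCov (K : S → S → ℝ) (X : Fin N → S) (x : S)
    (α β : Option (Fin N) → ℝ) : ℝ :=
  ∑ q, ∑ q', α q * β q' * K (testAndData X x q) (testAndData X x q')

theorem combCov_eq (α β : Option (Fin N) → ℝ) :
    combCov K X x α β = α none * (β none * K x x + (fun i => K x (X i)) ⬝ᵥ fun i => β (some i)) +
      (fun i => α (some i)) ⬝ᵥ (β none • (fun i => K (X i) x) +
        gram K X *ᵥ fun i => β (some i)) := by
  simp only [combCov, Fintype.sum_option, testAndData, dotProduct, Pi.add_apply, Pi.smul_apply,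
    smul_eq_mul, Matrix.mulVec, gram, Matrix.of_apply, mul_add, Finset.mul_sum]
  congr 1
  · congr 1
    · ring
    · exact Finset.sum_congr rfl fun i _ => by ring
  · refine Finset.sum_congr rfl fun i _ => ?_
    congr 1
    · ring
    · exact Finset.sum_congr rfl fun i _ => by ring

theorem combCov_whitening_some (hU : Uᵀ * U = 1) (hG : gram K X = U * diagonal d * Uᵀ)
    (hd : ∀ i, 0 < d i) (k l : Fin N) :
    combCov K X x (whitening U d w (some k)) (whitening U d w (some l)) =
      if k = l then 1 else 0 := by
  have hs : ∀ k, √(d k) * √(d k) = d k := fun k => Real.mul_self_sqrt (hd k).le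
  have hs0 : ∀ k, √(d k) ≠ 0 := fun k => (Real.sqrt_pos.2 (hd k)).ne'
  have e : ∀ k, (fun i => (√(d k))⁻¹ * U i k) = U *ᵥ Pi.single k (√(d k))⁻¹ := fun k => by
    ext i
    rw [Matrix.mulVec_single]
    simp [mul_comm]
  rw [combCov_eq]
  simp only [whitening, zero_mul, zero_smul, zero_add]
  rw [e k, e l, Matrix.mulVec_mulVec, hG, Matrix.mul_assoc, hU, Matrix.mul_one,
    ← Matrix.mulVec_mulVec, Matrix.dotProduct_mulVec, ← Matrix.mulVec_transpose,
    Matrix.mulVec_mulVec, hU, Matrix.one_mulVec, Matrix.diagonal_mulVec_single]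
  simp only [single_dotProduct]
  by_cases h : k = l
  · subst h
    rw [Pi.single_eq_same, if_pos rfl]
    have h2 := hs0 k
    have h3 := hs k
    generalize √(d k) = s at h2 h3 ⊢
    rw [← h3]
    field_simp
  · rw [Pi.single_eq_of_ne h, if_neg h, mul_zero]

/-- The normal equations `K(X,X) w = K(X,x)` say that the residual is uncorrelated with every data
value. -/
theorem combCov_whitening_some_none (hw : gram K X *ᵥ w = fun i => K (X i) x) (k : Fin N) :
    combCov K X x (whitening U d w (some k)) (whitening U d w none) = 0 := by
  rw [combCov_eq]
  simp only [whitening, zero_mul, one_smul, zero_add]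
  rw [show (fun i => -w i) = -w from rfl, Matrix.mulVec_neg, hw, add_neg_cancel, dotProduct_zero]

theorem combCov_whitening_none (hw : gram K X *ᵥ w = fun i => K (X i) x)
    (hw' : w = (gram K X)⁻¹ *ᵥ fun i => K (X i) x) :
    combCov K X x (whitening U d w none) (whitening U d w none) = posteriorCov K X x x := by
  rw [combCov_eq]
  simp only [whitening, one_mul, one_smul]
  rw [show (fun i => -w i) = -w from rfl, Matrix.mulVec_neg, hw, add_neg_cancel, dotProduct_zero,
    add_zero, dotProduct_neg, posteriorCov, ← hw', sub_eq_add_neg]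

theorem combCov_comm (hK : ∀ a b, K a b = K b a) (α β : Option (Fin N) → ℝ) :
    combCov K X x α β = combCov K X x β α := by
  unfold combCov
  rw [Finset.sum_comm]
  refine Finset.sum_congr rfl fun q _ => Finset.sum_congr rfl fun q' _ => ?_
  rw [hK]; ring

end Whitening

/-! ### Variance of the predictor and conclusion. -/

section Main

variable {S Ω : Type*} [MeasurableSpace Ω] {μ : Measure Ω} {N P : ℕ} {K : S → S → ℝ}
  {f : Fin P → S → Ω → ℝ} {X : Fin N → S} {U : Matrix (Fin N) (Fin N) ℝ} {d : Fin N → ℝ}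
  {lam : ℝ}

theorem IsGaussianFeatures.symm (hf : IsGaussianFeatures K f μ) (hP : 0 < P) (a b : S) :
    K a b = K b a := by
  rw [← hf.covariance ⟨0, hP⟩ a b, ← hf.covariance ⟨0, hP⟩ b a]
  simp only [mul_comm]

theorem posteriorCov_le (hK : ∀ a b, K a b = K b a) (hX : (gram K X).PosDef) (x : S) :
    posteriorCov K X x x ≤ K x x := by
  have h := hX.inv.posSemidef.dotProduct_mulVec_nonneg (fun i => K (X i) x)
  rw [posteriorCov]
  simp only [star_trivial] at h
  simp only [hK x]
  linarith

/-- The variance of the random feature predictor is at least the posterior variance times the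
mean square norm of the optimal parameters, divided by `P`. -/
theorem le_variance_rfPredictor (hf : IsGaussianFeatures K f μ) (hlam : 0 < lam) (hN : 0 < N)
    (hP : 0 < P) (hX : (gram K X).PosDef) (hU : Uᵀ * U = 1) (hU' : U * Uᵀ = 1)
    (hG : gram K X = U * diagonal d * Uᵀ) (hd : ∀ i, 0 < d i) (y : Fin N → ℝ) (x : S) :
    0 ≤ posteriorCov K X x x ∧
    MemLp (fun ω => rfPredictor lam (fun j z => f j z ω) X y x) 2 μ ∧
    1 / P * posteriorCov K X x x *
      ∫ Z, paramVec lam (fun k => d k / P)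
          (fun k => 1 / √(P : ℝ) * (d k * ((Uᵀ *ᵥ y) k / √(d k)))) Z ⬝ᵥ
        paramVec lam (fun k => d k / P)
          (fun k => 1 / √(P : ℝ) * (d k * ((Uᵀ *ᵥ y) k / √(d k)))) Z
        ∂(gaussRows (Fin N) (Fin P)) ≤
      variance (fun ω => rfPredictor lam (fun j z => f j z ω) X y x) μ := by
  have hprob := hf.indep.isProbabilityMeasure
  have hP' : (0 : ℝ) < P := by exact_mod_cast hP
  have hK := hf.symm hP
  have hs : ∀ k, √(d k) * (√(d k))⁻¹ = 1 := fun k =>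
    mul_inv_cancel₀ (Real.sqrt_pos.2 (hd k)).ne'
  set w := (gram K X)⁻¹ *ᵥ fun i => K (X i) x with hw'
  have hw : gram K X *ᵥ w = fun i => K (X i) x := by
    rw [hw', Matrix.mulVec_mulVec,
      Matrix.mul_nonsing_inv _ ((Matrix.isUnit_iff_isUnit_det _).1 hX.isUnit), Matrix.one_mulVec]
  set p := testAndData X x with hp
  set A := whitening U d w with hA
  set W : Fin P → Option (Fin N) → Ω → ℝ := fun j o ω => ∑ q, A o q * f j (p q) ω with hW
  have hWm : ∀ j o, Measurable (W j o) := fun j o =>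
    Finset.measurable_sum _ fun q _ => (hf.measurable j (p q)).const_mul _
  have hWG : ∀ j, HasGaussianLaw (fun ω o => W j o ω) μ := hf.hasGaussianLaw_comb p A
  have hWI : iIndepFun (fun j ω o => W j o ω) μ := hf.iIndepFun_comb p A
  have hW0 : ∀ j o, ∫ ω, W j o ω ∂μ = 0 := fun j o => hf.integral_comb p (A o) j
  have hWL : ∀ j o, MemLp (W j o) 2 μ := fun j o => hf.memLp_comb p (A o) j
  have hcov : ∀ j o o', ∫ ω, W j o ω * W j o' ω ∂μ = combCov K X x (A o) (A o') :=
    fun j o o' => hf.integral_comb_mul p (A o) (A o') j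
  have hoff : ∀ j o o', o ≠ o' → ∫ ω, W j o ω * W j o' ω ∂μ = 0 := by
    rintro j (_ | k) (_ | l) h
    · exact absurd rfl h
    · rw [hcov, combCov_comm hK]
      exact combCov_whitening_some_none hw l
    · rw [hcov]
      exact combCov_whitening_some_none hw k
    · rw [hcov, combCov_whitening_some hU hG hd, if_neg fun e => h (congrArg some e)]
  -- The residual row `none` and the whitened data rows `some k` become independent as rows of one
  -- jointly Gaussian matrix.
  have hrows := iIndepFun_rows hWG hWI hW0 hoff
  set ζ : Ω → Fin N → Fin P → ℝ := fun ω k j => W j (some k) ω with hζ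
  have hζm : Measurable ζ := by
    refine measurable_pi_lambda _ fun k => measurable_pi_lambda _ fun j => hWm j (some k)
  have hlaw : μ.map ζ = gaussRows (Fin N) (Fin P) := by
    have h := hrows.precomp (Option.some_injective (Fin N))
    have h2 := iIndepFun.map_fun_eq_pi_map
      (fun k => (measurable_pi_lambda _ fun j => hWm j (some k)).aemeasurable) h
    refine h2.trans ?_
    rw [gaussRows]
    congr 1
    ext1 k
    refine map_row_eq_stdGauss hWG hWI hW0 (some k) fun j => ?_
    simp only [sq]
    rw [hcov, combCov_whitening_some hU hG hd, if_pos rfl]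
  have hind : IndepFun ζ (fun ω j => W j none ω) μ := by
    have h := hrows.indepFun_finset (Finset.univ.image some) {none} (by simp)
      fun o => measurable_pi_lambda _ fun j => hWm j o
    exact h.comp
      (φ := fun (z : ↥(Finset.univ.image (some : Fin N → Option (Fin N))) → Fin P → ℝ) k =>
        z ⟨some k, by simp⟩)
      (ψ := fun (z : ↥({none} : Finset (Option (Fin N))) → Fin P → ℝ) => z ⟨none, by simp⟩)
      (by fun_prop) (by fun_prop)
  set s := posteriorCov K X x x with hs_def
  have hnn : ∀ j, ∫ ω, W j none ω * W j none ω ∂μ = s := fun j =>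
    (hcov j none none).trans (combCov_whitening_none hw hw')
  have hs0 : 0 ≤ s := by
    rw [← hnn ⟨0, hP⟩]
    exact integral_nonneg fun ω => mul_self_nonneg _
  set c : Fin N → ℝ := fun k => 1 / √(P : ℝ) * (d k * ((Uᵀ *ᵥ y) k / √(d k))) with hc
  set θ : (Fin N → Fin P → ℝ) → Fin P → ℝ := paramVec lam (fun k => d k / P) c with hθ
  have hθc : Continuous θ := continuous_paramVec hlam (fun k => div_nonneg (hd k).le hP'.le) c
  have hζe : ∀ ω, ζ ω = fun k j => ∑ i, (√(d k))⁻¹ * U i k * f j (X i) ω := fun ω => by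
    funext k j
    simp only [hζ, hW, hA, hp, Fintype.sum_option, whitening, testAndData, zero_mul, zero_add]
  have hopt : ∀ ω, optimalParam lam (fun j z => f j z ω) X y = θ (ζ ω) := fun ω => by
    rw [hζe, hθ, hc]
    exact optimalParam_eq_paramVec hlam hP hU' hd _ X y
  -- Inverts the whitening, so that the regression part of the features is a function of `ζ`.
  have hdata : ∀ ω j i, f j (X i) ω = ∑ k, U i k * √(d k) * ζ ω k j := fun ω j i => by
    have e : ∀ k, U i k * √(d k) * ζ ω k j = ∑ i', U i k * U i' k * f j (X i') ω := fun k => by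
      rw [hζe, Finset.mul_sum]
      refine Finset.sum_congr rfl fun i' _ => ?_
      calc _ = √(d k) * (√(d k))⁻¹ * (U i k * U i' k * f j (X i') ω) := by ring
        _ = _ := by rw [hs, one_mul]
    simp only [e]
    rw [Finset.sum_comm]
    have e2 : ∀ i', ∑ k, U i k * U i' k = (1 : Matrix (Fin N) (Fin N) ℝ) i i' := fun i' => by
      rw [← hU', Matrix.mul_apply]
      rfl
    simp only [← Finset.sum_mul, e2, Matrix.one_apply, ite_mul, one_mul, zero_mul,
      Finset.sum_ite_eq, Finset.mem_univ, if_true]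
  set h : Fin P → (Fin N → Fin P → ℝ) → ℝ := fun j Z => ∑ i, w i * ∑ k, U i k * √(d k) * Z k j
    with hh
  have hhe : ∀ j ω, h j (ζ ω) = ∑ i, w i * f j (X i) ω := fun j ω => by
    simp only [hh, hdata]
  have hpred : (fun ω => rfPredictor lam (fun j z => f j z ω) X y x) =
      fun ω => 1 / √(P : ℝ) * ∑ j, θ (ζ ω) j * (h j (ζ ω) + W j none ω) := by
    funext ω
    rw [rfPredictor, linearModel, hopt]
    congr 1
    refine Finset.sum_congr rfl fun j _ => ?_
    rw [hhe]
    simp only [hW, hA, hp, Fintype.sum_option, whitening, testAndData, one_mul, neg_mul,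
      Finset.sum_neg_distrib]
    ring
  have key := le_variance_of_indep_noise (μ := μ) (ζ := ζ) (g := fun j => W j none)
    (θ := fun j Z => θ Z j) (h := h) (C := √((∑ i, y i ^ 2) / lam)) (c := 1 / √(P : ℝ)) (s := s)
    hζm (fun j => hWm j none) hind (fun j => ((continuous_apply j).comp hθc).measurable)
    (fun j => by simp only [hh]; fun_prop)
    (fun j ω => by
      rw [← hopt]
      exact abs_optimalParam_le hlam hN _ X y j)
    (fun j => by
      simp only [hhe]
      exact hf.memLp_comb X w j)
    (fun j => hWL j none) (fun j => hW0 j none)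
    (fun i j => by
      by_cases hij : i = j
      · subst hij
        rw [if_pos rfl]
        exact hnn i
      · rw [if_neg hij]
        have h1 : IndepFun (W i none) (W j none) μ :=
          (hWI.indepFun hij).comp (φ := fun w : Option (Fin N) → ℝ => w none)
            (ψ := fun w : Option (Fin N) → ℝ => w none)
            (measurable_pi_apply none) (measurable_pi_apply none)
        rw [h1.integral_fun_mul_eq_mul_integral (hWm i none).aestronglyMeasurable
          (hWm j none).aestronglyMeasurable, hW0, zero_mul])
  rw [hpred]
  refine ⟨hs0, key.1, le_trans (le_of_eq ?_) key.2⟩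
  have hI : ∫ Z, θ Z ⬝ᵥ θ Z ∂(gaussRows (Fin N) (Fin P)) = ∫ ω, ∑ j, θ (ζ ω) j ^ 2 ∂μ := by
    rw [← hlaw, integral_map hζm.aemeasurable
      (hθc.dotProduct hθc).aestronglyMeasurable]
    simp only [dotProduct, sq]
  rw [hI, div_pow, one_pow, Real.sq_sqrt hP'.le]

end Main

end RandomFeatures

theorem corollary5p3 (lam γ T : ℝ) (hlam : 0 < lam) (hγ : 0 < γ) (hT : 0 < T) :
    ∃ c₄ : ℝ, 0 < c₄ ∧
      ∀ (d N P : ℕ) (_ : 0 < N) (_ : 0 < P) (_ : (P : ℝ) / N = γ)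
        (K : EuclideanSpace ℝ (Fin d) → EuclideanSpace ℝ (Fin d) → ℝ)
        (_ : (Matrix.of K).PosSemidef)
        (X : Fin N → EuclideanSpace ℝ (Fin d)) (hX : (RandomFeatures.gram K X).PosDef)
        (_ : (1 / (N : ℝ)) * (RandomFeatures.gram K X).trace = T)
        (y : Fin N → ℝ)
        (Ω : Type*) [MeasurableSpace Ω] (μ : Measure Ω) [IsProbabilityMeasure μ]
        (f : Fin P → EuclideanSpace ℝ (Fin d) → Ω → ℝ)
        (_ : RandomFeatures.IsGaussianFeatures K f μ)
        (x : EuclideanSpace ℝ (Fin d)),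
        -- `effectiveRidge hX.isHermitian.eigenvalues γ` is the function `λ ↦ λ̃(λ, γ)`
        DifferentiableAt ℝ (RandomFeatures.effectiveRidge hX.isHermitian.eigenvalues γ) lam ∧
        MemLp (fun ω => RandomFeatures.rfPredictor lam (fun j z => f j z ω) X y x) 2 μ ∧
        deriv (RandomFeatures.effectiveRidge hX.isHermitian.eigenvalues γ) lam
              * ((y ⬝ᵥ (RandomFeatures.ridgeMatrix (RandomFeatures.gram K X)
                    (RandomFeatures.effectiveRidge hX.isHermitian.eigenvalues γ lam) *ᵥ y)) / P)
              * RandomFeatures.posteriorCov K X x x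
            - c₄ * K x x * RandomFeatures.invKernelNorm (RandomFeatures.gram K X) y ^ 2
                / (P : ℝ) ^ 2
          ≤ variance (fun ω => RandomFeatures.rfPredictor lam (fun j z => f j z ω) X y x) μ := by
  -- The two parameters are `N/P = 1/γ` and `(∑ dₖ)/P = T/γ`, so the constant depends only on `λ, γ,
  -- T`.
  have hC := RandomFeatures.lowerConst_pos (r := 1 / γ) (τ := T / γ) hlam (by positivity) (by positivity)
  refine ⟨RandomFeatures.lowerConst lam (1 / γ) (T / γ), hC, ?_⟩
  intro n N P hN hP hPN K _ X hX htr y Ω _ μ _ f hf x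
  have hN' : (0 : ℝ) < N := by exact_mod_cast hN
  have hP' : (0 : ℝ) < P := by exact_mod_cast hP
  set d := hX.isHermitian.eigenvalues with hd_def
  have hd : ∀ i, 0 < d i := hX.eigenvalues_pos
  set U : Matrix (Fin N) (Fin N) ℝ := hX.isHermitian.eigenvectorUnitary.1 with hU_def
  have hU : Uᵀ * U = 1 := by
    have := Matrix.UnitaryGroup.star_mul_self hX.isHermitian.eigenvectorUnitary
    rwa [Matrix.star_eq_conjTranspose, Matrix.conjTranspose_eq_transpose_of_trivial] at this
  have hU' : U * Uᵀ = 1 := mul_eq_one_comm.1 hU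
  have hG : RandomFeatures.gram K X = U * diagonal d * Uᵀ := by
    have := hX.isHermitian.spectral_theorem
    rw [Unitary.conjStarAlgAut_apply, Matrix.star_eq_conjTranspose,
      Matrix.conjTranspose_eq_transpose_of_trivial] at this
    exact this
  have hγN : γ * N = P := by rw [← hPN]; field_simp
  have hr : (N : ℝ) / P = 1 / γ := by rw [← hγN]; field_simp
  have hsum : ∑ k, d k = N * T := by
    rw [← htr, hX.isHermitian.trace_eq_sum_eigenvalues]
    simp only [RCLike.ofReal_real_eq_id, id_eq]
    field_simp
    rfl
  have hτ : (∑ k, d k) / P = T / γ := by rw [hsum, ← hγN]; field_simp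
  have hNγ : 1 / γ * (1 / (N : ℝ)) = 1 / P := by rw [← hγN]; field_simp
  obtain ⟨ht, hte⟩ := RandomFeatures.isEffectiveRidge_effectiveRidge (fun i => (hd i).le) hγ hlam
  have hder := RandomFeatures.hasDerivAt_effectiveRidge (fun i => (hd i).le) hγ hlam
  set t := RandomFeatures.effectiveRidge d γ lam with ht_def
  have hte' : t = lam + t / P * ∑ k, d k / (t + d k) := by
    have e : t / P = t / γ * (1 / (N : ℝ)) := by
      rw [div_eq_mul_one_div t, ← hNγ]
      ring
    rwa [e, mul_assoc]
  rw [← mul_assoc, hNγ] at hder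
  obtain ⟨hs0, hL, hvar⟩ :=
    RandomFeatures.le_variance_rfPredictor hf hlam hN hP hX hU hU' hG hd y x
  refine ⟨hder.differentiableAt, hL, le_trans ?_ hvar⟩
  have hlow := RandomFeatures.le_integral_paramVec hlam hP (fun k => (hd k).le) hr hτ ht hte'
    (fun k => (Uᵀ *ᵥ y) k / √(d k))
  rw [hder.deriv, RandomFeatures.dotProduct_ridgeMatrix hU hU' hG hd ht,
    RandomFeatures.invKernelNorm_sq hU hU' hG hd]
  have hsK := RandomFeatures.posteriorCov_le (hf.symm hP) hX x
  set s := RandomFeatures.posteriorCov K X x x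
  have hV : 0 ≤ ∑ k, ((Uᵀ *ᵥ y) k / √(d k)) ^ 2 := Finset.sum_nonneg fun k _ => sq_nonneg _
  set V := ∑ k, ((Uᵀ *ᵥ y) k / √(d k)) ^ 2
  set C := RandomFeatures.lowerConst lam (1 / γ) (T / γ)
  have h1 : s * (C * V / P ^ 2) ≤ K x x * (C * V / P ^ 2) :=
    mul_le_mul_of_nonneg_right hsK (by positivity)
  -- Multiplying by the posterior variance over `P` turns the error `C V / P` into order `1/P²`.
  have h2 := mul_le_mul_of_nonneg_left hlow (show 0 ≤ 1 / (P : ℝ) * s by positivity)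
  refine le_trans ?_ h2
  set D := (1 - 1 / (P : ℝ) * ∑ k, d k ^ 2 / (t + d k) ^ 2)⁻¹
  set R := ∑ k, ((Uᵀ *ᵥ y) k / √(d k)) ^ 2 * (d k ^ 2 / (t + d k) ^ 2)
  calc D * (R / P) * s - C * K x x * V / (P : ℝ) ^ 2
      = D * (R / P) * s - K x x * (C * V / (P : ℝ) ^ 2) := by ring
    _ ≤ D * (R / P) * s - s * (C * V / (P : ℝ) ^ 2) := sub_le_sub_left h1 _
    _ = 1 / (P : ℝ) * s * (D * R - C / P * V) := by ring
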